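/- **Setting.** Let $T>0$, let $\Omega=\prod_{i=1}^n[l_i,h_i]$ ($l_i<h_i$) be a rectangle with opposite faces identified (periodic boundary conditions), and let $f(x,t,\alpha)=A(x,t)\alpha+b(x,t)$ with $A:\Omega\times[0,T]\to\mathbb R^{n\times m}$ and $b:\Omega\times[0,T]\to\mathbb R^n$ continuous. Let $L:\Omega\times[0,T]\times\mathbb R^m\to[0,+\infty]$ be Borel measurable and such that, for every $(x,t)$, $L(x,t,\cdot)$ is proper, convex, lower semicontinuous, $1$-coercive ($L(x,t,\alpha)/\|\alpha\|\to+\infty$ as $\|\alpha\|\to\infty$) and satisfies $L(x,t,0)=0$. Write $A_{x,t}=A(x,T-t)$, $b_{x,t}=b(x,T-t)$, $L_{x,t}=L(x,T-t,\cdot)$. Let $c\in\mathbb R$, and let $g:\Omega\to\mathbb R$ be the trace at $t=0$ of some $H^1$ function. Let $X=H^1(\Omega\times[0,T])$ (periodic in $x$), with $\|\varphi\|_{H^1}^2=\|\varphi\|_{L^2}^2+\|\partial_t\varphi\|_{L^2}^2+\|\nabla_x\varphi\|_{L^2}^2$, and $Y=L^2(\Omega\times[0,T])\times L^2(\Omega\times[0,T];\mathbb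 R^m)$ with $\|(\rho,m)\|^2=\|\rho\|_{L^2}^2+\|m\|_{L^2}^2$. Define $$K(\varphi,\rho,m)=\int_0^T\!\!\int_\Omega \rho\,\partial_t\varphi-\langle A_{x,t}m,\nabla_x\varphi\rangle-\rho\,\langle b_{x,t},\nabla_x\varphi\rangle\,dx\,dt,$$ $$G(\varphi)=-c\int_\Omega\varphi(x,T)\,dx\ \text{ if }\varphi(\cdot,0)=g,\qquad G(\varphi)=+\infty\ \text{ otherwise},$$ $$\hat F(\rho,m)=\int_0^T\!\!\int_\Omega \rho\,L_{x,t}\!\left(\tfrac m\rho\right)+\mathrm{ind}_{[0,\infty)}(\rho)\,dx\,dt,$$ where $\varphi(\cdot,0)$, $\varphi(\cdot,T)$ are traces in $L^2(\Omega)$ (characterized by integration by parts in time), and $\rho L_{x,t}(m/\rho)$ means $\mathrm{ind}_{\{0\}}(m)$ where $\rho=0$. Let $F=\hat F^*$ be the Fenchel–Legendre transform of $\hat F$ on the Hilbert space $Y$. **Claims.** 1. (Change of variable.) If $\varphi\in X$, $(\rho,m)\in Y$, $\rho\ge0$ and $m=\rho\alpha$ a.e., then $K(\varphi,\rho,m)+G(\varphi)-\hat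 F(\rho,m)$ equals the objective in the variables $(\varphi,\rho,\alpha)$, $$\int_0^T\!\!\int_\Omega\rho\big(\partial_t\varphi-\langle A_{x,t}\alpha+b_{x,t},\nabla_x\varphi\rangle\big)dx\,dt-\int_0^T\!\!\int_\Omega\rho\,L_{x,t}(\alpha)\,dx\,dt+G(\varphi).$$ Conversely, if $\hat F(\rho,m)<+\infty$ then $\rho\ge0$ and $m=\rho\alpha$ a.e. for some measurable $\alpha$. 2. Every $\varphi\in X$ has unique traces $\varphi(\cdot,0),\varphi(\cdot,T)\in L^2(\Omega)$. The functions $G$ on $X$ and $\hat F$, $F$ on $Y$ are proper, convex and lower semicontinuous, and $\hat F=F^*$. 3. The integral defining $K$ is absolutely convergent, $K$ is bilinear in $\varphi$ and $(\rho,m)$, and, with $\beta=\sup_{x,t}\|b(x,t)\|_\infty$ and $a=\sup_{x,t,i,j}|A_{ij}(x,t)|$, $$|K(\varphi,\rho,m)|\le\sqrt{n+1}\,\max\{1,\beta\}\,\|\rho\|_{L^2}\|\varphi\|_{H^1}+\sqrt{nm}\,a\,\|m\|_{L^2}\|\varphi\|_{H^1},$$ so that $K$ is bounded with $\|K\|\le(n+1)\max\{1,\beta\}^2+nm\,a^2$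 (in the factors $\sqrt{nm}$ and $nm$, $m$ is the dimension of the control). 4. For all $\tau_\varphi,\tau_{\rho,m}>0$ the updates $$(\rho^{\ell+1},m^{\ell+1})=\operatorname*{argmax}_{(\rho,m)\in Y}\Big\{K(\tilde\varphi^\ell,\rho,m)-F^*(\rho,m)-\tfrac1{2\tau_{\rho,m}}\big(\|\rho-\rho^\ell\|_{L^2}^2+\|m-m^\ell\|_{L^2}^2\big)\Big\},$$ $$\varphi^{\ell+1}=\operatorname*{argmin}_{\varphi\in X}\Big\{K(\varphi,\rho^{\ell+1},m^{\ell+1})+G(\varphi)+\tfrac1{2\tau_\varphi}\|\varphi-\varphi^\ell\|_{H^1}^2\Big\},\qquad \tilde\varphi^{\ell+1}=2\varphi^{\ell+1}-\varphi^\ell$$ are well defined: each argmax and argmin exists and is unique. 5. Suppose that $\min_{\varphi\in X}\max_{(\rho,m)\in Y}K(\varphi,\rho,m)+G(\varphi)-F^*(\rho,m)$ has a saddle point and that $\tau_\varphi,\tau_{\rho,m}>0$ satisfy $\tau_\varphi\tau_{\rho,m}\|K\|^2<1$, where $\|K\|$ is the operator norm of $K$. Then, for arbitrary initial values $\varphi^0,\tilde\varphi^0\in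 X$, $(\rho^0,m^0)\in Y$, the averages $(\bar\varphi^\ell,\bar\rho^\ell,\bar m^\ell)=\frac1\ell\sum_{j=1}^\ell(\varphi^j,\rho^j,m^j)$ have a subsequence that converges weakly in $X\times Y$ to a saddle point. -/

import Mathlib

open MeasureTheory Set Filter Topology
open scoped ENNReal ContDiff Matrix

namespace PDHG

noncomputable section

/-! ### Extended-real-valued convex analysis -/

/-- Convexity of an extended-real-valued function: its epigraph is convex. -/
def EConvex {E : Type*} [AddCommMonoid E] [Module ℝ E] (f : E → EReal) : Prop :=
  Convex ℝ {p : E × ℝ | f p.1 ≤ (p.2 : EReal)}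

/-- A function into `(-∞, +∞]` that is not identically `+∞`. -/
def EProper {E : Type*} (f : E → EReal) : Prop :=
  (∀ x, f x ≠ ⊥) ∧ ∃ x, f x ≠ ⊤

/-- The Fenchel-Legendre transform on a Hilbert space (identified with its dual). -/
def conjugate {H : Type*} [NormedAddCommGroup H] [InnerProductSpace ℝ H]
    (f : H → EReal) (z : H) : EReal :=
  ⨆ y : H, ((inner ℝ z y : ℝ) : EReal) - f y

/-- `1`-coercivity: `f α / ‖α‖ → +∞` as `‖α‖ → ∞`. -/
def OneCoercive {E : Type*} [NormedAddCommGroup E] (f : E → ℝ≥0∞) : Prop :=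
  Tendsto (fun α => f α / ENNReal.ofReal ‖α‖) (Bornology.cobounded E) (𝓝 ⊤)

/-- The (closed) perspective `r L(v / r)`: it is the indicator of `{0}` in `v` when `r = 0`, and
`+∞` when `r < 0` (the indicator of `[0, ∞)` in `r` is included). -/
def perspective {E : Type*} [AddCommGroup E] [Module ℝ E] (L : E → ℝ≥0∞)
    (r : ℝ) (v : E) : ℝ≥0∞ :=
  open Classical in
  if r < 0 then ⊤
  else if r = 0 then (if v = 0 then 0 else ⊤)
  else ENNReal.ofReal r * L (r⁻¹ • v)

/-! ### Function spaces on the periodic space-time cylinder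

The rectangle is `Ω = ∏ᵢ [loᵢ, hiᵢ]` with opposite faces identified; periodicity enters through the
test functions.  A space-time point is a pair `(x, t)`. -/

/-- The space-time cylinder `Ω × [0, T]`. -/
def spaceTime {n : ℕ} (lo hi : Fin n → ℝ) (T : ℝ) : Set ((Fin n → ℝ) × ℝ) :=
  Icc lo hi ×ˢ Icc 0 T

/-- `L²(Ω)`. -/
abbrev L2Space {n : ℕ} (lo hi : Fin n → ℝ) : Type :=
  Lp ℝ 2 ((volume : Measure (Fin n → ℝ)).restrict (Icc lo hi))

/-- `L²(Ω × [0, T]; E)`. -/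
abbrev L2Cyl {n : ℕ} (lo hi : Fin n → ℝ) (T : ℝ) (E : Type) [NormedAddCommGroup E] :
    Type :=
  Lp E 2 ((volume : Measure ((Fin n → ℝ) × ℝ)).restrict (spaceTime lo hi T))

/-- Smooth functions of `(x, t)` that are periodic in `x` with respect to the rectangle. -/
def PeriodicSmooth {n : ℕ} (lo hi : Fin n → ℝ) (η : (Fin n → ℝ) × ℝ → ℝ) : Prop :=
  ContDiff ℝ ∞ η ∧ ∀ (i : Fin n) (x : Fin n → ℝ) (t : ℝ),
    η (x + Pi.single i (hi i - lo i), t) = η (x, t)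

/-- Test functions on (torus) `× (0, T)`: periodic smooth functions whose support in time is
compactly contained in `(0, T)`. -/
def PeriodicTest {n : ℕ} (lo hi : Fin n → ℝ) (T : ℝ) (η : (Fin n → ℝ) × ℝ → ℝ) : Prop :=
  PeriodicSmooth lo hi η ∧
    ∃ a b : ℝ, 0 < a ∧ b < T ∧ ∀ (x : Fin n → ℝ) (t : ℝ), t ∉ Icc a b → η (x, t) = 0

/-- `∂_t η`. -/
def timeDeriv {n : ℕ} (η : (Fin n → ℝ) × ℝ → ℝ) (p : (Fin n → ℝ) × ℝ) : ℝ :=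
  fderiv ℝ η p (0, 1)

/-- `∂_{x_i} η`. -/
def spaceDeriv {n : ℕ} (i : Fin n) (η : (Fin n → ℝ) × ℝ → ℝ) (p : (Fin n → ℝ) × ℝ) : ℝ :=
  fderiv ℝ η p (Pi.single i 1, 0)

/-- Triples `(φ, (φ_t, φ_x))` in `L² × (L² × L²(·; ℝⁿ))`, with the Hilbert norm
`(‖φ‖² + ‖φ_t‖² + ‖φ_x‖²)^(1/2)`. -/
abbrev Jet {n : ℕ} (lo hi : Fin n → ℝ) (T : ℝ) : Type :=
  WithLp 2 (L2Cyl lo hi T ℝ ×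
    WithLp 2 (L2Cyl lo hi T ℝ × L2Cyl lo hi T (EuclideanSpace ℝ (Fin n))))

/-- `φ_t` and `φ_x` are the weak time derivative and weak spatial gradient of `φ` on
(torus) `× (0, T)`. -/
def IsWeakJet {n : ℕ} (lo hi : Fin n → ℝ) (T : ℝ) (u : Jet lo hi T) : Prop :=
  ∀ η : (Fin n → ℝ) × ℝ → ℝ, PeriodicTest lo hi T η →
    (∫ p in spaceTime lo hi T, u.fst p * timeDeriv η p
        = -∫ p in spaceTime lo hi T, u.snd.fst p * η p) ∧
    ∀ i : Fin n, ∫ p in spaceTime lo hi T, u.fst p * spaceDeriv i η p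
        = -∫ p in spaceTime lo hi T, (u.snd.snd p) i * η p

theorem spaceTime_isCompact {n : ℕ} (lo hi : Fin n → ℝ) (T : ℝ) :
    IsCompact (spaceTime lo hi T) :=
  isCompact_Icc.prod isCompact_Icc

/-- A square-integrable function times a continuous one is integrable on the cylinder. -/
theorem integrable_mul_continuous {n : ℕ} {lo hi : Fin n → ℝ} {T : ℝ}
    {u η : (Fin n → ℝ) × ℝ → ℝ} (hu : MemLp u 2 (volume.restrict (spaceTime lo hi T)))
    (hη : Continuous η) :
    Integrable (fun p => u p * η p) (volume.restrict (spaceTime lo hi T)) := by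
  have hK := spaceTime_isCompact lo hi T
  have : IsFiniteMeasure ((volume : Measure ((Fin n → ℝ) × ℝ)).restrict (spaceTime lo hi T)) :=
    ⟨by rw [Measure.restrict_apply_univ]; exact hK.measure_lt_top⟩
  obtain ⟨C, hC⟩ := hK.exists_bound_of_continuousOn hη.continuousOn
  refine (hu.integrable one_le_two).mul_bdd (c := C) hη.aestronglyMeasurable ?_
  exact (ae_restrict_iff' hK.isClosed.measurableSet).2 (Eventually.of_forall hC)

theorem PeriodicSmooth.continuous_timeDeriv {n : ℕ} {lo hi : Fin n → ℝ}
    {η : (Fin n → ℝ) × ℝ → ℝ} (h : PeriodicSmooth lo hi η) : Continuous (timeDeriv η) :=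
  (h.1.continuous_fderiv (by simp)).clm_apply continuous_const

theorem PeriodicSmooth.continuous_spaceDeriv {n : ℕ} {lo hi : Fin n → ℝ}
    {η : (Fin n → ℝ) × ℝ → ℝ} (h : PeriodicSmooth lo hi η) (i : Fin n) :
    Continuous (spaceDeriv i η) :=
  (h.1.continuous_fderiv (by simp)).clm_apply continuous_const

theorem memLp_coord {n : ℕ} {lo hi : Fin n → ℝ} {T : ℝ}
    (v : L2Cyl lo hi T (EuclideanSpace ℝ (Fin n))) (i : Fin n) :
    MemLp (fun p => (v p) i) 2 (volume.restrict (spaceTime lo hi T)) :=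
  (EuclideanSpace.proj (𝕜 := ℝ) i).comp_memLp' (Lp.memLp v)

/-- `H¹(Ω × [0, T])` on the periodic rectangle, with norm
`(‖φ‖² + ‖∂_t φ‖² + ‖∇_x φ‖²)^(1/2)`.  An element is carried together with its weak derivatives,
which `φ` determines. -/
def H1 {n : ℕ} (lo hi : Fin n → ℝ) (T : ℝ) : Submodule ℝ (Jet lo hi T) where
  carrier := {u | IsWeakJet lo hi T u}
  zero_mem' := by
    intro η hη
    have h0 : ((0 : L2Cyl lo hi T ℝ) : (Fin n → ℝ) × ℝ → ℝ)
        =ᵐ[volume.restrict (spaceTime lo hi T)] 0 := Lp.coeFn_zero _ _ _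
    have h1 : ((0 : L2Cyl lo hi T (EuclideanSpace ℝ (Fin n))) : (Fin n → ℝ) × ℝ → _)
        =ᵐ[volume.restrict (spaceTime lo hi T)] 0 := Lp.coeFn_zero _ _ _
    have e0 : ∀ f : (Fin n → ℝ) × ℝ → ℝ,
        ∫ p in spaceTime lo hi T, (0 : L2Cyl lo hi T ℝ) p * f p = 0 := fun f =>
      integral_eq_zero_of_ae (by filter_upwards [h0] with p hp; rw [hp]; simp)
    have e1 : ∀ (f : (Fin n → ℝ) × ℝ → ℝ) (i : Fin n), ∫ p in spaceTime lo hi T,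
        ((0 : L2Cyl lo hi T (EuclideanSpace ℝ (Fin n))) p) i * f p = 0 := fun f i =>
      integral_eq_zero_of_ae (by filter_upwards [h1] with p hp; rw [hp]; simp)
    refine ⟨?_, fun i => ?_⟩
    · exact (e0 _).trans (by rw [← neg_zero]; exact congrArg _ (e0 _).symm)
    · exact (e0 _).trans (by rw [← neg_zero]; exact congrArg _ (e1 _ i).symm)
  add_mem' := by
    intro u v hu hv η hη
    have a0 : ∀ (a b : L2Cyl lo hi T ℝ) (f : (Fin n → ℝ) × ℝ → ℝ), Continuous f →
        ∫ p in spaceTime lo hi T, (a + b : L2Cyl lo hi T ℝ) p * f p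
          = (∫ p in spaceTime lo hi T, a p * f p) + ∫ p in spaceTime lo hi T, b p * f p := by
      intro a b f hf
      rw [← integral_add (integrable_mul_continuous (Lp.memLp a) hf)
        (integrable_mul_continuous (Lp.memLp b) hf)]
      refine integral_congr_ae ?_
      filter_upwards [Lp.coeFn_add a b] with p hp
      rw [hp, Pi.add_apply, add_mul]
    have a1 : ∀ (a b : L2Cyl lo hi T (EuclideanSpace ℝ (Fin n))) (f : (Fin n → ℝ) × ℝ → ℝ)
        (i : Fin n), Continuous f →
        ∫ p in spaceTime lo hi T, ((a + b : L2Cyl lo hi T (EuclideanSpace ℝ (Fin n))) p) i * f p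
          = (∫ p in spaceTime lo hi T, (a p) i * f p)
            + ∫ p in spaceTime lo hi T, (b p) i * f p := by
      intro a b f i hf
      rw [← integral_add (integrable_mul_continuous (memLp_coord a i) hf)
        (integrable_mul_continuous (memLp_coord b i) hf)]
      refine integral_congr_ae ?_
      filter_upwards [Lp.coeFn_add a b] with p hp
      rw [hp, Pi.add_apply, PiLp.add_apply, add_mul]
    have hc : Continuous η := hη.1.1.continuous
    refine ⟨?_, fun i => ?_⟩
    · rw [WithLp.add_fst, WithLp.add_snd, WithLp.add_fst,
        a0 _ _ _ hη.1.continuous_timeDeriv, a0 _ _ _ hc, (hu η hη).1, (hv η hη).1, neg_add]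
    · rw [WithLp.add_fst, WithLp.add_snd, WithLp.add_snd,
        a0 _ _ _ (hη.1.continuous_spaceDeriv i), a1 _ _ _ i hc, (hu η hη).2 i, (hv η hη).2 i,
        neg_add]
  smul_mem' := by
    intro r u hu η hη
    have s0 : ∀ (a : L2Cyl lo hi T ℝ) (f : (Fin n → ℝ) × ℝ → ℝ),
        ∫ p in spaceTime lo hi T, (r • a : L2Cyl lo hi T ℝ) p * f p
          = r * ∫ p in spaceTime lo hi T, a p * f p := by
      intro a f
      rw [← integral_const_mul]
      refine integral_congr_ae ?_
      filter_upwards [Lp.coeFn_smul r a] with p hp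
      rw [hp, Pi.smul_apply, smul_eq_mul, mul_assoc]
    have s1 : ∀ (a : L2Cyl lo hi T (EuclideanSpace ℝ (Fin n))) (f : (Fin n → ℝ) × ℝ → ℝ)
        (i : Fin n),
        ∫ p in spaceTime lo hi T, ((r • a : L2Cyl lo hi T (EuclideanSpace ℝ (Fin n))) p) i * f p
          = r * ∫ p in spaceTime lo hi T, (a p) i * f p := by
      intro a f i
      rw [← integral_const_mul]
      refine integral_congr_ae ?_
      filter_upwards [Lp.coeFn_smul r a] with p hp
      rw [hp, Pi.smul_apply, PiLp.smul_apply, smul_eq_mul, mul_assoc]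
    refine ⟨?_, fun i => ?_⟩
    · rw [WithLp.smul_fst, WithLp.smul_snd, WithLp.smul_fst, s0, s0, (hu η hη).1, mul_neg]
    · rw [WithLp.smul_fst, WithLp.smul_snd, WithLp.smul_snd, s0, s1, (hu η hη).2 i, mul_neg]

section H1

variable {n : ℕ} {lo hi : Fin n → ℝ} {T : ℝ}

/-- The underlying `L²` function of `φ ∈ H¹`. -/
def H1.val (φ : H1 lo hi T) : L2Cyl lo hi T ℝ := φ.1.fst

/-- The weak time derivative `∂_t φ`. -/
def H1.dt (φ : H1 lo hi T) : L2Cyl lo hi T ℝ := φ.1.snd.fst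

/-- The weak spatial gradient `∇_x φ`. -/
def H1.grad (φ : H1 lo hi T) : L2Cyl lo hi T (EuclideanSpace ℝ (Fin n)) := φ.1.snd.snd

/-- `u₀` and `u₁` are the traces `φ(·, 0)` and `φ(·, T)` of `φ ∈ H¹`: the integration-by-parts
formula in time holds for all smooth functions up to the boundary. -/
def H1.HasTimeTraces (φ : H1 lo hi T) (u₀ u₁ : L2Space lo hi) : Prop :=
  ∀ η : (Fin n → ℝ) × ℝ → ℝ, PeriodicSmooth lo hi η →
    (∫ p in spaceTime lo hi T, (H1.dt φ p * η p + H1.val φ p * timeDeriv η p))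
      = (∫ x in Icc lo hi, u₁ x * η (x, T)) - ∫ x in Icc lo hi, u₀ x * η (x, 0)

open Classical in
/-- The pair of time traces `(φ(·, 0), φ(·, T))`. -/
def H1.timeTraces (φ : H1 lo hi T) : L2Space lo hi × L2Space lo hi :=
  if h : ∃ u : L2Space lo hi × L2Space lo hi, H1.HasTimeTraces φ u.1 u.2 then h.choose else 0

/-- The initial trace `φ(·, 0)`. -/
def H1.initialTrace (φ : H1 lo hi T) : L2Space lo hi := (H1.timeTraces φ).1

/-- The terminal trace `φ(·, T)`. -/
def H1.terminalTrace (φ : H1 lo hi T) : L2Space lo hi := (H1.timeTraces φ).2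

/-- The initial condition `φ(·, 0) = g` in the sense of traces. -/
def H1.InitialCondition (φ : H1 lo hi T) (g : (Fin n → ℝ) → ℝ) : Prop :=
  ∀ᵐ x ∂(volume.restrict (Icc lo hi)), H1.initialTrace φ x = g x

end H1

/-- `Y = L²(Ω × [0, T]) × L²(Ω × [0, T]; ℝᵐ)` with its Hilbert norm; elements are `(ρ, m)`. -/
abbrev DualSpace {n : ℕ} (lo hi : Fin n → ℝ) (T : ℝ) (m : ℕ) : Type :=
  WithLp 2 (L2Cyl lo hi T ℝ × L2Cyl lo hi T (EuclideanSpace ℝ (Fin m)))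

/-! ### The saddle point problem

The data are evaluated at the reversed time `T - t`. -/

section Problem

variable {n m : ℕ} {lo hi : Fin n → ℝ} {T : ℝ}

/-- The integrand `ρ ∂_tφ - ⟨A_{x,t} m, ∇_xφ⟩ - ρ ⟨b_{x,t}, ∇_xφ⟩` of `K`. -/
def couplingDensity (A : (Fin n → ℝ) → ℝ → Matrix (Fin n) (Fin m) ℝ)
    (b : (Fin n → ℝ) → ℝ → (Fin n → ℝ)) (φ : H1 lo hi T) (y : DualSpace lo hi T m)
    (p : (Fin n → ℝ) × ℝ) : ℝ :=
  y.fst p * H1.dt φ p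
    - (A p.1 (T - p.2) *ᵥ (y.snd p).ofLp) ⬝ᵥ (H1.grad φ p).ofLp
    - y.fst p * (b p.1 (T - p.2) ⬝ᵥ (H1.grad φ p).ofLp)

/-- `K(φ, ρ, m)`. -/
def coupling (A : (Fin n → ℝ) → ℝ → Matrix (Fin n) (Fin m) ℝ)
    (b : (Fin n → ℝ) → ℝ → (Fin n → ℝ)) (φ : H1 lo hi T) (y : DualSpace lo hi T m) : ℝ :=
  ∫ p in spaceTime lo hi T, couplingDensity A b φ y p

open Classical in
/-- `G(φ) = -c ∫_Ω φ(x, T) dx` if `φ(·, 0) = g`, and `+∞` otherwise. -/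
def primalFunctional (g : (Fin n → ℝ) → ℝ) (c : ℝ) (φ : H1 lo hi T) : EReal :=
  if H1.InitialCondition φ g then
    ((-c * ∫ x in Icc lo hi, H1.terminalTrace φ x : ℝ) : EReal)
  else ⊤

/-- `F̂(ρ, m) = ∫∫ ρ L_{x,t}(m / ρ) + ind_{[0,∞)}(ρ) dx dt`. -/
def dualFunctional (L : (Fin n → ℝ) → ℝ → EuclideanSpace ℝ (Fin m) → ℝ≥0∞)
    (y : DualSpace lo hi T m) : EReal :=
  ((∫⁻ p in spaceTime lo hi T, perspective (L p.1 (T - p.2)) (y.fst p) (y.snd p) : ℝ≥0∞) : EReal)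

/-- The objective `K(φ, ρ, m) + G(φ) - F̂(ρ, m)`. -/
def saddleObjective (A : (Fin n → ℝ) → ℝ → Matrix (Fin n) (Fin m) ℝ)
    (b : (Fin n → ℝ) → ℝ → (Fin n → ℝ))
    (L : (Fin n → ℝ) → ℝ → EuclideanSpace ℝ (Fin m) → ℝ≥0∞)
    (g : (Fin n → ℝ) → ℝ) (c : ℝ) (φ : H1 lo hi T) (y : DualSpace lo hi T m) : EReal :=
  (coupling A b φ y : EReal) + primalFunctional g c φ - dualFunctional L y

/-- The objective in the original variables `(φ, ρ, α)`, for `ρ ≥ 0`: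
`∫∫ ρ (∂_tφ - ⟨A_{x,t} α + b_{x,t}, ∇_xφ⟩) - ∫∫ ρ L_{x,t}(α) + G(φ)`. -/
def controlObjective (A : (Fin n → ℝ) → ℝ → Matrix (Fin n) (Fin m) ℝ)
    (b : (Fin n → ℝ) → ℝ → (Fin n → ℝ))
    (L : (Fin n → ℝ) → ℝ → EuclideanSpace ℝ (Fin m) → ℝ≥0∞)
    (g : (Fin n → ℝ) → ℝ) (c : ℝ) (φ : H1 lo hi T) (ρ : L2Cyl lo hi T ℝ)
    (α : (Fin n → ℝ) × ℝ → EuclideanSpace ℝ (Fin m)) : EReal :=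
  ((∫ p in spaceTime lo hi T, ρ p * (H1.dt φ p
      - (A p.1 (T - p.2) *ᵥ (α p).ofLp + b p.1 (T - p.2)) ⬝ᵥ (H1.grad φ p).ofLp) : ℝ) : EReal)
    + primalFunctional g c φ
    - ((∫⁻ p in spaceTime lo hi T, ENNReal.ofReal (ρ p) * L p.1 (T - p.2) (α p) : ℝ≥0∞) : EReal)

/-- A saddle point of `min_φ max_{(ρ, m)} K + G - F̂` over `H¹ × Y`. -/
def IsSaddlePoint (A : (Fin n → ℝ) → ℝ → Matrix (Fin n) (Fin m) ℝ)
    (b : (Fin n → ℝ) → ℝ → (Fin n → ℝ))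
    (L : (Fin n → ℝ) → ℝ → EuclideanSpace ℝ (Fin m) → ℝ≥0∞)
    (g : (Fin n → ℝ) → ℝ) (c : ℝ) (φ : H1 lo hi T) (y : DualSpace lo hi T m) : Prop :=
  primalFunctional g c φ ≠ ⊤ ∧ dualFunctional L y ≠ ⊤ ∧
    (∀ y' : DualSpace lo hi T m, saddleObjective A b L g c φ y' ≤ saddleObjective A b L g c φ y) ∧
    ∀ φ' : H1 lo hi T, saddleObjective A b L g c φ y ≤ saddleObjective A b L g c φ' y

/-- `y` is an `argmax` over `(ρ, m) ∈ Y` of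
`K(φ, ρ, m) - F̂(ρ, m) - (‖ρ - ρ₀‖² + ‖m - m₀‖²) / (2 τ)`, where `(ρ₀, m₀) = y₀`. -/
def IsDualUpdate (A : (Fin n → ℝ) → ℝ → Matrix (Fin n) (Fin m) ℝ)
    (b : (Fin n → ℝ) → ℝ → (Fin n → ℝ))
    (L : (Fin n → ℝ) → ℝ → EuclideanSpace ℝ (Fin m) → ℝ≥0∞) (τ : ℝ)
    (φ : H1 lo hi T) (y₀ y : DualSpace lo hi T m) : Prop :=
  IsMaxOn (fun z : DualSpace lo hi T m => (coupling A b φ z : EReal) - dualFunctional L z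
    - ((1 / (2 * τ) * (‖z.fst - y₀.fst‖ ^ 2 + ‖z.snd - y₀.snd‖ ^ 2) : ℝ) : EReal)) univ y

/-- `φ` is an `argmin` over `H¹` of `K(φ, y) + G(φ) + ‖φ - φ₀‖²_{H¹} / (2 τ)`. -/
def IsPrimalUpdate (A : (Fin n → ℝ) → ℝ → Matrix (Fin n) (Fin m) ℝ)
    (b : (Fin n → ℝ) → ℝ → (Fin n → ℝ)) (g : (Fin n → ℝ) → ℝ) (c : ℝ) (τ : ℝ)
    (y : DualSpace lo hi T m) (φ₀ φ : H1 lo hi T) : Prop :=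
  IsMinOn (fun ψ : H1 lo hi T => (coupling A b ψ y : EReal) + primalFunctional g c ψ
    + ((1 / (2 * τ) * ‖ψ - φ₀‖ ^ 2 : ℝ) : EReal)) univ φ

/-- The PDHG iteration: dual update at the extrapolated `φ̃`, primal update, extrapolation.
The starting values `φ 0`, `φ̃ 0`, `y 0` are arbitrary. -/
def IsPDHG (A : (Fin n → ℝ) → ℝ → Matrix (Fin n) (Fin m) ℝ)
    (b : (Fin n → ℝ) → ℝ → (Fin n → ℝ))
    (L : (Fin n → ℝ) → ℝ → EuclideanSpace ℝ (Fin m) → ℝ≥0∞)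
    (g : (Fin n → ℝ) → ℝ) (c : ℝ) (τφ τρm : ℝ)
    (φ φt : ℕ → H1 lo hi T) (y : ℕ → DualSpace lo hi T m) : Prop :=
  ∀ l : ℕ, IsDualUpdate A b L τρm (φt l) (y l) (y (l + 1)) ∧
    IsPrimalUpdate A b g c τφ (y (l + 1)) (φ l) (φ (l + 1)) ∧
    φt (l + 1) = (2 : ℝ) • φ (l + 1) - φ l

/-- The ergodic average `(1/l) ∑_{j=1}^{l} u j`. -/
def ergodicAverage {E : Type*} [AddCommGroup E] [Module ℝ E] (u : ℕ → E) (l : ℕ) : E :=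
  (1 / (l : ℝ)) • ∑ j ∈ Finset.Icc 1 l, u j

variable (lo hi T) in
/-- `sup_{x,t} ‖b(x,t)‖_∞`. -/
def supDrift (b : (Fin n → ℝ) → ℝ → (Fin n → ℝ)) : ℝ :=
  sSup {r : ℝ | ∃ p ∈ spaceTime lo hi T, r = ‖b p.1 p.2‖}

variable (lo hi T) in
/-- `sup_{x,t,i,j} |A_{ij}(x,t)|`. -/
def supEntry (A : (Fin n → ℝ) → ℝ → Matrix (Fin n) (Fin m) ℝ) : ℝ :=
  sSup {r : ℝ | ∃ p ∈ spaceTime lo hi T, ∃ i j, r = |A p.1 p.2 i j|}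

end Problem

end

end PDHG

open PDHG

/-!
Convex analysis reduces everything to four facts about the data.

* The functional `F̂` is convex and lower semicontinuous because its integrand, the perspective
  `(r, v) ↦ r L(v / r)`, is subadditive, positively homogeneous and jointly lower semicontinuous
  (`perspective_add_le`, `perspective_homogeneous`, `perspective_le_liminf`); `1`-coercivity is what
  makes the value `+∞` at `r = 0`, `v ≠ 0` a lower limit.  Fatou's lemma along an almost everywhere
  convergent subsequence transfers lower semicontinuity to the integral.
* The functional `G` is a continuous linear functional on a closed affine subspace of `H¹`
  (`exists_primalFunctional_eq`), once the time traces are known to exist, to be unique and to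
  depend continuously on `φ`.  The traces are explicit time integrals
  (`H1.exists_hasTimeTraces`): test functions that are affine in time satisfy the integration by
  parts formula by construction, and those vanishing at both ends are handled by smooth cutoffs
  (`integral_timeDeriv_eq_zero_of_vanishing`).  Smooth periodic functions separate the points of
  `L²(Ω)`, which gives uniqueness, and continuity is the closed graph theorem.
* The coupling `K` is bounded, by the Cauchy-Schwarz inequality (`abs_coupling_le`).
* Both updates minimise a convex lower semicontinuous function plus a linear one plus
  `s ‖x - x₀‖²`.  Strong convexity makes minimising sequences Cauchy, which gives existence and
  uniqueness (`existsUnique_isMinOn_eProxObjective`), and it gives the three-point inequality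
  `isMinOn_eProxObjective_three_point`.  The same proximal steps prove `F̂** = F̂`
  (`conjugate_conjugate`).

Adding the three-point inequalities of the two updates, the extrapolation turns the coupling terms
into a telescoping part and a remainder, which `τ σ ‖K‖² < 1` absorbs.  Hence an energy decreases by
at least the primal-dual gap in each step (`gap_add_pdhgEnergy_le`).  It bounds the iterates through
a saddle point and makes the gap of the averages `O(1 / l)` at every comparison point, so every weak
limit of the averages is a saddle point (`ergodic_convergence`).
-/

namespace PDHG

/-! ### Proximal steps -/

section Convex

variable {H : Type*} [NormedAddCommGroup H] [InnerProductSpace ℝ H]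

/-- The epigraph of `f` as a subset of `H × ℝ`.  Since it contains no point above a value `⊤`,
minimising over it turns extended-real problems into real ones. -/
def realEpigraph {E : Type*} (f : E → EReal) : Set (E × ℝ) :=
  {p | f p.1 ≤ (p.2 : EReal)}

theorem isClosed_realEpigraph {E : Type*} [TopologicalSpace E] {f : E → EReal}
    (hf : LowerSemicontinuous f) : IsClosed (realEpigraph f) :=
  hf.isClosed_epigraph.preimage
    (continuous_fst.prodMk (continuous_coe_real_ereal.comp continuous_snd))

theorem mem_realEpigraph_toReal {E : Type*} {f : E → EReal} {x : E} (hb : f x ≠ ⊥) (ht : f x ≠ ⊤) :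
    (x, (f x).toReal) ∈ realEpigraph f := by
  simp only [realEpigraph, mem_ofPred_eq]
  rw [EReal.coe_toReal ht hb]

theorem toReal_le_of_mem_realEpigraph {E : Type*} {f : E → EReal} {x : E} {r : ℝ}
    (hb : f x ≠ ⊥) (h : (x, r) ∈ realEpigraph f) : (f x).toReal ≤ r := by
  have ht : f x ≠ ⊤ := fun h' => by simp [realEpigraph, h'] at h
  have : f x ≤ (r : EReal) := h
  rw [← EReal.coe_toReal ht hb] at this
  exact_mod_cast this

theorem ne_top_of_mem_realEpigraph {E : Type*} {f : E → EReal} {x : E} {r : ℝ}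
    (h : (x, r) ∈ realEpigraph f) : f x ≠ ⊤ := fun h' => by
  simp [realEpigraph, h'] at h

/-- The objective `r + ℓ x + s ‖x - x₀‖²` of a proximal step, on points `(x, r)` of an epigraph. -/
def proxObjective (ℓ : H →L[ℝ] ℝ) (s : ℝ) (x₀ : H) (p : H × ℝ) : ℝ :=
  p.2 + ℓ p.1 + s * ‖p.1 - x₀‖ ^ 2

/-- The parallelogram law: the proximal objective is strongly convex with modulus `2 s`, exactly. -/
theorem proxObjective_combo (ℓ : H →L[ℝ] ℝ) (s : ℝ) (x₀ : H) (p q : H × ℝ) (t : ℝ) :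
    proxObjective ℓ s x₀ ((1 - t) • p + t • q) =
      (1 - t) * proxObjective ℓ s x₀ p + t * proxObjective ℓ s x₀ q
        - s * (t * (1 - t)) * ‖q.1 - p.1‖ ^ 2 := by
  have e1 : ((1 - t) • p + t • q).1 - x₀ = (1 - t) • (p.1 - x₀) + t • (q.1 - x₀) := by
    rw [Prod.fst_add, Prod.smul_fst, Prod.smul_fst]; module
  have e2 : q.1 - p.1 = (q.1 - x₀) - (p.1 - x₀) := by abel
  simp only [proxObjective]
  rw [e1, e2, norm_add_sq_real, norm_sub_sq_real (q.1 - x₀), norm_smul, norm_smul, inner_smul_left,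
    inner_smul_right, real_inner_comm (p.1 - x₀) (q.1 - x₀), mul_pow, mul_pow, Real.norm_eq_abs,
    Real.norm_eq_abs, sq_abs, sq_abs]
  simp only [Prod.fst_add, Prod.snd_add, Prod.smul_fst, Prod.smul_snd, map_add, map_smul,
    smul_eq_mul, conj_trivial]
  ring

/-- The three-point inequality: the value at a minimiser over a convex set is beaten
quadratically. -/
theorem proxObjective_three_point {C : Set (H × ℝ)} (hC : Convex ℝ C) (ℓ : H →L[ℝ] ℝ) (s : ℝ)
    (x₀ : H) {p : H × ℝ} (hp : p ∈ C)
    (hmin : ∀ q ∈ C, proxObjective ℓ s x₀ p ≤ proxObjective ℓ s x₀ q) {q : H × ℝ} (hq : q ∈ C) :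
    proxObjective ℓ s x₀ p + s * ‖q.1 - p.1‖ ^ 2 ≤ proxObjective ℓ s x₀ q := by
  have key : ∀ t ∈ Ioo (0 : ℝ) 1, s * (1 - t) * ‖q.1 - p.1‖ ^ 2
      ≤ proxObjective ℓ s x₀ q - proxObjective ℓ s x₀ p := by
    intro t ht
    have h1 := hmin _ (hC hp hq (sub_nonneg.2 ht.2.le) ht.1.le (by ring))
    rw [proxObjective_combo] at h1
    refine le_of_mul_le_mul_left ?_ ht.1
    linarith
  have hlim : Tendsto (fun t : ℝ => s * (1 - t) * ‖q.1 - p.1‖ ^ 2) (𝓝[>] 0)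
      (𝓝 (s * (1 - 0) * ‖q.1 - p.1‖ ^ 2)) := by
    refine Tendsto.mono_left (Continuous.tendsto ?_ 0) nhdsWithin_le_nhds
    fun_prop
  have := le_of_tendsto hlim (by
    filter_upwards [Ioo_mem_nhdsGT (zero_lt_one (α := ℝ))] with t ht using key t ht)
  linarith

/-- A proximal objective that dominates an affine function is bounded below. -/
theorem proxObjective_bddBelow {C : Set (H × ℝ)} (ℓ ℓ' : H →L[ℝ] ℝ) (c : ℝ)
    (hbd : ∀ p ∈ C, ℓ' p.1 + c ≤ p.2) {s : ℝ} (hs : 0 < s) (x₀ : H) :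
    ∃ B, ∀ p ∈ C, B ≤ proxObjective ℓ s x₀ p := by
  set k := ℓ + ℓ'
  refine ⟨c + k x₀ - ‖k‖ ^ 2 / (4 * s), fun p hp => ?_⟩
  have h1 : -(‖k‖ * ‖p.1 - x₀‖) ≤ k (p.1 - x₀) :=
    (abs_le.1 (k.le_opNorm (p.1 - x₀))).1
  have h2 : k (p.1 - x₀) = ℓ p.1 + ℓ' p.1 - k x₀ := by simp [k]; ring
  have h3 := hbd p hp
  have h4 : 0 ≤ s * (‖p.1 - x₀‖ - ‖k‖ / (2 * s)) ^ 2 := by positivity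
  have h5 : s * (‖p.1 - x₀‖ - ‖k‖ / (2 * s)) ^ 2
      = s * ‖p.1 - x₀‖ ^ 2 - ‖k‖ * ‖p.1 - x₀‖ + ‖k‖ ^ 2 / (4 * s) := by
    field_simp; ring
  simp only [proxObjective]
  linarith

/-- A minimising sequence of a proximal objective is Cauchy by strong convexity, so a minimiser
exists over every closed convex set of epigraph type. -/
theorem exists_proxObjective_min [CompleteSpace H] {C : Set (H × ℝ)} (hC : Convex ℝ C)
    (hcl : IsClosed C) (hne : C.Nonempty) (ℓ ℓ' : H →L[ℝ] ℝ) (c : ℝ)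
    (hbd : ∀ p ∈ C, ℓ' p.1 + c ≤ p.2) {s : ℝ} (hs : 0 < s) (x₀ : H) :
    ∃ p ∈ C, ∀ q ∈ C, proxObjective ℓ s x₀ p ≤ proxObjective ℓ s x₀ q := by
  obtain ⟨B, hB⟩ := proxObjective_bddBelow ℓ ℓ' c hbd hs x₀
  set J := proxObjective ℓ s x₀ with hJ
  have hbb : BddBelow (J '' C) := ⟨B, by rintro _ ⟨p, hp, rfl⟩; exact hB p hp⟩
  set I := sInf (J '' C) with hI
  have hIle : ∀ p ∈ C, I ≤ J p := fun p hp => csInf_le hbb ⟨p, hp, rfl⟩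
  have hex : ∀ k : ℕ, ∃ p ∈ C, J p < I + 1 / ((k : ℝ) + 1) := by
    intro k
    obtain ⟨_, ⟨p, hp, rfl⟩, hlt⟩ := exists_lt_of_csInf_lt (hne.image J)
      (lt_add_of_pos_right I (Nat.one_div_pos_of_nat (n := k)))
    exact ⟨p, hp, hlt⟩
  choose p hpC hpJ using hex
  have hdist : ∀ j k, s / 4 * ‖(p j).1 - (p k).1‖ ^ 2 ≤ (J (p j) - I) / 2 + (J (p k) - I) / 2 := by
    intro j k
    have h1 := hIle _ (hC (hpC k) (hpC j) (sub_nonneg.2 (by norm_num : (1 / 2 : ℝ) ≤ 1))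
      (by norm_num : (0 : ℝ) ≤ 1 / 2) (by ring))
    rw [hJ, proxObjective_combo, ← hJ] at h1
    linarith
  have hto : Tendsto (fun k : ℕ => 1 / ((k : ℝ) + 1)) atTop (𝓝 0) :=
    tendsto_one_div_add_atTop_nhds_zero_nat
  have hJlim : Tendsto (fun k => J (p k)) atTop (𝓝 I) := by
    refine tendsto_of_tendsto_of_tendsto_of_le_of_le tendsto_const_nhds
      (by simpa using (tendsto_const_nhds (x := I)).add hto) (fun k => hIle _ (hpC k))
      (fun k => (hpJ k).le)
  have hcauchy : CauchySeq (fun k => (p k).1) := by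
    rw [Metric.cauchySeq_iff']
    intro ε hε
    obtain ⟨N, hN⟩ := (hto.eventually (gt_mem_nhds (by positivity : 0 < s / 4 * ε ^ 2))).exists_forall_of_atTop
    refine ⟨N, fun k hk => ?_⟩
    rw [dist_eq_norm]
    have h1 := hdist k N
    have h2 := hpJ k
    have h3 := hpJ N
    have h4 := hN k hk
    have h5 := hN N le_rfl
    have h6 : ‖(p k).1 - (p N).1‖ ^ 2 < ε ^ 2 := by
      refine lt_of_mul_lt_mul_left (a := s / 4) ?_ (by positivity)
      linarith
    exact lt_of_pow_lt_pow_left₀ 2 hε.le h6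
  obtain ⟨x, hx⟩ := cauchySeq_tendsto_of_complete hcauchy
  have hr : Tendsto (fun k => (p k).2) atTop (𝓝 (I - ℓ x - s * ‖x - x₀‖ ^ 2)) := by
    have : (fun k => (p k).2) = fun k => J (p k) - ℓ (p k).1 - s * ‖(p k).1 - x₀‖ ^ 2 := by
      funext k; simp only [hJ, proxObjective]; ring
    rw [this]
    exact (hJlim.sub ((ℓ.continuous.tendsto x).comp hx)).sub
      (((hx.sub_const x₀).norm.pow 2).const_mul s)
  refine ⟨(x, I - ℓ x - s * ‖x - x₀‖ ^ 2), ?_, fun q hq => ?_⟩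
  · exact hcl.mem_of_tendsto (hx.prodMk_nhds hr) (Eventually.of_forall hpC)
  · refine le_trans (le_of_eq ?_) (hIle q hq)
    simp only [hJ, proxObjective]; ring

/-- The extended-real objective `ℓ x + f x + s ‖x - x₀‖²` of a proximal step. -/
noncomputable def eProxObjective (f : H → EReal) (ℓ : H →L[ℝ] ℝ) (s : ℝ) (x₀ x : H) : EReal :=
  (ℓ x : EReal) + f x + ((s * ‖x - x₀‖ ^ 2 : ℝ) : EReal)

theorem eProxObjective_le_coe {f : H → EReal} {ℓ : H →L[ℝ] ℝ} {s : ℝ} {x₀ x : H} {r : ℝ}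
    (h : (x, r) ∈ realEpigraph f) :
    eProxObjective f ℓ s x₀ x ≤ (proxObjective ℓ s x₀ (x, r) : EReal) := by
  have h' : f x ≤ (r : EReal) := h
  have : ((proxObjective ℓ s x₀ (x, r) : ℝ) : EReal)
      = (ℓ x : EReal) + (r : EReal) + ((s * ‖x - x₀‖ ^ 2 : ℝ) : EReal) := by
    rw [← EReal.coe_add, ← EReal.coe_add]; congr 1; simp only [proxObjective]; ring
  rw [this, eProxObjective]
  gcongr

theorem eProxObjective_eq_coe {f : H → EReal} {ℓ : H →L[ℝ] ℝ} {s : ℝ} {x₀ x : H}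
    (hb : f x ≠ ⊥) (ht : f x ≠ ⊤) :
    eProxObjective f ℓ s x₀ x = (proxObjective ℓ s x₀ (x, (f x).toReal) : EReal) := by
  rw [eProxObjective]
  conv_lhs => rw [← EReal.coe_toReal ht hb]
  rw [← EReal.coe_add, ← EReal.coe_add]; congr 1; simp only [proxObjective]; ring

theorem eProxObjective_eq_top {f : H → EReal} {ℓ : H →L[ℝ] ℝ} {s : ℝ} {x₀ x : H}
    (ht : f x = ⊤) : eProxObjective f ℓ s x₀ x = ⊤ := by
  rw [eProxObjective, ht, EReal.coe_add_top, EReal.top_add_coe]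

/-- Minimisers of the extended-real proximal objective are the minimisers over the epigraph. -/
theorem isMinOn_eProxObjective_iff {f : H → EReal} (hf : EProper f) (ℓ : H →L[ℝ] ℝ) (s : ℝ)
    (x₀ x : H) : IsMinOn (eProxObjective f ℓ s x₀) univ x ↔
      f x ≠ ⊤ ∧ ∀ q ∈ realEpigraph f,
        proxObjective ℓ s x₀ (x, (f x).toReal) ≤ proxObjective ℓ s x₀ q := by
  rw [isMinOn_univ_iff]
  constructor
  · intro h
    have ht : f x ≠ ⊤ := by
      obtain ⟨z, hz⟩ := hf.2
      intro h'
      have := h z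
      rw [eProxObjective_eq_top h', eProxObjective_eq_coe (hf.1 z) hz] at this
      exact absurd this (not_le.2 (EReal.coe_lt_top _))
    refine ⟨ht, fun q hq => ?_⟩
    have := (h q.1).trans (eProxObjective_le_coe (r := q.2) hq)
    rw [eProxObjective_eq_coe (hf.1 x) ht] at this
    exact_mod_cast this
  · rintro ⟨ht, h⟩ z
    by_cases hz : f z = ⊤
    · rw [eProxObjective_eq_top hz]; exact le_top
    · rw [eProxObjective_eq_coe (hf.1 x) ht, eProxObjective_eq_coe (hf.1 z) hz]
      exact_mod_cast h _ (mem_realEpigraph_toReal (hf.1 z) hz)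

theorem isMinOn_eProxObjective_three_point {f : H → EReal} (hf : EProper f) (hc : EConvex f)
    {ℓ : H →L[ℝ] ℝ} {s : ℝ} {x₀ x : H} (h : IsMinOn (eProxObjective f ℓ s x₀) univ x)
    {q : H × ℝ} (hq : q ∈ realEpigraph f) :
    proxObjective ℓ s x₀ (x, (f x).toReal) + s * ‖q.1 - x‖ ^ 2 ≤ proxObjective ℓ s x₀ q := by
  obtain ⟨ht, h⟩ := (isMinOn_eProxObjective_iff hf ℓ s x₀ x).1 h
  exact proxObjective_three_point hc ℓ s x₀ (mem_realEpigraph_toReal (hf.1 x) ht) h hq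

/-- A proximal step of a proper convex lower semicontinuous function with an affine minorant is
well defined. -/
theorem existsUnique_isMinOn_eProxObjective [CompleteSpace H] {f : H → EReal} (hf : EProper f)
    (hc : EConvex f) (hl : LowerSemicontinuous f) (ℓ ℓ' : H →L[ℝ] ℝ)
    (hbd : ∀ x, (ℓ' x : EReal) ≤ f x) {s : ℝ} (hs : 0 < s) (x₀ : H) :
    ∃! x, IsMinOn (eProxObjective f ℓ s x₀) univ x := by
  have hne : (realEpigraph f).Nonempty := by
    obtain ⟨z, hz⟩ := hf.2
    exact ⟨_, mem_realEpigraph_toReal (hf.1 z) hz⟩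
  obtain ⟨p, hp, hmin⟩ := exists_proxObjective_min hc (isClosed_realEpigraph hl) hne ℓ ℓ' 0
    (fun q hq => by
      have : ((ℓ' q.1 : ℝ) : EReal) ≤ (q.2 : EReal) := (hbd q.1).trans hq
      simpa using (by exact_mod_cast this : ℓ' q.1 ≤ q.2)) hs x₀
  refine ⟨p.1, ?_, fun z hz => ?_⟩
  · refine (isMinOn_eProxObjective_iff hf ℓ s x₀ p.1).2
      ⟨ne_top_of_mem_realEpigraph (r := p.2) hp, fun q hq => le_trans ?_ (hmin q hq)⟩
    have := toReal_le_of_mem_realEpigraph (hf.1 p.1) (r := p.2) hp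
    simp only [proxObjective]; linarith
  · have h1 := isMinOn_eProxObjective_three_point hf hc hz hp
    have h2 := hmin _ (mem_realEpigraph_toReal (hf.1 z)
      ((isMinOn_eProxObjective_iff hf ℓ s x₀ z).1 hz).1)
    have h3 : s * ‖p.1 - z‖ ^ 2 ≤ 0 := by linarith
    have h4 : ‖p.1 - z‖ ^ 2 ≤ 0 := by
      by_contra! hcon
      exact absurd h3 (not_le.2 (mul_pos hs hcon))
    have h5 : ‖p.1 - z‖ = 0 := by
      have := sq_nonneg ‖p.1 - z‖
      exact pow_eq_zero_iff two_ne_zero |>.1 (le_antisymm h4 this)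
    exact (sub_eq_zero.1 (norm_eq_zero.1 h5)).symm

/-! ### Conjugate functions -/

theorem conjugate_le_coe_iff {f : H → EReal} (hf : EProper f) {z : H} {r : ℝ} :
    conjugate f z ≤ (r : EReal) ↔ ∀ q ∈ realEpigraph f, inner ℝ z q.1 - q.2 ≤ r := by
  rw [conjugate, iSup_le_iff]
  constructor
  · intro h q hq
    have h1 : ((inner ℝ z q.1 : ℝ) : EReal) - (q.2 : EReal) ≤ (r : EReal) :=
      le_trans (EReal.sub_le_sub le_rfl hq) (h q.1)
    rw [← EReal.coe_sub] at h1
    exact_mod_cast h1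
  · intro h y
    by_cases hy : f y = ⊤
    · simp [hy]
    · have := h _ (mem_realEpigraph_toReal (hf.1 y) hy)
      rw [← EReal.coe_toReal hy (hf.1 y), ← EReal.coe_sub]
      exact_mod_cast this

theorem econvex_conjugate {f : H → EReal} (hf : EProper f) : EConvex (conjugate f) := by
  have : {p : H × ℝ | conjugate f p.1 ≤ (p.2 : EReal)}
      = ⋂ q ∈ realEpigraph f, {p : H × ℝ | inner ℝ p.1 q.1 - q.2 ≤ p.2} := by
    ext p; simp only [mem_ofPred_eq, mem_iInter]; exact conjugate_le_coe_iff hf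
  rw [EConvex, this]
  refine convex_iInter₂ fun q _ => ?_
  intro a ha b hb s t hs ht hst
  simp only [mem_ofPred_eq, Prod.fst_add, Prod.smul_fst, Prod.snd_add, Prod.smul_snd,
    inner_add_left, inner_smul_left, conj_trivial, smul_eq_mul] at *
  have hq : q.2 = s * q.2 + t * q.2 := by rw [← add_mul, hst, one_mul]
  nlinarith [mul_le_mul_of_nonneg_left ha hs, mul_le_mul_of_nonneg_left hb ht]

theorem lowerSemicontinuous_conjugate {f : H → EReal} (hf : EProper f) :
    LowerSemicontinuous (conjugate f) := by
  refine lowerSemicontinuous_iSup fun y => Continuous.lowerSemicontinuous ?_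
  by_cases hy : f y = ⊤
  · simp only [hy, EReal.sub_top]; exact continuous_const
  · have : (fun z : H => ((inner ℝ z y : ℝ) : EReal) - f y)
        = fun z : H => ((inner ℝ z y - (f y).toReal : ℝ) : EReal) := by
      funext z
      rw [EReal.coe_sub, EReal.coe_toReal hy (hf.1 y)]
    rw [this]
    exact continuous_coe_real_ereal.comp (by fun_prop)

theorem eproper_conjugate {f : H → EReal} (hf : EProper f) (h0 : ∀ x, 0 ≤ f x) :
    EProper (conjugate f) := by
  refine ⟨fun z hz => ?_, 0, fun h => ?_⟩
  · obtain ⟨y, hy⟩ := hf.2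
    have h1 : ((inner ℝ z y : ℝ) : EReal) - f y ≤ conjugate f z := le_iSup (fun y : H => ((inner ℝ z y : ℝ) : EReal) - f y) y
    rw [hz, le_bot_iff, ← EReal.coe_toReal hy (hf.1 y), ← EReal.coe_sub] at h1
    exact EReal.coe_ne_bot _ h1
  · have h1 : conjugate f 0 ≤ ((0 : ℝ) : EReal) := by
      rw [conjugate_le_coe_iff hf]
      intro q hq
      have : (0 : EReal) ≤ (q.2 : EReal) := (h0 q.1).trans hq
      simpa using (by exact_mod_cast this : (0 : ℝ) ≤ q.2)
    rw [h] at h1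
    exact absurd h1 (not_le.2 (EReal.coe_lt_top _))

theorem conjugate_nonneg {f : H → EReal} (h00 : f 0 = 0) (z : H) : 0 ≤ conjugate f z := by
  have h1 : ((inner ℝ z (0 : H) : ℝ) : EReal) - f 0 ≤ conjugate f z :=
    le_iSup (fun y : H => ((inner ℝ z y : ℝ) : EReal) - f y) 0
  simpa [h00] using h1

/-- The Fenchel-Moreau theorem for a nonnegative function.  The points `p_s` of the proximal path
at `x` carry subgradients `2 s (x - p_s)`, so `f p_s + 2 s ‖x - p_s‖² ≤ f** x`; if the right-hand
side is finite, then `p_s → x` as `s → ∞` and lower semicontinuity gives `f x ≤ f** x`. -/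
theorem conjugate_conjugate [CompleteSpace H] {f : H → EReal} (hf : EProper f)
    (hc : EConvex f) (hl : LowerSemicontinuous f) (h0 : ∀ x, 0 ≤ f x) (h00 : f 0 = 0) :
    conjugate (conjugate f) = f := by
  have hf' := eproper_conjugate hf h0
  have hf'' := eproper_conjugate hf' (conjugate_nonneg h00)
  have hle : ∀ x, ∀ r : ℝ, f x ≤ (r : EReal) → conjugate (conjugate f) x ≤ (r : EReal) := by
    intro x r hr
    rw [conjugate_le_coe_iff hf']
    intro q hq
    have := (conjugate_le_coe_iff hf).1 hq (x, r) hr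
    rw [real_inner_comm] at this
    simp only at this
    linarith
  funext x
  refine le_antisymm ?_ ?_
  · rcases eq_or_ne (f x) ⊤ with h | h
    · rw [h]; exact le_top
    · have := hle x (f x).toReal (by rw [EReal.coe_toReal h (hf.1 x)])
      rwa [EReal.coe_toReal h (hf.1 x)] at this
  · rcases eq_or_ne (conjugate (conjugate f) x) ⊤ with h | h
    · rw [h]; exact le_top
    obtain ⟨r, hr⟩ : ∃ r : ℝ, conjugate (conjugate f) x = (r : EReal) :=
      ⟨_, (EReal.coe_toReal h (hf''.1 x)).symm⟩
    have hstep : ∀ k : ℕ, ∃ p : H, f p ≤ (r : EReal) ∧ ‖p - x‖ ^ 2 ≤ r * (1 / ((k : ℝ) + 1)) := by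
      intro k
      have hs : (0 : ℝ) < k + 1 := by positivity
      obtain ⟨p, hp, -⟩ := existsUnique_isMinOn_eProxObjective hf hc hl 0 0
        (fun x => by simpa using h0 x) hs x
      obtain ⟨ht, -⟩ := (isMinOn_eProxObjective_iff hf 0 _ x p).1 hp
      have hfp := EReal.coe_toReal ht (hf.1 p)
      have hfp0 : 0 ≤ (f p).toReal := EReal.toReal_nonneg (h0 p)
      set z : H := (2 * ((k : ℝ) + 1)) • (x - p) with hz
      have hsub : conjugate f z ≤ ((inner ℝ z p - (f p).toReal : ℝ) : EReal) := by
        rw [conjugate_le_coe_iff hf]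
        intro q hq
        have h3 := isMinOn_eProxObjective_three_point hf hc hp hq
        have e : q.1 - x = (q.1 - p) - (x - p) := by abel
        simp only [proxObjective, zero_apply] at h3
        rw [e, norm_sub_sq_real (q.1 - p), norm_sub_rev p x, real_inner_comm] at h3
        have e2 : inner ℝ z q.1 - inner ℝ z p
            = 2 * ((k : ℝ) + 1) * inner ℝ (x - p) (q.1 - p) := by
          rw [← inner_sub_right, hz, inner_smul_left, conj_trivial]
        linarith
      have h4 := (conjugate_le_coe_iff hf').1 hr.le (z, inner ℝ z p - (f p).toReal) hsub
      have e3 : inner ℝ x z - inner ℝ z p = 2 * ((k : ℝ) + 1) * ‖p - x‖ ^ 2 := by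
        rw [real_inner_comm, ← inner_sub_right, hz, inner_smul_left, conj_trivial,
          real_inner_self_eq_norm_sq, norm_sub_rev]
      simp only at h4
      have h5 : 0 ≤ ((k : ℝ) + 1) * ‖p - x‖ ^ 2 := by positivity
      refine ⟨p, ?_, ?_⟩
      · rw [← hfp]
        exact_mod_cast (by linarith : (f p).toReal ≤ r)
      · rw [mul_one_div, le_div_iff₀ hs]
        linarith
    choose p hpr hpx using hstep
    have hlim : Tendsto (fun k => ‖p k - x‖ ^ 2) atTop (𝓝 0) := by
      refine squeeze_zero (fun k => by positivity) hpx ?_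
      simpa using (tendsto_one_div_add_atTop_nhds_zero_nat (𝕜 := ℝ)).const_mul r
    have hpto : Tendsto p atTop (𝓝 x) := by
      rw [tendsto_iff_norm_sub_tendsto_zero]
      have := hlim.sqrt
      simpa [Real.sqrt_sq (norm_nonneg _)] using this
    rw [hr]
    exact (isClosed_realEpigraph hl).mem_of_tendsto (hpto.prodMk_nhds (tendsto_const_nhds (x := r)))
      (Eventually.of_forall hpr)

end Convex

/-! ### Weak convergence -/

section WeakConvergence

variable {H : Type*} [NormedAddCommGroup H] [InnerProductSpace ℝ H]

theorem tendsto_toWeakSpace {x : ℕ → H} {a : H}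
    (h : ∀ f : H →L[ℝ] ℝ, Tendsto (fun j => f (x j)) atTop (𝓝 (f a))) :
    Tendsto (fun j => toWeakSpace ℝ H (x j)) atTop (𝓝 (toWeakSpace ℝ H a)) := by
  refine (WeakBilin.tendsto_iff_forall_eval_tendsto (topDualPairing ℝ H).flip ?_).2 fun f => h f
  intro u v huv
  refine ext_inner_left ℝ fun w => ?_
  exact DFunLike.congr_fun huv (innerSL ℝ w)

/-- Bounded sequences in a Hilbert space have weakly convergent subsequences: on the closed span
of the sequence, which is separable, this is the sequential Banach-Alaoglu theorem. -/
theorem exists_weakly_convergent_subseq [CompleteSpace H] (x : ℕ → H) (R : ℝ)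
    (hR : ∀ n, ‖x n‖ ≤ R) :
    ∃ (a : H) (k : ℕ → ℕ), StrictMono k ∧
      ∀ f : H →L[ℝ] ℝ, Tendsto (fun j => f (x (k j))) atTop (𝓝 (f a)) := by
  set M : Submodule ℝ H := (Submodule.span ℝ (range x)).topologicalClosure with hM
  have hxM : ∀ n, x n ∈ M := fun n =>
    Submodule.le_topologicalClosure _ (Submodule.subset_span (mem_range_self n))
  have hMc : IsClosed (M : Set H) := Submodule.isClosed_topologicalClosure _
  have : CompleteSpace M := hMc.completeSpace_coe
  have : TopologicalSpace.SeparableSpace M := by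
    have h1 : TopologicalSpace.IsSeparable (M : Set H) := by
      rw [hM, Submodule.topologicalClosure_coe]
      exact ((countable_range x).isSeparable.span (R := ℝ)).closure
    exact h1.separableSpace
  obtain ⟨φ, -, k, hk, hlim⟩ := WeakDual.isSeqCompact_closedBall ℝ M 0 R
    (x := fun n => StrongDual.toWeakDual (innerSL ℝ (⟨x n, hxM n⟩ : M)))
    (fun n => by
      simp only [mem_preimage, mem_closedBall_zero_iff]
      refine le_trans (le_of_eq ?_) (hR n)
      exact innerSL_apply_norm (𝕜 := ℝ) (⟨x n, hxM n⟩ : M))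
  set a : M := (InnerProductSpace.toDual ℝ M).symm (WeakDual.toStrongDual φ)
  refine ⟨a, k, hk, fun f => ?_⟩
  -- the restriction of `f` to `M` is the inner product with some `w`
  set w : M := (InnerProductSpace.toDual ℝ M).symm (f.comp M.subtypeL) with hw
  have hfw : ∀ v : M, f v = inner ℝ v w := fun v => by
    rw [real_inner_comm, hw, InnerProductSpace.toDual_symm_apply]; rfl
  have h1 := ((WeakDual.eval_continuous w).tendsto φ).comp hlim
  have h2 : φ w = f a := by
    rw [hfw, InnerProductSpace.toDual_symm_apply]; rfl
  rw [h2] at h1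
  refine h1.congr fun j => ?_
  exact (hfw ⟨x (k j), hxM (k j)⟩).symm

/-- Closed convex sets are closed under weak convergence in the first variable and strong
convergence in the second. -/
theorem mem_of_weak_tendsto {C : Set (H × ℝ)} (hC : Convex ℝ C) (hcl : IsClosed C) {x : ℕ → H}
    {r : ℕ → ℝ} {a : H} {b : ℝ} (hx : ∀ f : H →L[ℝ] ℝ, Tendsto (fun j => f (x j)) atTop (𝓝 (f a)))
    (hr : Tendsto r atTop (𝓝 b)) (hmem : ∀ j, (x j, r j) ∈ C) : (a, b) ∈ C := by
  by_contra hcon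
  obtain ⟨f, u, h1, h2⟩ := geometric_hahn_banach_closed_point hC hcl hcon
  have e : ∀ (z : H) (t : ℝ), f (z, t) = (f.comp (ContinuousLinearMap.inl ℝ H ℝ)) z + t * f (0, 1) := by
    intro z t
    have : ((z, t) : H × ℝ) = (z, 0) + t • (0, 1) := by simp
    rw [this, map_add, map_smul, smul_eq_mul]; rfl
  have hlim : Tendsto (fun j => f (x j, r j)) atTop (𝓝 (f (a, b))) := by
    rw [e]
    exact ((hx _).add (hr.mul_const _)).congr fun j => (e _ _).symm
  exact absurd (le_of_tendsto hlim (Eventually.of_forall fun j => (h1 _ (hmem j)).le))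
    (not_le.2 h2)

end WeakConvergence

/-! ### Ergodic convergence of the primal-dual hybrid gradient iteration -/

section Ergodic

variable {X Y : Type*} [NormedAddCommGroup X] [InnerProductSpace ℝ X]
  [NormedAddCommGroup Y] [InnerProductSpace ℝ Y]

theorem ergodicAverage_eq_sum {E : Type*} [AddCommGroup E] [Module ℝ E] (u : ℕ → E) (l : ℕ) :
    ergodicAverage u l = ∑ j ∈ Finset.Icc 1 l, (1 / (l : ℝ)) • u j := Finset.smul_sum

theorem ergodicAverage_mem {E : Type*} [AddCommGroup E] [Module ℝ E] {C : Set E} (hC : Convex ℝ C)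
    {u : ℕ → E} (hu : ∀ j, 1 ≤ j → u j ∈ C) {l : ℕ} (hl : 1 ≤ l) : ergodicAverage u l ∈ C := by
  rw [ergodicAverage_eq_sum]
  refine hC.sum_mem (fun j _ => by positivity) ?_ fun j hj => hu j (Finset.mem_Icc.1 hj).1
  have : (l : ℝ) ≠ 0 := by positivity
  simp [this]

theorem norm_ergodicAverage_le {u : ℕ → X} {R : ℝ} (hu : ∀ j, 1 ≤ j → ‖u j‖ ≤ R) {l : ℕ}
    (hl : 1 ≤ l) : ‖ergodicAverage u l‖ ≤ R := by
  have := ergodicAverage_mem (convex_closedBall (0 : X) R) (u := u)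
    (fun j hj => by simpa using hu j hj) hl
  simpa using this

/-- Young's inequality for a bilinear form, weighted so that the constant is `τ σ ‖K‖²`. -/
theorem abs_bilin_le (K : X →L[ℝ] Y →L[ℝ] ℝ) {τ σ : ℝ} (hτ : 0 < τ) (hσ : 0 < σ) (u : X) (v : Y) :
    |K u v| ≤ 1 / (2 * τ) * ‖u‖ ^ 2 + τ * σ * ‖K‖ ^ 2 * (1 / (2 * σ) * ‖v‖ ^ 2) := by
  have h1 : |K u v| ≤ ‖K‖ * ‖u‖ * ‖v‖ := K.le_opNorm₂ u v
  have h2 : 0 ≤ 1 / (2 * τ) * (‖u‖ - τ * (‖K‖ * ‖v‖)) ^ 2 := by positivity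
  have h3 : 1 / (2 * τ) * (‖u‖ - τ * (‖K‖ * ‖v‖)) ^ 2 = 1 / (2 * τ) * ‖u‖ ^ 2 - ‖K‖ * ‖u‖ * ‖v‖
      + τ * σ * ‖K‖ ^ 2 * (1 / (2 * σ) * ‖v‖ ^ 2) := by
    field_simp; ring
  linarith

/-- The energy that the iteration dissipates, relative to a comparison point `(x', y')`. -/
noncomputable def pdhgEnergy (K : X →L[ℝ] Y →L[ℝ] ℝ) (τ σ : ℝ) (x : ℕ → X) (y : ℕ → Y)
    (x' : X) (y' : Y) (l : ℕ) : ℝ :=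
  1 / (2 * σ) * ‖y' - y (l + 1)‖ ^ 2 + 1 / (2 * τ) * ‖x' - x (l + 1)‖ ^ 2
    - K (x (l + 1) - x l) (y' - y (l + 1)) + 1 / (2 * τ) * ‖x (l + 1) - x l‖ ^ 2

theorem le_pdhgEnergy (K : X →L[ℝ] Y →L[ℝ] ℝ) {τ σ : ℝ} (hτ : 0 < τ) (hσ : 0 < σ)
    (x : ℕ → X) (y : ℕ → Y) (x' : X) (y' : Y) (l : ℕ) :
    (1 - τ * σ * ‖K‖ ^ 2) * (1 / (2 * σ) * ‖y' - y (l + 1)‖ ^ 2)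
      + 1 / (2 * τ) * ‖x' - x (l + 1)‖ ^ 2 ≤ pdhgEnergy K τ σ x y x' y' l := by
  have := (abs_le.1 (abs_bilin_le K hτ hσ (x (l + 1) - x l) (y' - y (l + 1)))).2
  simp only [pdhgEnergy]
  linarith

/-- One step of the iteration: the primal-dual gap at `(x', y')` is paid for by the energy. -/
theorem gap_add_pdhgEnergy_le (K : X →L[ℝ] Y →L[ℝ] ℝ) {τ σ : ℝ} (hτ : 0 < τ) (hσ : 0 < σ)
    (hK : τ * σ * ‖K‖ ^ 2 ≤ 1) (x xt : ℕ → X) (y : ℕ → Y) (G F : ℕ → ℝ) (x' : X) (y' : Y) (l : ℕ)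
    (g f : ℝ) (hxt : xt (l + 1) = (2 : ℝ) • x (l + 1) - x l)
    (hy : F (l + 2) - K (xt (l + 1)) (y (l + 2)) + 1 / (2 * σ) * ‖y (l + 2) - y (l + 1)‖ ^ 2
      + 1 / (2 * σ) * ‖y' - y (l + 2)‖ ^ 2
        ≤ f - K (xt (l + 1)) y' + 1 / (2 * σ) * ‖y' - y (l + 1)‖ ^ 2)
    (hx : G (l + 2) + K (x (l + 2)) (y (l + 2)) + 1 / (2 * τ) * ‖x (l + 2) - x (l + 1)‖ ^ 2
      + 1 / (2 * τ) * ‖x' - x (l + 2)‖ ^ 2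
        ≤ g + K x' (y (l + 2)) + 1 / (2 * τ) * ‖x' - x (l + 1)‖ ^ 2) :
    (K (x (l + 2)) y' + G (l + 2) - f) - (K x' (y (l + 2)) + g - F (l + 2))
      + pdhgEnergy K τ σ x y x' y' (l + 1) ≤ pdhgEnergy K τ σ x y x' y' l := by
  have h1 := (abs_le.1 (abs_bilin_le K hτ hσ (x (l + 1) - x l) (y (l + 1) - y (l + 2)))).1
  have h2 : τ * σ * ‖K‖ ^ 2 * (1 / (2 * σ) * ‖y (l + 1) - y (l + 2)‖ ^ 2)
      ≤ 1 * (1 / (2 * σ) * ‖y (l + 1) - y (l + 2)‖ ^ 2) :=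
    mul_le_mul_of_nonneg_right hK (by positivity)
  rw [norm_sub_rev (y (l + 1))] at h1 h2
  rw [hxt] at hy
  simp only [pdhgEnergy, map_sub, map_smul, sub_apply,
    smul_apply, smul_eq_mul] at *
  linarith

theorem map_ergodicAverage {E F : Type*} [AddCommGroup E] [Module ℝ E] [AddCommGroup F]
    [Module ℝ F] (ℓ : E →ₗ[ℝ] F) (u : ℕ → E) (l : ℕ) :
    ℓ (ergodicAverage u l) = ergodicAverage (fun j => ℓ (u j)) l := by
  simp [ergodicAverage]

theorem ergodicAverage_le_of_sum_le {u : ℕ → ℝ} {C : ℝ} {l : ℕ}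
    (h : ∑ j ∈ Finset.Icc 1 l, u j ≤ C) : ergodicAverage u l ≤ C * (1 / (l : ℝ)) := by
  rw [ergodicAverage, smul_eq_mul, mul_comm]
  exact mul_le_mul_of_nonneg_right h (by positivity)

/-- The primal-dual gap of `(u, v)` against the comparison points `p` and `q`. -/
noncomputable def gap (K : X →L[ℝ] Y →L[ℝ] ℝ) (p : X × ℝ) (q : Y × ℝ) (u : X × ℝ) (v : Y × ℝ) : ℝ :=
  (K u.1 q.1 + u.2 - q.2) - (K p.1 v.1 + p.2 - v.2)

theorem ergodicAverage_gap (K : X →L[ℝ] Y →L[ℝ] ℝ) (p : X × ℝ) (q : Y × ℝ) (u : ℕ → X × ℝ)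
    (v : ℕ → Y × ℝ) {l : ℕ} (hl : 1 ≤ l) :
    ergodicAverage (fun j => gap K p q (u j) (v j)) l
      = gap K p q (ergodicAverage u l) (ergodicAverage v l) := by
  have hl' : (l : ℝ) ≠ 0 := by positivity
  simp only [ergodicAverage, gap, Prod.smul_fst, Prod.smul_snd, Prod.fst_sum, Prod.snd_sum, map_smul,
    map_sum, smul_apply, sum_apply, Finset.sum_sub_distrib, Finset.sum_add_distrib,
    Finset.sum_const, Nat.card_Icc, smul_eq_mul, nsmul_eq_mul, Nat.add_sub_cancel]
  field_simp

/-- Summing the one-step estimate: the average gap is `O(1 / l)`, and the energy stays bounded. -/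
theorem sum_gap_add_pdhgEnergy_le (K : X →L[ℝ] Y →L[ℝ] ℝ) (τ σ : ℝ) (x : ℕ → X) (y : ℕ → Y)
    (G F : ℕ → ℝ) (p : X × ℝ) (q : Y × ℝ)
    (hstep : ∀ l, gap K p q (x (l + 2), G (l + 2)) (y (l + 2), F (l + 2))
      + pdhgEnergy K τ σ x y p.1 q.1 (l + 1) ≤ pdhgEnergy K τ σ x y p.1 q.1 l) (N : ℕ) :
    ∑ j ∈ Finset.Icc 1 (N + 1), gap K p q (x j, G j) (y j, F j) + pdhgEnergy K τ σ x y p.1 q.1 N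
      ≤ gap K p q (x 1, G 1) (y 1, F 1) + pdhgEnergy K τ σ x y p.1 q.1 0 := by
  induction N with
  | zero => simp
  | succ N ih =>
    rw [Finset.sum_Icc_succ_top (by omega)]
    have := hstep N
    linarith

/-- Ergodic convergence.  The energy bounds the iterates through a saddle point, and bounds
the sum of the gaps at every comparison point; dividing by `l` and using weak lower
semicontinuity of `f` and `h`, every weak limit of the averages is a saddle point. -/
theorem ergodic_convergence [CompleteSpace X] [CompleteSpace Y] (K : X →L[ℝ] Y →L[ℝ] ℝ)
    {f : X → EReal} {h : Y → EReal} (hf : EProper f) (hfc : EConvex f)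
    (hfl : LowerSemicontinuous f) (hh : EProper h) (hhc : EConvex h) (hhl : LowerSemicontinuous h)
    {τ σ : ℝ} (hτ : 0 < τ) (hσ : 0 < σ) (hK : τ * σ * ‖K‖ ^ 2 < 1)
    (x xt : ℕ → X) (y : ℕ → Y)
    (hy : ∀ l, IsMinOn (eProxObjective h (-K (xt l)) (1 / (2 * σ)) (y l)) univ (y (l + 1)))
    (hx : ∀ l, IsMinOn (eProxObjective f (K.flip (y (l + 1))) (1 / (2 * τ)) (x l)) univ (x (l + 1)))
    (hxt : ∀ l, xt (l + 1) = (2 : ℝ) • x (l + 1) - x l)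
    {x₀ : X} {y₀ : Y} (hx₀ : f x₀ ≠ ⊤) (hy₀ : h y₀ ≠ ⊤)
    (hsad : ∀ p ∈ realEpigraph f, ∀ q ∈ realEpigraph h,
      K x₀ q.1 + (f x₀).toReal - q.2 ≤ K p.1 y₀ + p.2 - (h y₀).toReal) :
    ∃ (xs : X) (ys : Y), f xs ≠ ⊤ ∧ h ys ≠ ⊤ ∧
      (∀ p ∈ realEpigraph f, ∀ q ∈ realEpigraph h,
        K xs q.1 + (f xs).toReal - q.2 ≤ K p.1 ys + p.2 - (h ys).toReal) ∧
      ∃ k : ℕ → ℕ, StrictMono k ∧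
        (∀ ℓ : X →L[ℝ] ℝ, Tendsto (fun j => ℓ (ergodicAverage x (k j))) atTop (𝓝 (ℓ xs))) ∧
        (∀ ℓ : Y →L[ℝ] ℝ, Tendsto (fun j => ℓ (ergodicAverage y (k j))) atTop (𝓝 (ℓ ys))) := by
  set Gv : ℕ → ℝ := fun j => (f (x j)).toReal with hGv
  set Fv : ℕ → ℝ := fun j => (h (y j)).toReal with hFv
  have hxmem : ∀ j, 1 ≤ j → (x j, Gv j) ∈ realEpigraph f := by
    intro j hj
    obtain ⟨l, rfl⟩ := Nat.exists_eq_add_of_le' hj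
    exact mem_realEpigraph_toReal (hf.1 _) ((isMinOn_eProxObjective_iff hf _ _ _ _).1 (hx l)).1
  have hymem : ∀ j, 1 ≤ j → (y j, Fv j) ∈ realEpigraph h := by
    intro j hj
    obtain ⟨l, rfl⟩ := Nat.exists_eq_add_of_le' hj
    exact mem_realEpigraph_toReal (hh.1 _) ((isMinOn_eProxObjective_iff hh _ _ _ _).1 (hy l)).1
  have hstep : ∀ p ∈ realEpigraph f, ∀ q ∈ realEpigraph h, ∀ l,
      gap K p q (x (l + 2), Gv (l + 2)) (y (l + 2), Fv (l + 2))
        + pdhgEnergy K τ σ x y p.1 q.1 (l + 1) ≤ pdhgEnergy K τ σ x y p.1 q.1 l := by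
    intro p hp q hq l
    have h1 := isMinOn_eProxObjective_three_point hh hhc (hy (l + 1)) hq
    have h2 := isMinOn_eProxObjective_three_point hf hfc (hx (l + 1)) hp
    simp only [proxObjective, neg_apply, ContinuousLinearMap.flip_apply] at h1 h2
    refine gap_add_pdhgEnergy_le K hτ hσ hK.le x xt y Gv Fv p.1 q.1 l p.2 q.2 (hxt l) ?_ ?_
    · linarith
    · linarith
  have hE0 : ∀ (x' : X) (y' : Y) (l : ℕ), 0 ≤ pdhgEnergy K τ σ x y x' y' l := by
    intro x' y' l
    refine le_trans ?_ (le_pdhgEnergy K hτ hσ x y x' y' l)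
    have : 0 ≤ 1 - τ * σ * ‖K‖ ^ 2 := by linarith
    positivity
  have hsum := fun p hp q hq => sum_gap_add_pdhgEnergy_le K τ σ x y Gv Fv p q (hstep p hp q hq)
  have hp₀ : (x₀, (f x₀).toReal) ∈ realEpigraph f := mem_realEpigraph_toReal (hf.1 _) hx₀
  have hq₀ : (y₀, (h y₀).toReal) ∈ realEpigraph h := mem_realEpigraph_toReal (hh.1 _) hy₀
  set p₀ : X × ℝ := (x₀, (f x₀).toReal)
  set q₀ : Y × ℝ := (y₀, (h y₀).toReal)
  have hgap0 : ∀ u ∈ realEpigraph f, ∀ v ∈ realEpigraph h, 0 ≤ gap K p₀ q₀ u v := by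
    intro u hu v hv
    have := hsad u hu v hv
    simp only [gap, p₀, q₀]
    linarith
  -- the iterates are bounded, by the energy relative to the given saddle point
  set E := gap K p₀ q₀ (x 1, Gv 1) (y 1, Fv 1) + pdhgEnergy K τ σ x y x₀ y₀ 0 with hE
  have hEle : ∀ N, pdhgEnergy K τ σ x y x₀ y₀ N ≤ E := by
    intro N
    have h1 := hsum p₀ hp₀ q₀ hq₀ N
    have h2 : 0 ≤ ∑ j ∈ Finset.Icc 1 (N + 1), gap K p₀ q₀ (x j, Gv j) (y j, Fv j) :=
      Finset.sum_nonneg fun j hj => hgap0 _ (hxmem j (Finset.mem_Icc.1 hj).1) _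
        (hymem j (Finset.mem_Icc.1 hj).1)
    linarith
  have hθ : 0 < 1 - τ * σ * ‖K‖ ^ 2 := by linarith
  obtain ⟨R, hRx, hRy⟩ : ∃ R, (∀ j, 1 ≤ j → ‖x j‖ ≤ R) ∧ ∀ j, 1 ≤ j → ‖y j‖ ≤ R := by
    refine ⟨max (‖x₀‖ + √(2 * τ * E)) (‖y₀‖ + √(2 * σ * E / (1 - τ * σ * ‖K‖ ^ 2))),
      fun j hj => le_max_of_le_left ?_, fun j hj => le_max_of_le_right ?_⟩ <;>
    obtain ⟨l, rfl⟩ := Nat.exists_eq_add_of_le' hj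
    · have h1 := (le_pdhgEnergy K hτ hσ x y x₀ y₀ l).trans (hEle l)
      have h2 : 0 ≤ (1 - τ * σ * ‖K‖ ^ 2) * (1 / (2 * σ) * ‖y₀ - y (l + 1)‖ ^ 2) := by positivity
      have h3 : ‖x₀ - x (l + 1)‖ ≤ √(2 * τ * E) := by
        refine Real.le_sqrt_of_sq_le ?_
        have : 1 / (2 * τ) * ‖x₀ - x (l + 1)‖ ^ 2 ≤ E := by linarith
        rw [one_div, inv_mul_le_iff₀ (by positivity)] at this
        exact this
      have h4 := norm_le_norm_add_norm_sub x₀ (x (l + 1))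
      linarith
    · have h1 := (le_pdhgEnergy K hτ hσ x y x₀ y₀ l).trans (hEle l)
      have h2 : 0 ≤ 1 / (2 * τ) * ‖x₀ - x (l + 1)‖ ^ 2 := by positivity
      have h3 : ‖y₀ - y (l + 1)‖ ≤ √(2 * σ * E / (1 - τ * σ * ‖K‖ ^ 2)) := by
        refine Real.le_sqrt_of_sq_le ?_
        have : (1 - τ * σ * ‖K‖ ^ 2) * (1 / (2 * σ) * ‖y₀ - y (l + 1)‖ ^ 2) ≤ E := by linarith
        rw [le_div_iff₀ hθ]
        calc ‖y₀ - y (l + 1)‖ ^ 2 * (1 - τ * σ * ‖K‖ ^ 2)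
            = 2 * σ * ((1 - τ * σ * ‖K‖ ^ 2) * (1 / (2 * σ) * ‖y₀ - y (l + 1)‖ ^ 2)) := by
              field_simp
          _ ≤ 2 * σ * E := by gcongr
      have h4 := norm_le_norm_add_norm_sub y₀ (y (l + 1))
      linarith
  -- averages of the iterates together with their function values
  set U : ℕ → X × ℝ := fun n => ergodicAverage (fun j => (x j, Gv j)) (n + 1) with hU
  set V : ℕ → Y × ℝ := fun n => ergodicAverage (fun j => (y j, Fv j)) (n + 1) with hV
  have hU1 : ∀ n, (U n).1 = ergodicAverage x (n + 1) := fun n =>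
    map_ergodicAverage (LinearMap.fst ℝ X ℝ) _ _
  have hV1 : ∀ n, (V n).1 = ergodicAverage y (n + 1) := fun n =>
    map_ergodicAverage (LinearMap.fst ℝ Y ℝ) _ _
  have hUmem : ∀ n, U n ∈ realEpigraph f := fun n => ergodicAverage_mem hfc hxmem (by omega)
  have hVmem : ∀ n, V n ∈ realEpigraph h := fun n => ergodicAverage_mem hhc hymem (by omega)
  have hgapUV : ∀ p ∈ realEpigraph f, ∀ q ∈ realEpigraph h, ∃ C, 0 ≤ C ∧ ∀ n : ℕ,
      gap K p q (U n) (V n) ≤ C * (1 / ((n : ℝ) + 1)) := by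
    intro p hp q hq
    refine ⟨|gap K p q (x 1, Gv 1) (y 1, Fv 1) + pdhgEnergy K τ σ x y p.1 q.1 0|, abs_nonneg _,
      fun n => ?_⟩
    rw [hU, hV, ← ergodicAverage_gap K p q _ _ (by omega)]
    have h1 := hsum p hp q hq n
    have h2 := hE0 p.1 q.1 n
    have h3 := le_abs_self (gap K p q (x 1, Gv 1) (y 1, Fv 1) + pdhgEnergy K τ σ x y p.1 q.1 0)
    have := ergodicAverage_le_of_sum_le (u := fun j => gap K p q (x j, Gv j) (y j, Fv j))
      (l := n + 1) (by linarith)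
    simpa using this
  have hRU : ∀ n, ‖(U n).1‖ ≤ R := fun n => by
    rw [hU1]; exact norm_ergodicAverage_le hRx (by omega)
  have hRV : ∀ n, ‖(V n).1‖ ≤ R := fun n => by
    rw [hV1]; exact norm_ergodicAverage_le hRy (by omega)
  -- both function values are bounded: from below by the saddle inequality, and their sum from
  -- above by the gap
  obtain ⟨C, hC0, hC⟩ := hgapUV p₀ hp₀ q₀ hq₀
  have hbdd : ∀ n, |(U n).2| ≤ C + |K x₀ y₀ + (f x₀).toReal| + ‖K‖ * R * ‖y₀‖ ∧
      |(V n).2| ≤ C + |K x₀ y₀ - (h y₀).toReal| + ‖K‖ * ‖x₀‖ * R := by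
    intro n
    have h1 := hsad _ (hUmem n) _ hq₀
    have h2 := hsad _ hp₀ _ (hVmem n)
    have h3 : gap K p₀ q₀ (U n) (V n) ≤ C := by
      refine (hC n).trans (mul_le_of_le_one_right hC0 ?_)
      rw [div_le_one (by positivity)]
      linarith [Nat.cast_nonneg (α := ℝ) n]
    have h4 : |K (U n).1 y₀| ≤ ‖K‖ * R * ‖y₀‖ := by
      refine (K.le_opNorm₂ _ _).trans ?_
      gcongr
      exact hRU n
    have h5 : |K x₀ (V n).1| ≤ ‖K‖ * ‖x₀‖ * R := by
      refine (K.le_opNorm₂ _ _).trans ?_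
      gcongr
      exact hRV n
    simp only [gap, p₀, q₀] at h1 h2 h3
    have h6 := abs_le.1 h4
    have h7 := abs_le.1 h5
    have h8 := abs_le.1 (le_refl |K x₀ y₀ + (f x₀).toReal|)
    have h9 := abs_le.1 (le_refl |K x₀ y₀ - (h y₀).toReal|)
    constructor <;> rw [abs_le] <;> constructor <;> linarith
  obtain ⟨xs, k₁, hk₁, hlim₁⟩ := exists_weakly_convergent_subseq (fun n => (U n).1) R hRU
  obtain ⟨ys, k₂, hk₂, hlim₂⟩ := exists_weakly_convergent_subseq (fun n => (V (k₁ n)).1) R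
    fun n => hRV _
  obtain ⟨a, k₃, hk₃, hlim₃⟩ := exists_weakly_convergent_subseq (fun n => (U (k₁ (k₂ n))).2) _
    fun n => (hbdd _).1
  obtain ⟨b, k₄, hk₄, hlim₄⟩ := exists_weakly_convergent_subseq (fun n => (V (k₁ (k₂ (k₃ n)))).2) _
    fun n => (hbdd _).2
  set k : ℕ → ℕ := fun j => k₁ (k₂ (k₃ (k₄ j))) with hk
  have hkm : StrictMono k := hk₁.comp (hk₂.comp (hk₃.comp hk₄))
  have hlx : ∀ ℓ : X →L[ℝ] ℝ, Tendsto (fun j => ℓ (U (k j)).1) atTop (𝓝 (ℓ xs)) := fun ℓ =>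
    (hlim₁ ℓ).comp (hk₂.comp (hk₃.comp hk₄)).tendsto_atTop
  have hly : ∀ ℓ : Y →L[ℝ] ℝ, Tendsto (fun j => ℓ (V (k j)).1) atTop (𝓝 (ℓ ys)) := fun ℓ =>
    (hlim₂ ℓ).comp (hk₃.comp hk₄).tendsto_atTop
  have hla : Tendsto (fun j => (U (k j)).2) atTop (𝓝 a) :=
    (hlim₃ (ContinuousLinearMap.id ℝ ℝ)).comp hk₄.tendsto_atTop
  have hlb : Tendsto (fun j => (V (k j)).2) atTop (𝓝 b) := hlim₄ (ContinuousLinearMap.id ℝ ℝ)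
  have hmemx : (xs, a) ∈ realEpigraph f :=
    mem_of_weak_tendsto hfc (isClosed_realEpigraph hfl) hlx hla fun j => hUmem _
  have hmemy : (ys, b) ∈ realEpigraph h :=
    mem_of_weak_tendsto hhc (isClosed_realEpigraph hhl) hly hlb fun j => hVmem _
  refine ⟨xs, ys, ne_top_of_mem_realEpigraph hmemx, ne_top_of_mem_realEpigraph hmemy, ?_,
    fun j => k j + 1, fun i j hij => Nat.succ_lt_succ (hkm hij), ?_, ?_⟩
  · intro p hp q hq
    obtain ⟨C', -, hC'⟩ := hgapUV p hp q hq
    have hlim : Tendsto (fun j => gap K p q (U (k j)) (V (k j))) atTop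
        (𝓝 (gap K p q (xs, a) (ys, b))) :=
      (((hlx (K.flip q.1)).add hla).sub_const _).sub (((hly (K p.1)).add_const _).sub hlb)
    have hzero : Tendsto (fun j => C' * (1 / ((k j : ℝ) + 1))) atTop (𝓝 0) := by
      simpa using ((tendsto_one_div_add_atTop_nhds_zero_nat (𝕜 := ℝ)).comp
        hkm.tendsto_atTop).const_mul C'
    have h1 : gap K p q (xs, a) (ys, b) ≤ 0 :=
      le_of_tendsto_of_tendsto' hlim hzero fun j => hC' _
    have h2 := toReal_le_of_mem_realEpigraph (hf.1 xs) hmemx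
    have h3 := toReal_le_of_mem_realEpigraph (hh.1 ys) hmemy
    simp only [gap] at h1
    linarith
  · intro ℓ
    simpa only [hU1] using hlx ℓ
  · intro ℓ
    simpa only [hV1] using hly ℓ

end Ergodic

/-! ### The perspective function -/

section Perspective

variable {E : Type*} [NormedAddCommGroup E] [NormedSpace ℝ E] {L : E → ℝ≥0∞}

theorem perspective_of_neg {r : ℝ} (hr : r < 0) (v : E) : perspective L r v = ⊤ := by
  simp [perspective, hr]

theorem perspective_of_pos {r : ℝ} (hr : 0 < r) (v : E) :
    perspective L r v = ENNReal.ofReal r * L (r⁻¹ • v) := by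
  simp [perspective, hr.not_gt, hr.ne']

theorem perspective_zero_zero : perspective L 0 (0 : E) = 0 := by
  simp [perspective]

theorem perspective_zero_of_ne {v : E} (hv : v ≠ 0) : perspective L 0 v = ⊤ := by
  simp [perspective, hv]

theorem perspective_smul {r : ℝ} (hr : 0 ≤ r) (v : E) :
    perspective L r (r • v) = ENNReal.ofReal r * L v := by
  rcases hr.eq_or_lt with rfl | hr
  · simp [perspective]
  · rw [perspective_of_pos hr, inv_smul_smul₀ hr.ne']

/-- Finiteness of the perspective forces `0 ≤ r` and `v = r α`. -/
theorem eq_smul_of_perspective_ne_top {r : ℝ} {v : E} (h : perspective L r v ≠ ⊤) :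
    0 ≤ r ∧ v = r • (r⁻¹ • v) := by
  rcases lt_trichotomy r 0 with hr | rfl | hr
  · exact absurd (perspective_of_neg hr v) h
  · refine ⟨le_rfl, ?_⟩
    by_contra hv
    exact h (perspective_zero_of_ne fun h0 => hv (by simp [h0]))
  · exact ⟨hr.le, (smul_inv_smul₀ hr.ne' v).symm⟩

theorem perspective_homogeneous {a : ℝ} (ha : 0 < a) (r : ℝ) (v : E) :
    perspective L (a * r) (a • v) = ENNReal.ofReal a * perspective L r v := by
  rcases lt_trichotomy r 0 with hr | rfl | hr
  · rw [perspective_of_neg hr, perspective_of_neg (mul_neg_of_pos_of_neg ha hr),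
      ENNReal.mul_top (by simpa using ha)]
  · rw [mul_zero]
    rcases eq_or_ne v 0 with rfl | hv
    · simp [perspective_zero_zero]
    · rw [perspective_zero_of_ne hv, perspective_zero_of_ne (smul_ne_zero ha.ne' hv),
        ENNReal.mul_top (by simpa using ha)]
  · rw [perspective_of_pos hr, perspective_of_pos (mul_pos ha hr), ENNReal.ofReal_mul ha.le,
      mul_assoc, smul_smul, mul_inv, mul_right_comm, inv_mul_cancel₀ ha.ne',
      one_mul]

theorem EConvex.ennreal_le (hL : EConvex (fun α => (L α : EReal))) {a b : ℝ} (ha : 0 < a)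
    (hb : 0 < b) (hab : a + b = 1) (α β : E) :
    L (a • α + b • β) ≤ ENNReal.ofReal a * L α + ENNReal.ofReal b * L β := by
  rcases eq_or_ne (L α) ⊤ with h | h
  · simp [h, ENNReal.mul_top, ha]
  rcases eq_or_ne (L β) ⊤ with h' | h'
  · simp [h', ENNReal.mul_top, hb]
  have hmem : ∀ γ, L γ ≠ ⊤ → (γ, (L γ).toReal) ∈ {p : E × ℝ | (L p.1 : EReal) ≤ (p.2 : EReal)} := by
    intro γ hγ
    simp only [mem_ofPred_eq]
    rw [EReal.coe_ennreal_toReal hγ]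
  have := hL (hmem α h) (hmem β h') ha.le hb.le hab
  simp only [mem_ofPred_eq, Prod.smul_mk, Prod.mk_add_mk, smul_eq_mul] at this
  have h2 : ((a * (L α).toReal + b * (L β).toReal : ℝ) : EReal)
      = ((ENNReal.ofReal a * L α + ENNReal.ofReal b * L β : ℝ≥0∞) : EReal) := by
    rw [← ENNReal.ofReal_toReal h, ← ENNReal.ofReal_toReal h', ← ENNReal.ofReal_mul ha.le,
      ← ENNReal.ofReal_mul hb.le, ← ENNReal.ofReal_add (by positivity) (by positivity),
      EReal.coe_ennreal_ofReal, max_eq_left (by positivity)]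
    simp
  rw [h2] at this
  exact EReal.coe_ennreal_le_coe_ennreal_iff.1 this

theorem perspective_add_le (hL : EConvex (fun α => (L α : EReal))) (r s : ℝ) (v w : E) :
    perspective L (r + s) (v + w) ≤ perspective L r v + perspective L s w := by
  rcases lt_trichotomy r 0 with hr | rfl | hr
  · simp [perspective_of_neg hr]
  · rcases eq_or_ne v 0 with rfl | hv
    · simp [perspective_zero_zero]
    · simp [perspective_zero_of_ne hv]
  rcases lt_trichotomy s 0 with hs | rfl | hs
  · simp [perspective_of_neg hs]
  · rcases eq_or_ne w 0 with rfl | hw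
    · simp [perspective_zero_zero]
    · simp [perspective_zero_of_ne hw]
  have hrs := add_pos hr hs
  rw [perspective_of_pos hr, perspective_of_pos hs, perspective_of_pos hrs]
  have e : (r + s)⁻¹ • (v + w) = (r / (r + s)) • (r⁻¹ • v) + (s / (r + s)) • (s⁻¹ • w) := by
    rw [smul_smul, smul_smul, smul_add]
    congr 2 <;> field_simp
  have h := hL.ennreal_le (div_pos hr hrs) (div_pos hs hrs)
    (by rw [← add_div, div_self hrs.ne']) (r⁻¹ • v) (s⁻¹ • w)
  rw [e]
  refine (mul_le_mul_right h _).trans (le_of_eq ?_)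
  rw [mul_add, ← mul_assoc, ← mul_assoc, ← ENNReal.ofReal_mul hrs.le, ← ENNReal.ofReal_mul hrs.le,
    mul_div_cancel₀ _ hrs.ne', mul_div_cancel₀ _ hrs.ne']

/-- The perspective is jointly lower semicontinuous.  At `r = 0` this is where `1`-coercivity
enters: `r L(v / r) ≥ M ‖v‖` for any `M` as soon as `v / r` is large. -/
theorem perspective_le_liminf (hl : LowerSemicontinuous L) (hco : OneCoercive L) {ι : Type*}
    {l : Filter ι} [l.NeBot] {r : ι → ℝ} {v : ι → E} {r₀ : ℝ} {v₀ : E} (hr : Tendsto r l (𝓝 r₀))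
    (hv : Tendsto v l (𝓝 v₀)) :
    perspective L r₀ v₀ ≤ liminf (fun j => perspective L (r j) (v j)) l := by
  rcases lt_trichotomy r₀ 0 with h | rfl | h
  · refine le_liminf_of_le (by isBoundedDefault) ?_
    filter_upwards [hr.eventually (gt_mem_nhds h)] with j hj
    rw [perspective_of_neg hj]; exact le_top
  · rcases eq_or_ne v₀ 0 with rfl | hv0
    · rw [perspective_zero_zero]; exact zero_le
    · have hv0' : 0 < ‖v₀‖ := norm_pos_iff.2 hv0
      rw [perspective_zero_of_ne hv0, top_le_iff]
      refine ENNReal.eq_top_of_forall_nnreal_le fun M => le_liminf_of_le (by isBoundedDefault) ?_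
      set N : ℝ := M / (‖v₀‖ / 2) with hN
      have hN0 : 0 ≤ N := by positivity
      have h1 : ∀ᶠ α in Bornology.cobounded E, ENNReal.ofReal N < L α / ENNReal.ofReal ‖α‖ :=
        hco.eventually (lt_mem_nhds ENNReal.ofReal_lt_top)
      obtain ⟨R, -, hR⟩ := (hasBasis_cobounded_norm (E := E)).eventually_iff.1 h1
      have h2 : ∀ᶠ j in l, ‖v₀‖ / 2 < ‖v j‖ := hv.norm.eventually (lt_mem_nhds (by linarith))
      have h3 : ∀ᶠ j in l, r j * R < ‖v₀‖ / 2 :=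
        (hr.mul_const R).eventually (gt_mem_nhds (by simpa using hv0'))
      filter_upwards [h2, h3] with j hj2 hj3
      have hvj : 0 < ‖v j‖ := by linarith
      rcases lt_trichotomy (r j) 0 with hj | hj | hj
      · rw [perspective_of_neg hj]; exact le_top
      · rw [hj, perspective_zero_of_ne (norm_pos_iff.1 hvj)]; exact le_top
      · rw [perspective_of_pos hj]
        have hn : ‖(r j)⁻¹ • v j‖ = (r j)⁻¹ * ‖v j‖ := by
          rw [norm_smul, Real.norm_of_nonneg (by positivity)]
        have hα := hR (x := (r j)⁻¹ • v j) (by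
          simp only [mem_ofPred_eq, hn]
          rw [inv_mul_eq_div, le_div_iff₀ hj]; linarith)
        have hnpos : 0 < ‖(r j)⁻¹ • v j‖ := by rw [hn]; positivity
        have h4 : ENNReal.ofReal N * ENNReal.ofReal ‖(r j)⁻¹ • v j‖ ≤ L ((r j)⁻¹ • v j) :=
          (ENNReal.le_div_iff_mul_le (Or.inl (by simpa using hnpos))
            (Or.inl ENNReal.ofReal_ne_top)).1 hα.le
        refine le_trans ?_ (mul_le_mul_right h4 _)
        rw [← ENNReal.ofReal_mul hN0, ← ENNReal.ofReal_mul hj.le, hn,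
          ← ENNReal.ofReal_coe_nnreal]
        refine ENNReal.ofReal_le_ofReal ?_
        have : r j * (N * ((r j)⁻¹ * ‖v j‖)) = N * ‖v j‖ := by field_simp
        rw [this, hN, div_mul_eq_mul_div, le_div_iff₀ (by positivity)]
        exact mul_le_mul_of_nonneg_left hj2.le M.2
  · rw [perspective_of_pos h]
    have h1 : Tendsto (fun j => ENNReal.ofReal (r j)) l (𝓝 (ENNReal.ofReal r₀)) :=
      ENNReal.tendsto_ofReal hr
    have h2 : Tendsto (fun j => (r j)⁻¹ • v j) l (𝓝 (r₀⁻¹ • v₀)) := (hr.inv₀ h.ne').smul hv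
    have h3 : L (r₀⁻¹ • v₀) ≤ liminf (fun j => L ((r j)⁻¹ • v j)) l := by
      refine (LowerSemicontinuousAt.le_liminf (hl _)).trans ?_
      exact liminf_le_liminf_of_le (g := map (fun j => (r j)⁻¹ • v j) l) h2
    calc ENNReal.ofReal r₀ * L (r₀⁻¹ • v₀)
        ≤ liminf (fun j => ENNReal.ofReal (r j)) l * liminf (fun j => L ((r j)⁻¹ • v j)) l := by
          rw [h1.liminf_eq]; gcongr
      _ ≤ liminf (fun j => ENNReal.ofReal (r j) * L ((r j)⁻¹ • v j)) l := ENNReal.le_liminf_mul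
      _ = _ := by
          refine liminf_congr ?_
          filter_upwards [hr.eventually (lt_mem_nhds h)] with j hj
          rw [perspective_of_pos hj]

end Perspective

/-! ### The functional `F̂` -/

section Dual

variable {n m : ℕ} {lo hi : Fin n → ℝ} {T : ℝ}
  {L : (Fin n → ℝ) → ℝ → EuclideanSpace ℝ (Fin m) → ℝ≥0∞}

theorem measurableSet_spaceTime (lo hi : Fin n → ℝ) (T : ℝ) : MeasurableSet (spaceTime lo hi T) :=
  (spaceTime_isCompact lo hi T).isClosed.measurableSet

theorem reverse_mem_spaceTime {p : (Fin n → ℝ) × ℝ} (hp : p ∈ spaceTime lo hi T) :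
    (p.1, T - p.2) ∈ spaceTime lo hi T :=
  ⟨hp.1, sub_nonneg.2 hp.2.2, sub_le_self _ hp.2.1⟩

theorem measurable_perspective
    (hLmeas : Measurable
      (fun q : ((Fin n → ℝ) × ℝ) × EuclideanSpace ℝ (Fin m) => L q.1.1 q.1.2 q.2))
    {ρ : (Fin n → ℝ) × ℝ → ℝ} {v : (Fin n → ℝ) × ℝ → EuclideanSpace ℝ (Fin m)}
    (hρ : Measurable ρ) (hv : Measurable v) :
    Measurable fun p => perspective (L p.1 (T - p.2)) (ρ p) (v p) := by
  have hm : Measurable fun p : (Fin n → ℝ) × ℝ => L p.1 (T - p.2) ((ρ p)⁻¹ • v p) :=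
    hLmeas.comp (f := fun p : (Fin n → ℝ) × ℝ => ((p.1, T - p.2), (ρ p)⁻¹ • v p))
      ((measurable_fst.prodMk (measurable_const.sub measurable_snd)).prodMk (hρ.inv.smul hv))
  simp only [perspective]
  refine Measurable.ite (hρ measurableSet_Iio) measurable_const ?_
  refine Measurable.ite (hρ (measurableSet_singleton 0)) ?_ (hρ.ennreal_ofReal.mul hm)
  exact Measurable.ite (hv (measurableSet_singleton 0)) measurable_const measurable_const

theorem dualFunctional_nonneg (y : DualSpace lo hi T m) : 0 ≤ dualFunctional L y :=
  EReal.coe_ennreal_nonneg _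

theorem dualFunctional_zero : dualFunctional L (0 : DualSpace lo hi T m) = 0 := by
  rw [dualFunctional, lintegral_eq_zero_of_ae_eq_zero]
  · rfl
  · filter_upwards [Lp.coeFn_zero ℝ 2 (volume.restrict (spaceTime lo hi T)),
      Lp.coeFn_zero (EuclideanSpace ℝ (Fin m)) 2 (volume.restrict (spaceTime lo hi T))] with p h1 h2
    rw [WithLp.zero_fst, WithLp.zero_snd, h1, h2]
    exact perspective_zero_zero

theorem eproper_dualFunctional : EProper (dualFunctional L : DualSpace lo hi T m → EReal) :=
  ⟨fun y => (lt_of_lt_of_le (by simp) (dualFunctional_nonneg y)).ne', 0,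
    by rw [dualFunctional_zero]; exact EReal.zero_ne_top⟩

theorem measurable_perspective_coe
    (hLmeas : Measurable
      (fun q : ((Fin n → ℝ) × ℝ) × EuclideanSpace ℝ (Fin m) => L q.1.1 q.1.2 q.2))
    (y : DualSpace lo hi T m) :
    Measurable fun p => perspective (L p.1 (T - p.2)) (y.fst p) (y.snd p) :=
  measurable_perspective hLmeas (Lp.stronglyMeasurable _).measurable
    (Lp.stronglyMeasurable _).measurable

theorem lintegral_perspective_combo_le
    (hLmeas : Measurable
      (fun q : ((Fin n → ℝ) × ℝ) × EuclideanSpace ℝ (Fin m) => L q.1.1 q.1.2 q.2))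
    (hLconvex : ∀ p ∈ spaceTime lo hi T, EConvex (fun α => (L p.1 p.2 α : EReal)))
    (y z : DualSpace lo hi T m) {a b : ℝ} (ha : 0 < a) (hb : 0 < b) :
    ∫⁻ p in spaceTime lo hi T, perspective (L p.1 (T - p.2)) ((a • y + b • z).fst p)
        ((a • y + b • z).snd p)
      ≤ ENNReal.ofReal a * (∫⁻ p in spaceTime lo hi T,
          perspective (L p.1 (T - p.2)) (y.fst p) (y.snd p))
        + ENNReal.ofReal b * ∫⁻ p in spaceTime lo hi T,
          perspective (L p.1 (T - p.2)) (z.fst p) (z.snd p) := by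
  rw [← lintegral_const_mul _ (measurable_perspective_coe hLmeas y),
    ← lintegral_const_mul _ (measurable_perspective_coe hLmeas z),
    ← lintegral_add_left ((measurable_perspective_coe hLmeas y).const_mul _)]
  refine lintegral_mono_ae ?_
  filter_upwards [ae_restrict_mem (measurableSet_spaceTime lo hi T),
    Lp.coeFn_add (a • y.fst) (b • z.fst), Lp.coeFn_smul a y.fst, Lp.coeFn_smul b z.fst,
    Lp.coeFn_add (a • y.snd) (b • z.snd), Lp.coeFn_smul a y.snd, Lp.coeFn_smul b z.snd]
    with p hp h1 h2 h3 h4 h5 h6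
  rw [WithLp.add_fst, WithLp.add_snd, WithLp.smul_fst, WithLp.smul_fst, WithLp.smul_snd,
    WithLp.smul_snd, h1, h4, Pi.add_apply, Pi.add_apply, h2, h3, h5, h6, Pi.smul_apply,
    Pi.smul_apply, Pi.smul_apply, Pi.smul_apply, ← perspective_homogeneous ha,
    ← perspective_homogeneous hb]
  exact perspective_add_le (hLconvex _ (reverse_mem_spaceTime hp)) _ _ _ _

theorem econvex_dualFunctional
    (hLmeas : Measurable
      (fun q : ((Fin n → ℝ) × ℝ) × EuclideanSpace ℝ (Fin m) => L q.1.1 q.1.2 q.2))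
    (hLconvex : ∀ p ∈ spaceTime lo hi T, EConvex (fun α => (L p.1 p.2 α : EReal))) :
    EConvex (dualFunctional L : DualSpace lo hi T m → EReal) := by
  rw [EConvex, convex_iff_forall_pos]
  rintro ⟨y, r⟩ hy ⟨z, s⟩ hz a b ha hb -
  simp only [mem_ofPred_eq, Prod.smul_mk, Prod.mk_add_mk, smul_eq_mul, dualFunctional] at *
  have key : ∀ (x : ℝ≥0∞) (t : ℝ), (x : EReal) ≤ (t : EReal) ↔ 0 ≤ t ∧ x ≤ ENNReal.ofReal t := by
    intro x t
    constructor
    · intro h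
      have ht : 0 ≤ t := by
        have : (0 : EReal) ≤ (t : EReal) := (EReal.coe_ennreal_nonneg x).trans h
        exact_mod_cast this
      refine ⟨ht, ?_⟩
      rw [← EReal.coe_ennreal_le_coe_ennreal_iff, EReal.coe_ennreal_ofReal, max_eq_left ht]
      exact h
    · rintro ⟨ht, h⟩
      rw [← EReal.coe_ennreal_le_coe_ennreal_iff, EReal.coe_ennreal_ofReal, max_eq_left ht] at h
      exact h
  rw [key] at hy hz ⊢
  have hy0 := hy.1
  have hz0 := hz.1
  refine ⟨by positivity, (lintegral_perspective_combo_le hLmeas hLconvex y z ha hb).trans ?_⟩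
  rw [ENNReal.ofReal_add (by positivity) (by positivity), ENNReal.ofReal_mul ha.le,
    ENNReal.ofReal_mul hb.le]
  exact add_le_add (mul_le_mul_right hy.2 _) (mul_le_mul_right hz.2 _)

/-- Fatou's lemma along a subsequence that converges almost everywhere. -/
theorem lowerSemicontinuous_dualFunctional
    (hLmeas : Measurable
      (fun q : ((Fin n → ℝ) × ℝ) × EuclideanSpace ℝ (Fin m) => L q.1.1 q.1.2 q.2))
    (hLlsc : ∀ p ∈ spaceTime lo hi T, LowerSemicontinuous (L p.1 p.2))
    (hLcoercive : ∀ p ∈ spaceTime lo hi T, OneCoercive (L p.1 p.2)) :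
    LowerSemicontinuous (dualFunctional L : DualSpace lo hi T m → EReal) := by
  rw [lowerSemicontinuous_iff_isClosed_preimage]
  intro c
  refine IsSeqClosed.isClosed fun y y₀ hy hlim => ?_
  have h1 : Tendsto (fun j => (y j).fst) atTop (𝓝 y₀.fst) :=
    ((WithLp.prod_continuous_ofLp 2 _ _).fst.tendsto y₀).comp hlim
  have h2 : Tendsto (fun j => (y j).snd) atTop (𝓝 y₀.snd) :=
    ((WithLp.prod_continuous_ofLp 2 _ _).snd.tendsto y₀).comp hlim
  obtain ⟨k₁, hk₁, hae₁⟩ := (tendstoInMeasure_of_tendsto_Lp h1).exists_seq_tendsto_ae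
  obtain ⟨k₂, hk₂, hae₂⟩ := (tendstoInMeasure_of_tendsto_Lp
    (h2.comp hk₁.tendsto_atTop)).exists_seq_tendsto_ae
  have hF : ∫⁻ p in spaceTime lo hi T, perspective (L p.1 (T - p.2)) (y₀.fst p) (y₀.snd p)
      ≤ liminf (fun j => ∫⁻ p in spaceTime lo hi T,
        perspective (L p.1 (T - p.2)) ((y (k₁ (k₂ j))).fst p) ((y (k₁ (k₂ j))).snd p)) atTop := by
    refine le_trans (lintegral_mono_ae ?_)
      (lintegral_liminf_le fun j => measurable_perspective_coe hLmeas (y (k₁ (k₂ j))))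
    filter_upwards [ae_restrict_mem (measurableSet_spaceTime lo hi T), hae₁, hae₂] with p hp e1 e2
    exact perspective_le_liminf (hLlsc _ (reverse_mem_spaceTime hp))
      (hLcoercive _ (reverse_mem_spaceTime hp)) (e1.comp hk₂.tendsto_atTop) e2
  have hc0 : 0 ≤ c := (dualFunctional_nonneg (y 0)).trans (hy 0)
  obtain ⟨d, rfl⟩ : ∃ d : ℝ≥0∞, (d : EReal) = c := ⟨c.toENNReal, EReal.coe_toENNReal hc0⟩
  simp only [mem_preimage, mem_Iic, dualFunctional, EReal.coe_ennreal_le_coe_ennreal_iff] at hy ⊢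
  exact hF.trans (liminf_le_of_frequently_le' (Frequently.of_forall fun j => hy _))

/-- Points of finite `F̂` are of the form `(ρ, ρ α)` with `ρ ≥ 0`. -/
theorem exists_control_of_dualFunctional_ne_top
    (hLmeas : Measurable
      (fun q : ((Fin n → ℝ) × ℝ) × EuclideanSpace ℝ (Fin m) => L q.1.1 q.1.2 q.2))
    {y : DualSpace lo hi T m} (hy : dualFunctional L y ≠ ⊤) :
    ∃ α : (Fin n → ℝ) × ℝ → EuclideanSpace ℝ (Fin m), Measurable α ∧
      ∀ᵐ p ∂(volume.restrict (spaceTime lo hi T)), 0 ≤ y.fst p ∧ y.snd p = y.fst p • α p := by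
  refine ⟨fun p => (y.fst p)⁻¹ • y.snd p, (Lp.stronglyMeasurable y.fst).measurable.inv.smul
    (Lp.stronglyMeasurable y.snd).measurable, ?_⟩
  have h1 : ∫⁻ p in spaceTime lo hi T, perspective (L p.1 (T - p.2)) (y.fst p) (y.snd p) ≠ ⊤ :=
    fun h => hy (by rw [dualFunctional, h]; rfl)
  filter_upwards [ae_lt_top (measurable_perspective_coe hLmeas y) h1] with p hp
  exact eq_smul_of_perspective_ne_top hp.ne

/-- The change of variable `m = ρ α`: the two objectives agree integrand by integrand. -/
theorem saddleObjective_eq_controlObjective {A : (Fin n → ℝ) → ℝ → Matrix (Fin n) (Fin m) ℝ}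
    {b : (Fin n → ℝ) → ℝ → (Fin n → ℝ)} {g : (Fin n → ℝ) → ℝ} {c : ℝ} (φ : H1 lo hi T)
    (y : DualSpace lo hi T m) (α : (Fin n → ℝ) × ℝ → EuclideanSpace ℝ (Fin m))
    (h : ∀ᵐ p ∂(volume.restrict (spaceTime lo hi T)), 0 ≤ y.fst p ∧ y.snd p = y.fst p • α p) :
    saddleObjective A b L g c φ y = controlObjective A b L g c φ y.fst α := by
  have h1 : coupling A b φ y = ∫ p in spaceTime lo hi T, y.fst p * (H1.dt φ p
      - (A p.1 (T - p.2) *ᵥ (α p).ofLp + b p.1 (T - p.2)) ⬝ᵥ (H1.grad φ p).ofLp) := by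
    refine integral_congr_ae ?_
    filter_upwards [h] with p hp
    rw [couplingDensity, hp.2, WithLp.ofLp_smul, Matrix.mulVec_smul, smul_dotProduct, add_dotProduct,
      smul_eq_mul]
    ring
  have h2 : ∫⁻ p in spaceTime lo hi T, perspective (L p.1 (T - p.2)) (y.fst p) (y.snd p)
      = ∫⁻ p in spaceTime lo hi T, ENNReal.ofReal (y.fst p) * L p.1 (T - p.2) (α p) := by
    refine lintegral_congr_ae ?_
    filter_upwards [h] with p hp
    rw [hp.2, perspective_smul hp.1]
  rw [saddleObjective, controlObjective, dualFunctional, h1, h2]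

end Dual

/-! ### The coupling `K` -/

section Coupling

theorem integral_norm_mul_norm_le {S E F : Type*} [MeasurableSpace S] {μ : Measure S}
    [NormedAddCommGroup E] [NormedAddCommGroup F] (f : Lp E 2 μ) (g : Lp F 2 μ) :
    Integrable (fun p => ‖f p‖ * ‖g p‖) μ ∧ ∫ p, ‖f p‖ * ‖g p‖ ∂μ ≤ ‖f‖ * ‖g‖ := by
  have hf := (Lp.memLp f).norm
  have hg := (Lp.memLp g).norm
  refine ⟨hf.integrable_mul hg, ?_⟩
  have h1 : ∫ p, ‖f p‖ * ‖g p‖ ∂μ = inner ℝ (hf.toLp _) (hg.toLp _) := by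
    rw [L2.inner_def]
    refine integral_congr_ae ?_
    filter_upwards [hf.coeFn_toLp, hg.coeFn_toLp] with p h1 h2
    rw [h1, h2, real_inner_eq_re_inner ℝ]; simp [mul_comm]
  rw [h1]
  refine (real_inner_le_norm _ _).trans (le_of_eq ?_)
  rw [Lp.norm_toLp, Lp.norm_toLp, eLpNorm_norm, eLpNorm_norm, Lp.norm_def, Lp.norm_def]

theorem sum_abs_le_sqrt_mul_norm {n : ℕ} (w : EuclideanSpace ℝ (Fin n)) :
    ∑ i, |w i| ≤ √n * ‖w‖ := by
  rw [EuclideanSpace.norm_eq, ← Real.sqrt_mul (Nat.cast_nonneg n)]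
  refine Real.le_sqrt_of_sq_le ?_
  have := sq_sum_le_card_mul_sum_sq (s := Finset.univ) (f := fun i => |w i|)
  simpa using this

theorem abs_dotProduct_le {n : ℕ} {v : Fin n → ℝ} {C : ℝ} (hC : 0 ≤ C) (hv : ∀ i, |v i| ≤ C)
    (w : EuclideanSpace ℝ (Fin n)) : |v ⬝ᵥ w.ofLp| ≤ C * (√n * ‖w‖) := by
  refine (Finset.abs_sum_le_sum_abs _ _).trans ?_
  refine le_trans ?_ (mul_le_mul_of_nonneg_left (sum_abs_le_sqrt_mul_norm w) hC)
  rw [Finset.mul_sum]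
  refine Finset.sum_le_sum fun i _ => ?_
  rw [abs_mul]
  exact mul_le_mul_of_nonneg_right (hv i) (abs_nonneg _)

variable {n m : ℕ} {lo hi : Fin n → ℝ} {T : ℝ}
  {A : (Fin n → ℝ) → ℝ → Matrix (Fin n) (Fin m) ℝ} {b : (Fin n → ℝ) → ℝ → (Fin n → ℝ)}

theorem continuousOn_reverse {F : Type*} [TopologicalSpace F] {f : (Fin n → ℝ) × ℝ → F}
    (hf : ContinuousOn f (spaceTime lo hi T)) :
    ContinuousOn (fun p : (Fin n → ℝ) × ℝ => f (p.1, T - p.2)) (spaceTime lo hi T) :=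
  hf.comp (f := fun p : (Fin n → ℝ) × ℝ => (p.1, T - p.2)) (by fun_prop)
    fun _ hp => reverse_mem_spaceTime hp

theorem supDrift_nonneg : 0 ≤ supDrift lo hi T b :=
  Real.sSup_nonneg (by rintro _ ⟨p, -, rfl⟩; exact norm_nonneg _)

theorem supEntry_nonneg : 0 ≤ supEntry lo hi T A :=
  Real.sSup_nonneg (by rintro _ ⟨p, -, i, j, rfl⟩; exact abs_nonneg _)

theorem abs_le_supDrift
    (hb : ContinuousOn (fun p : (Fin n → ℝ) × ℝ => b p.1 p.2) (spaceTime lo hi T))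
    {p : (Fin n → ℝ) × ℝ} (hp : p ∈ spaceTime lo hi T) (i : Fin n) :
    |b p.1 p.2 i| ≤ supDrift lo hi T b := by
  obtain ⟨C, hC⟩ := (spaceTime_isCompact lo hi T).exists_bound_of_continuousOn hb
  refine (norm_le_pi_norm (b p.1 p.2) i).trans (le_csSup ⟨C, ?_⟩ ⟨p, hp, rfl⟩)
  rintro _ ⟨q, hq, rfl⟩
  exact hC q hq

theorem abs_le_supEntry
    (hA : ContinuousOn (fun p : (Fin n → ℝ) × ℝ => A p.1 p.2) (spaceTime lo hi T))
    {p : (Fin n → ℝ) × ℝ} (hp : p ∈ spaceTime lo hi T) (i : Fin n) (j : Fin m) :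
    |A p.1 p.2 i j| ≤ supEntry lo hi T A := by
  have hA' : ContinuousOn (fun p : (Fin n → ℝ) × ℝ => fun i j => A p.1 p.2 i j)
      (spaceTime lo hi T) :=
    continuousOn_pi.2 fun i => continuousOn_pi.2 fun j =>
      (continuous_id.matrix_elem i j).comp_continuousOn hA
  obtain ⟨C, hC⟩ := (spaceTime_isCompact lo hi T).exists_bound_of_continuousOn hA'
  refine le_csSup ⟨C, ?_⟩ ⟨p, hp, i, j, rfl⟩
  rintro _ ⟨q, hq, i, j, rfl⟩
  exact ((norm_le_pi_norm (fun j => A q.1 q.2 i j) j).trans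
    (norm_le_pi_norm (fun i j => A q.1 q.2 i j) i)).trans (hC q hq)

theorem aestronglyMeasurable_couplingDensity
    (hA : ContinuousOn (fun p : (Fin n → ℝ) × ℝ => A p.1 p.2) (spaceTime lo hi T))
    (hb : ContinuousOn (fun p : (Fin n → ℝ) × ℝ => b p.1 p.2) (spaceTime lo hi T))
    (φ : H1 lo hi T) (y : DualSpace lo hi T m) :
    AEStronglyMeasurable (couplingDensity A b φ y) (volume.restrict (spaceTime lo hi T)) := by
  have hm := measurableSet_spaceTime lo hi T
  have hA' : ∀ i j, AEStronglyMeasurable (fun p : (Fin n → ℝ) × ℝ => A p.1 (T - p.2) i j)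
      (volume.restrict (spaceTime lo hi T)) := fun i j =>
    (continuousOn_reverse ((continuous_id.matrix_elem i j).comp_continuousOn hA)).aestronglyMeasurable
      hm
  have hb' : ∀ i, AEStronglyMeasurable (fun p : (Fin n → ℝ) × ℝ => b p.1 (T - p.2) i)
      (volume.restrict (spaceTime lo hi T)) := fun i =>
    (continuousOn_reverse (continuousOn_pi.1 hb i)).aestronglyMeasurable hm
  have h1 := Lp.aestronglyMeasurable y.fst
  have h2 := Lp.aestronglyMeasurable (H1.dt φ)
  have h3 : ∀ i, AEStronglyMeasurable (fun p => (H1.grad φ p) i)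
      (volume.restrict (spaceTime lo hi T)) := fun i => (memLp_coord _ i).1
  have h4 : ∀ j, AEStronglyMeasurable (fun p => (y.snd p) j)
      (volume.restrict (spaceTime lo hi T)) := fun j =>
    ((EuclideanSpace.proj (𝕜 := ℝ) j).comp_memLp' (Lp.memLp y.snd)).1
  refine ((h1.mul h2).sub ?_).sub (h1.mul ?_)
  · refine Finset.aestronglyMeasurable_fun_sum _ fun i _ => AEStronglyMeasurable.mul ?_ (h3 i)
    change AEStronglyMeasurable (fun p => ∑ j, A p.1 (T - p.2) i j * (y.snd p) j) _
    exact Finset.aestronglyMeasurable_fun_sum _ fun j _ => (hA' i j).mul (h4 j)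
  · exact Finset.aestronglyMeasurable_fun_sum _ fun i _ => (hb' i).mul (h3 i)

theorem abs_couplingDensity_le
    (hA : ContinuousOn (fun p : (Fin n → ℝ) × ℝ => A p.1 p.2) (spaceTime lo hi T))
    (hb : ContinuousOn (fun p : (Fin n → ℝ) × ℝ => b p.1 p.2) (spaceTime lo hi T))
    (φ : H1 lo hi T) (y : DualSpace lo hi T m) {p : (Fin n → ℝ) × ℝ}
    (hp : p ∈ spaceTime lo hi T) :
    |couplingDensity A b φ y p| ≤ ‖y.fst p‖ * ‖H1.dt φ p‖
      + √(n * m) * supEntry lo hi T A * (‖y.snd p‖ * ‖H1.grad φ p‖)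
      + √n * supDrift lo hi T b * (‖y.fst p‖ * ‖H1.grad φ p‖) := by
  have hp' := reverse_mem_spaceTime hp
  have h1 : |(A p.1 (T - p.2) *ᵥ (y.snd p).ofLp) ⬝ᵥ (H1.grad φ p).ofLp|
      ≤ √(n * m) * supEntry lo hi T A * (‖y.snd p‖ * ‖H1.grad φ p‖) := by
    have h := abs_dotProduct_le (v := A p.1 (T - p.2) *ᵥ (y.snd p).ofLp)
      (C := supEntry lo hi T A * (√m * ‖y.snd p‖))
      (mul_nonneg supEntry_nonneg (by positivity))
      (fun i => abs_dotProduct_le supEntry_nonneg (fun j => abs_le_supEntry hA hp' i j) _)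
      (H1.grad φ p)
    refine h.trans (le_of_eq ?_)
    rw [Real.sqrt_mul (Nat.cast_nonneg n)]
    ring
  have h2 : |y.fst p * (b p.1 (T - p.2) ⬝ᵥ (H1.grad φ p).ofLp)|
      ≤ √n * supDrift lo hi T b * (‖y.fst p‖ * ‖H1.grad φ p‖) := by
    rw [abs_mul]
    have h := abs_dotProduct_le supDrift_nonneg (fun i => abs_le_supDrift hb hp' i) (H1.grad φ p)
    refine (mul_le_mul_of_nonneg_left h (abs_nonneg _)).trans (le_of_eq ?_)
    rw [Real.norm_eq_abs]
    ring
  have h3 : |y.fst p * H1.dt φ p| = ‖y.fst p‖ * ‖H1.dt φ p‖ := abs_mul _ _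
  rw [couplingDensity]
  refine (abs_sub _ _).trans (add_le_add ((abs_sub _ _).trans (add_le_add h3.le h1)) h2)

theorem integrable_couplingDensity
    (hA : ContinuousOn (fun p : (Fin n → ℝ) × ℝ => A p.1 p.2) (spaceTime lo hi T))
    (hb : ContinuousOn (fun p : (Fin n → ℝ) × ℝ => b p.1 p.2) (spaceTime lo hi T))
    (φ : H1 lo hi T) (y : DualSpace lo hi T m) :
    IntegrableOn (couplingDensity A b φ y) (spaceTime lo hi T) := by
  refine Integrable.mono' ((((integral_norm_mul_norm_le y.fst (H1.dt φ)).1).add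
    ((integral_norm_mul_norm_le y.snd (H1.grad φ)).1.const_mul
      (√(n * m) * supEntry lo hi T A))).add
    ((integral_norm_mul_norm_le y.fst (H1.grad φ)).1.const_mul (√n * supDrift lo hi T b)))
    (aestronglyMeasurable_couplingDensity hA hb φ y) ?_
  filter_upwards [ae_restrict_mem (measurableSet_spaceTime lo hi T)] with p hp
  exact abs_couplingDensity_le hA hb φ y hp

theorem H1.norm_sq (φ : H1 lo hi T) :
    ‖φ‖ ^ 2 = ‖H1.val φ‖ ^ 2 + (‖H1.dt φ‖ ^ 2 + ‖H1.grad φ‖ ^ 2) := by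
  have h1 := WithLp.prod_norm_sq_eq_of_L2 φ.1
  rw [WithLp.prod_norm_sq_eq_of_L2 φ.1.snd] at h1
  exact h1

theorem abs_coupling_le
    (hA : ContinuousOn (fun p : (Fin n → ℝ) × ℝ => A p.1 p.2) (spaceTime lo hi T))
    (hb : ContinuousOn (fun p : (Fin n → ℝ) × ℝ => b p.1 p.2) (spaceTime lo hi T))
    (φ : H1 lo hi T) (y : DualSpace lo hi T m) :
    |coupling A b φ y| ≤ √(n + 1) * max 1 (supDrift lo hi T b) * ‖y.fst‖ * ‖φ‖
      + √(n * m) * supEntry lo hi T A * ‖y.snd‖ * ‖φ‖ := by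
  obtain ⟨i1, e1⟩ := integral_norm_mul_norm_le y.fst (H1.dt φ)
  obtain ⟨i2, e2⟩ := integral_norm_mul_norm_le y.snd (H1.grad φ)
  obtain ⟨i3, e3⟩ := integral_norm_mul_norm_le y.fst (H1.grad φ)
  have hβ : 0 ≤ supDrift lo hi T b := supDrift_nonneg
  have ha : 0 ≤ supEntry lo hi T A := supEntry_nonneg
  have hi2 := i2.const_mul (√(n * m) * supEntry lo hi T A)
  have hi3 := i3.const_mul (√n * supDrift lo hi T b)
  have hi12 : Integrable (fun p => ‖y.fst p‖ * ‖H1.dt φ p‖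
      + √(n * m) * supEntry lo hi T A * (‖y.snd p‖ * ‖H1.grad φ p‖))
      (volume.restrict (spaceTime lo hi T)) := i1.add hi2
  have h1 : |coupling A b φ y| ≤ ‖y.fst‖ * ‖H1.dt φ‖
      + √(n * m) * supEntry lo hi T A * (‖y.snd‖ * ‖H1.grad φ‖)
      + √n * supDrift lo hi T b * (‖y.fst‖ * ‖H1.grad φ‖) := by
    have h2 : |coupling A b φ y| ≤ ∫ p in spaceTime lo hi T, (‖y.fst p‖ * ‖H1.dt φ p‖
        + √(n * m) * supEntry lo hi T A * (‖y.snd p‖ * ‖H1.grad φ p‖)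
        + √n * supDrift lo hi T b * (‖y.fst p‖ * ‖H1.grad φ p‖)) := by
      rw [coupling, ← Real.norm_eq_abs]
      refine norm_integral_le_of_norm_le (hi12.add hi3) ?_
      filter_upwards [ae_restrict_mem (measurableSet_spaceTime lo hi T)] with p hp
      exact abs_couplingDensity_le hA hb φ y hp
    rw [integral_add hi12 hi3, integral_add i1 hi2,
      integral_const_mul, integral_const_mul] at h2
    refine h2.trans ?_
    gcongr
  have hs := H1.norm_sq φ
  have hgrad : ‖H1.grad φ‖ ≤ ‖φ‖ := by
    refine abs_le_of_sq_le_sq' ?_ (norm_nonneg _) |>.2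
    nlinarith [sq_nonneg ‖H1.val φ‖, sq_nonneg ‖H1.dt φ‖]
  have hdt : ‖H1.dt φ‖ + √n * ‖H1.grad φ‖ ≤ √(n + 1) * ‖φ‖ := by
    refine abs_le_of_sq_le_sq' ?_ (by positivity) |>.2
    have hn := Real.sq_sqrt (Nat.cast_nonneg (α := ℝ) n)
    have hn1 := Real.sq_sqrt (by positivity : (0 : ℝ) ≤ n + 1)
    rw [mul_pow, hn1, hs]
    have h3 : 0 ≤ ((n : ℝ) + 1) * ‖H1.val φ‖ ^ 2 := by positivity
    have h4 := sq_nonneg (√n * ‖H1.dt φ‖ - ‖H1.grad φ‖)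
    rw [sub_sq, mul_pow, hn] at h4
    rw [add_sq, mul_pow, hn]
    linarith
  have hmax1 : (1 : ℝ) ≤ max 1 (supDrift lo hi T b) := le_max_left _ _
  calc |coupling A b φ y| ≤ _ := h1
    _ ≤ ‖y.fst‖ * (max 1 (supDrift lo hi T b) * (‖H1.dt φ‖ + √n * ‖H1.grad φ‖))
        + √(n * m) * supEntry lo hi T A * (‖y.snd‖ * ‖H1.grad φ‖) := by
      have h5 : ‖y.fst‖ * ‖H1.dt φ‖ ≤ max 1 (supDrift lo hi T b) * (‖y.fst‖ * ‖H1.dt φ‖) :=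
        le_mul_of_one_le_left (by positivity) hmax1
      have h6 : √n * supDrift lo hi T b * (‖y.fst‖ * ‖H1.grad φ‖)
          ≤ √n * max 1 (supDrift lo hi T b) * (‖y.fst‖ * ‖H1.grad φ‖) := by
        gcongr
        exact le_max_right _ _
      linarith
    _ ≤ ‖y.fst‖ * (max 1 (supDrift lo hi T b) * (√(n + 1) * ‖φ‖))
        + √(n * m) * supEntry lo hi T A * (‖y.snd‖ * ‖φ‖) := by gcongr
    _ = _ := by ring

theorem exists_couplingCLM
    (hA : ContinuousOn (fun p : (Fin n → ℝ) × ℝ => A p.1 p.2) (spaceTime lo hi T))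
    (hb : ContinuousOn (fun p : (Fin n → ℝ) × ℝ => b p.1 p.2) (spaceTime lo hi T)) :
    ∃ K : H1 lo hi T →L[ℝ] DualSpace lo hi T m →L[ℝ] ℝ, (∀ φ y, K φ y = coupling A b φ y) ∧
      ‖K‖ ≤ (n + 1) * max 1 (supDrift lo hi T b) ^ 2 + n * m * supEntry lo hi T A ^ 2 := by
  have hI := integrable_couplingDensity (m := m) hA hb
  have hadd₁ : ∀ (φ ψ : H1 lo hi T) (y : DualSpace lo hi T m),
      coupling A b (φ + ψ) y = coupling A b φ y + coupling A b ψ y := by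
    intro φ ψ y
    rw [coupling, coupling, coupling, ← integral_add (hI φ y) (hI ψ y)]
    refine integral_congr_ae ?_
    filter_upwards [Lp.coeFn_add (H1.dt φ) (H1.dt ψ), Lp.coeFn_add (H1.grad φ) (H1.grad ψ)]
      with p h1 h2
    have e1 : H1.dt (φ + ψ) = H1.dt φ + H1.dt ψ := rfl
    have e2 : H1.grad (φ + ψ) = H1.grad φ + H1.grad ψ := rfl
    simp only [couplingDensity, e1, e2, h1, h2, Pi.add_apply, WithLp.ofLp_add, dotProduct_add]
    ring
  have hsmul₁ : ∀ (c : ℝ) (φ : H1 lo hi T) (y : DualSpace lo hi T m),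
      coupling A b (c • φ) y = c • coupling A b φ y := by
    intro c φ y
    rw [coupling, coupling, ← integral_smul]
    refine integral_congr_ae ?_
    filter_upwards [Lp.coeFn_smul c (H1.dt φ), Lp.coeFn_smul c (H1.grad φ)] with p h1 h2
    have e1 : H1.dt (c • φ) = c • H1.dt φ := rfl
    have e2 : H1.grad (c • φ) = c • H1.grad φ := rfl
    simp only [couplingDensity, e1, e2, h1, h2, Pi.smul_apply, WithLp.ofLp_smul, dotProduct_smul,
      smul_eq_mul]
    ring
  have hadd₂ : ∀ (φ : H1 lo hi T) (y z : DualSpace lo hi T m),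
      coupling A b φ (y + z) = coupling A b φ y + coupling A b φ z := by
    intro φ y z
    rw [coupling, coupling, coupling, ← integral_add (hI φ y) (hI φ z)]
    refine integral_congr_ae ?_
    filter_upwards [Lp.coeFn_add y.fst z.fst, Lp.coeFn_add y.snd z.snd] with p h1 h2
    simp only [couplingDensity, WithLp.add_fst, WithLp.add_snd, h1, h2, Pi.add_apply,
      WithLp.ofLp_add, Matrix.mulVec_add, add_dotProduct]
    ring
  have hsmul₂ : ∀ (c : ℝ) (φ : H1 lo hi T) (y : DualSpace lo hi T m),
      coupling A b φ (c • y) = c • coupling A b φ y := by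
    intro c φ y
    rw [coupling, coupling, ← integral_smul]
    refine integral_congr_ae ?_
    filter_upwards [Lp.coeFn_smul c y.fst, Lp.coeFn_smul c y.snd] with p h1 h2
    simp only [couplingDensity, WithLp.smul_fst, WithLp.smul_snd, h1, h2, Pi.smul_apply,
      WithLp.ofLp_smul, Matrix.mulVec_smul, smul_dotProduct, smul_eq_mul]
    ring
  set P : ℝ := √(n + 1) * max 1 (supDrift lo hi T b) with hP
  set Q : ℝ := √(n * m) * supEntry lo hi T A with hQ
  have ha : 0 ≤ supEntry lo hi T A := supEntry_nonneg
  have hmax1 : (1 : ℝ) ≤ max 1 (supDrift lo hi T b) := le_max_left _ _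
  have hP0 : 0 ≤ P := by positivity
  have hQ0 : 0 ≤ Q := by positivity
  have hPsq : P ^ 2 = (n + 1) * max 1 (supDrift lo hi T b) ^ 2 := by
    rw [hP, mul_pow, Real.sq_sqrt (by positivity)]
  have hQsq : Q ^ 2 = n * m * supEntry lo hi T A ^ 2 := by
    rw [hQ, mul_pow, Real.sq_sqrt (by positivity)]
  have hP1 : 1 ≤ P ^ 2 := by
    rw [hPsq]
    have : (1 : ℝ) ≤ max 1 (supDrift lo hi T b) ^ 2 := one_le_pow₀ hmax1
    nlinarith [Nat.cast_nonneg (α := ℝ) n]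
  have hbound : ∀ (φ : H1 lo hi T) (y : DualSpace lo hi T m),
      ‖coupling A b φ y‖ ≤ (P ^ 2 + Q ^ 2) * ‖φ‖ * ‖y‖ := by
    intro φ y
    have h1 : P * ‖y.fst‖ + Q * ‖y.snd‖ ≤ (P ^ 2 + Q ^ 2) * ‖y‖ := by
      refine abs_le_of_sq_le_sq' ?_ (by positivity) |>.2
      have hcs : (P * ‖y.fst‖ + Q * ‖y.snd‖) ^ 2 ≤ (P ^ 2 + Q ^ 2) * ‖y‖ ^ 2 := by
        rw [WithLp.prod_norm_sq_eq_of_L2]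
        nlinarith [sq_nonneg (P * ‖y.snd‖ - Q * ‖y.fst‖)]
      refine hcs.trans ?_
      rw [mul_pow (P ^ 2 + Q ^ 2)]
      refine mul_le_mul_of_nonneg_right ?_ (sq_nonneg ‖y‖)
      exact le_self_pow₀ (by linarith [sq_nonneg Q]) two_ne_zero
    calc ‖coupling A b φ y‖ ≤ P * ‖y.fst‖ * ‖φ‖ + Q * ‖y.snd‖ * ‖φ‖ := abs_coupling_le hA hb φ y
      _ = (P * ‖y.fst‖ + Q * ‖y.snd‖) * ‖φ‖ := by ring
      _ ≤ (P ^ 2 + Q ^ 2) * ‖y‖ * ‖φ‖ := by gcongr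
      _ = _ := by ring
  refine ⟨(LinearMap.mk₂ ℝ (coupling A b) hadd₁ hsmul₁ hadd₂ hsmul₂).mkContinuous₂ (P ^ 2 + Q ^ 2)
    hbound, fun φ y => rfl, ?_⟩
  rw [← hPsq, ← hQsq]
  exact LinearMap.mkContinuous₂_norm_le _ (by positivity) _

end Coupling

/-! ### Completeness of `H¹` -/

section Pairing

theorem memLp_two_of_continuous {S : Type*} [TopologicalSpace S] [MeasureSpace S]
    [OpensMeasurableSpace S] [SecondCountableTopology S]
    [IsFiniteMeasureOnCompacts (volume : Measure S)] {k : Set S} (hk : IsCompact k)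
    (hm : MeasurableSet k) {η : S → ℝ} (hη : Continuous η) :
    MemLp η 2 (volume.restrict k) := by
  have : IsFiniteMeasure ((volume : Measure S).restrict k) :=
    ⟨by rw [Measure.restrict_apply_univ]; exact hk.measure_lt_top⟩
  obtain ⟨C, hC⟩ := hk.exists_bound_of_continuousOn hη.continuousOn
  exact MemLp.of_bound hη.aestronglyMeasurable C
    ((ae_restrict_iff' hm).2 (Eventually.of_forall hC))

theorem integral_mul_eq_inner {S : Type*} [MeasurableSpace S] {μ : Measure S} (u : Lp ℝ 2 μ)
    {η : S → ℝ} (hη : MemLp η 2 μ) : ∫ p, u p * η p ∂μ = inner ℝ (hη.toLp η) u := by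
  rw [L2.inner_def]
  refine integral_congr_ae ?_
  filter_upwards [hη.coeFn_toLp] with p h
  rw [h]; rfl

variable {n : ℕ} {lo hi : Fin n → ℝ} {T : ℝ}

theorem continuous_integral_mul {η : (Fin n → ℝ) × ℝ → ℝ} (hη : Continuous η) :
    Continuous fun u : L2Cyl lo hi T ℝ => ∫ p in spaceTime lo hi T, u p * η p := by
  have h := memLp_two_of_continuous (spaceTime_isCompact lo hi T)
    (measurableSet_spaceTime lo hi T) hη
  simp only [integral_mul_eq_inner _ h]
  fun_prop

theorem continuous_integral_coord_mul {η : (Fin n → ℝ) × ℝ → ℝ} (hη : Continuous η) (i : Fin n) :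
    Continuous fun u : L2Cyl lo hi T (EuclideanSpace ℝ (Fin n)) =>
      ∫ p in spaceTime lo hi T, (u p) i * η p := by
  have h1 : ∀ u : L2Cyl lo hi T (EuclideanSpace ℝ (Fin n)),
      ∫ p in spaceTime lo hi T, (u p) i * η p = ∫ p in spaceTime lo hi T,
        ((EuclideanSpace.proj (𝕜 := ℝ) i).compLpL 2 (volume.restrict (spaceTime lo hi T)) u) p
          * η p := by
    intro u
    refine integral_congr_ae ?_
    filter_upwards [(EuclideanSpace.proj (𝕜 := ℝ) i).coeFn_compLpL u] with p h
    rw [h]; rfl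
  simp only [h1]
  exact (continuous_integral_mul hη).comp (ContinuousLinearMap.continuous _)

theorem isClosed_H1 (lo hi : Fin n → ℝ) (T : ℝ) : IsClosed (H1 lo hi T : Set (Jet lo hi T)) := by
  have h1 : Continuous fun u : Jet lo hi T => u.fst := (WithLp.prod_continuous_ofLp 2 _ _).fst
  have h2 : Continuous fun u : Jet lo hi T => u.snd := (WithLp.prod_continuous_ofLp 2 _ _).snd
  have h3 : Continuous fun u : Jet lo hi T => u.snd.fst :=
    (WithLp.prod_continuous_ofLp 2 _ _).fst.comp h2
  have h4 : Continuous fun u : Jet lo hi T => u.snd.snd :=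
    (WithLp.prod_continuous_ofLp 2 _ _).snd.comp h2
  have : (H1 lo hi T : Set (Jet lo hi T)) = ⋂ (η) (_ : PeriodicTest lo hi T η),
      {u : Jet lo hi T | ∫ p in spaceTime lo hi T, u.fst p * timeDeriv η p
        = -∫ p in spaceTime lo hi T, u.snd.fst p * η p} ∩
      ⋂ i, {u : Jet lo hi T | ∫ p in spaceTime lo hi T, u.fst p * spaceDeriv i η p
        = -∫ p in spaceTime lo hi T, (u.snd.snd p) i * η p} := by
    ext u
    simp only [mem_iInter, mem_inter_iff, mem_ofPred_eq]
    rfl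
  rw [this]
  refine isClosed_iInter fun η => isClosed_iInter fun hη => IsClosed.inter ?_ ?_
  · exact isClosed_eq ((continuous_integral_mul hη.1.continuous_timeDeriv).comp h1)
      ((continuous_integral_mul hη.1.1.continuous).comp h3).neg
  · exact isClosed_iInter fun i =>
      isClosed_eq ((continuous_integral_mul (hη.1.continuous_spaceDeriv i)).comp h1)
        ((continuous_integral_coord_mul hη.1.1.continuous i).comp h4).neg

instance : CompleteSpace (H1 lo hi T) := (isClosed_H1 lo hi T).completeSpace_coe

end Pairing

/-! ### Existence of the time traces -/

section TraceExistence

variable {n : ℕ} {lo hi : Fin n → ℝ} {T : ℝ}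

theorem restrict_spaceTime (lo hi : Fin n → ℝ) (T : ℝ) :
    (volume : Measure ((Fin n → ℝ) × ℝ)).restrict (spaceTime lo hi T)
      = ((volume : Measure (Fin n → ℝ)).restrict (Icc lo hi)).prod
        ((volume : Measure ℝ).restrict (Icc 0 T)) := by
  rw [spaceTime, Measure.volume_eq_prod, Measure.prod_restrict]

/-- Integrating an `L²` function of `(x, t)` against functions of `x` only is integrating its time
average, an element of `L²(Ω)`. -/
theorem exists_timeIntegral {w : (Fin n → ℝ) × ℝ → ℝ}
    (hw : MemLp w 2 (volume.restrict (spaceTime lo hi T))) :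
    ∃ u : L2Space lo hi, ∀ ζ : (Fin n → ℝ) → ℝ, Continuous ζ →
      ∫ x in Icc lo hi, u x * ζ x = ∫ p in spaceTime lo hi T, w p * ζ p.1 := by
  set μ := (volume : Measure (Fin n → ℝ)).restrict (Icc lo hi) with hμ
  set ν := (volume : Measure ((Fin n → ℝ) × ℝ)).restrict (spaceTime lo hi T) with hν
  have hmap : Measure.map Prod.fst ν = (volume.restrict (Icc (0 : ℝ) T)) univ • μ := by
    rw [hν, restrict_spaceTime, Measure.map_fst_prod]
  set c := (volume.restrict (Icc (0 : ℝ) T)) univ with hc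
  have hctop : c ≠ ⊤ := by
    rw [hc, Measure.restrict_apply_univ]; exact isCompact_Icc.measure_lt_top.ne
  have hq : Measure.QuasiMeasurePreserving (Prod.fst : (Fin n → ℝ) × ℝ → _) ν μ :=
    ⟨measurable_fst, by rw [hmap]; exact Measure.smul_absolutelyContinuous⟩
  have hnorm : ∀ ξ : L2Space lo hi, eLpNorm (ξ ∘ Prod.fst) 2 ν
      = c ^ (1 / (2 : ℝ≥0∞)).toReal * eLpNorm ξ 2 μ := by
    intro ξ
    have h1 : AEStronglyMeasurable ξ (Measure.map Prod.fst ν) := by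
      rw [hmap]; exact (Lp.aestronglyMeasurable ξ).smul_measure c
    rw [← eLpNorm_map_measure h1 measurable_fst.aemeasurable, hmap,
      eLpNorm_smul_measure_of_ne_top (by simp), smul_eq_mul]
  have hmem : ∀ ξ : L2Space lo hi, MemLp (ξ ∘ Prod.fst) 2 ν := fun ξ =>
    ⟨(Lp.aestronglyMeasurable ξ).comp_quasiMeasurePreserving hq, by
      rw [hnorm]
      exact ENNReal.mul_lt_top (ENNReal.rpow_lt_top_of_nonneg (by positivity) hctop)
        (Lp.eLpNorm_lt_top ξ)⟩
  -- the embedding of `L²(Ω)` into `L²(Ω × [0, T])`, whose adjoint is the time integral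
  let J : L2Space lo hi →L[ℝ] L2Cyl lo hi T ℝ := LinearMap.mkContinuous
    { toFun := fun ξ => (hmem ξ).toLp _
      map_add' := fun ξ ζ => by
        rw [← MemLp.toLp_add]
        exact MemLp.toLp_congr _ _ (hq.ae_eq_comp (Lp.coeFn_add ξ ζ))
      map_smul' := fun r ξ => by
        rw [RingHom.id_apply, ← MemLp.toLp_const_smul]
        exact MemLp.toLp_congr _ _ (hq.ae_eq_comp (Lp.coeFn_smul r ξ)) }
    (c ^ (1 / (2 : ℝ≥0∞)).toReal).toReal
    (fun ξ => by
      simp only [LinearMap.coe_mk, AddHom.coe_mk]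
      rw [Lp.norm_toLp, hnorm, ENNReal.toReal_mul, Lp.norm_def])
  refine ⟨ContinuousLinearMap.adjoint J (hw.toLp w), fun ζ hζ => ?_⟩
  have hζ2 : MemLp ζ 2 μ := memLp_two_of_continuous isCompact_Icc measurableSet_Icc hζ
  rw [integral_mul_eq_inner _ hζ2, ContinuousLinearMap.adjoint_inner_right, L2.inner_def]
  refine integral_congr_ae ?_
  have h1 : (J (hζ2.toLp ζ) : (Fin n → ℝ) × ℝ → ℝ) =ᵐ[ν] (hζ2.toLp ζ) ∘ Prod.fst :=
    (hmem _).coeFn_toLp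
  filter_upwards [h1, hw.coeFn_toLp, hq.ae_eq_comp hζ2.coeFn_toLp] with p e1 e2 e3
  rw [e1, e2, e3]; rfl

theorem hasDerivAt_timeDeriv {η : (Fin n → ℝ) × ℝ → ℝ} (hη : ContDiff ℝ ∞ η) (x : Fin n → ℝ)
    (t : ℝ) : HasDerivAt (fun s => η (x, s)) (timeDeriv η (x, t)) t :=
  ((hη.differentiable (by simp)) (x, t)).hasFDerivAt.comp_hasDerivAt t
    ((hasDerivAt_const t x).prodMk (hasDerivAt_id t))

theorem timeDeriv_eq_of_hasDerivAt {η : (Fin n → ℝ) × ℝ → ℝ} (hη : ContDiff ℝ ∞ η)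
    {p : (Fin n → ℝ) × ℝ} {d : ℝ} (h : HasDerivAt (fun s => η (p.1, s)) d p.2) :
    timeDeriv η p = d :=
  (hasDerivAt_timeDeriv hη p.1 p.2).unique h

theorem exists_bound_deriv_smoothTransition :
    ∃ D : ℝ, 0 ≤ D ∧ ∀ s, |deriv Real.smoothTransition s| ≤ D := by
  have hcont : Continuous (deriv Real.smoothTransition) :=
    (Real.smoothTransition.contDiff (n := 1)).continuous_deriv (by simp)
  obtain ⟨C, hC⟩ := isCompact_Icc.exists_bound_of_continuousOn (s := Icc (0 : ℝ) 1)
    hcont.continuousOn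
  refine ⟨max C 0, le_max_right _ _, fun s => ?_⟩
  by_cases hs : s ∈ Icc (0 : ℝ) 1
  · exact (hC s hs).trans (le_max_left _ _)
  · have : deriv Real.smoothTransition s = 0 := by
      rcases not_and_or.1 hs with h | h
      · have : Real.smoothTransition =ᶠ[𝓝 s] fun _ => 0 := by
          filter_upwards [gt_mem_nhds (not_le.1 h)] with r hr
          exact Real.smoothTransition.zero_of_nonpos hr.le
        rw [this.deriv_eq, deriv_const]
      · have : Real.smoothTransition =ᶠ[𝓝 s] fun _ => 1 := by
          filter_upwards [lt_mem_nhds (not_le.1 h)] with r hr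
          exact Real.smoothTransition.one_of_one_le hr.le
        rw [this.deriv_eq, deriv_const]
    rw [this, abs_zero]; exact le_max_right _ _

theorem deriv_smoothTransition_of_one_lt {s : ℝ} (hs : 1 < s) :
    deriv Real.smoothTransition s = 0 := by
  have : Real.smoothTransition =ᶠ[𝓝 s] fun _ => 1 := by
    filter_upwards [lt_mem_nhds hs] with r hr
    exact Real.smoothTransition.one_of_one_le hr.le
  rw [this.deriv_eq, deriv_const]

/-- A smooth cutoff in time, `0` where `(k + 1) t (T - t) ≤ 1` and `1` where
`(k + 1) t (T - t) ≥ 2`. -/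
noncomputable def timeCutoff (T : ℝ) (k : ℕ) (t : ℝ) : ℝ :=
  Real.smoothTransition ((k + 1) * (t * (T - t)) - 1)

/-- The derivative of `timeCutoff`. -/
noncomputable def timeCutoffDeriv (T : ℝ) (k : ℕ) (t : ℝ) : ℝ :=
  deriv Real.smoothTransition ((k + 1) * (t * (T - t)) - 1) * ((k + 1) * (T - 2 * t))

theorem contDiff_timeCutoff (T : ℝ) (k : ℕ) : ContDiff ℝ ∞ (timeCutoff T k) :=
  Real.smoothTransition.contDiff.comp (by fun_prop)

theorem hasDerivAt_timeCutoff (T : ℝ) (k : ℕ) (t : ℝ) :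
    HasDerivAt (timeCutoff T k) (timeCutoffDeriv T k t) t := by
  have h1 : HasDerivAt (fun t : ℝ => ((k : ℝ) + 1) * (t * (T - t)) - 1)
      (((k : ℝ) + 1) * (T - 2 * t)) t := by
    have := ((((hasDerivAt_id t).mul ((hasDerivAt_const t T).sub (hasDerivAt_id t))).const_mul
      ((k : ℝ) + 1)).sub_const 1)
    refine this.congr_deriv ?_
    change ((k : ℝ) + 1) * (1 * (T - t) + t * (0 - 1)) = _
    ring
  exact (((Real.smoothTransition.contDiff (n := 1)).differentiable (by simp))
    _).hasDerivAt.comp t h1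

theorem timeCutoff_support (hT : 0 < T) (k : ℕ) : ∃ a b : ℝ, 0 < a ∧ b < T ∧
    ∀ t, t ∉ Icc a b → timeCutoff T k t = 0 := by
  have hk : (0 : ℝ) < k + 1 := by positivity
  have ha : 0 < 1 / (((k : ℝ) + 1) * T) := by positivity
  refine ⟨1 / ((k + 1) * T), T - 1 / ((k + 1) * T), ha, by linarith, fun t ht => ?_⟩
  refine Real.smoothTransition.zero_of_nonpos ?_
  rw [sub_nonpos]
  have key : ∀ s : ℝ, s < 1 / (((k : ℝ) + 1) * T) → (k + 1) * (s * (T - s)) ≤ 1 := by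
    intro s hs
    rw [lt_div_iff₀ (by positivity)] at hs
    nlinarith [mul_nonneg hk.le (sq_nonneg s)]
  rcases not_and_or.1 ht with h | h
  · exact key t (not_le.1 h)
  · have := key (T - t) (by linarith [not_le.1 h])
    rwa [sub_sub_cancel, mul_comm (T - t)] at this

theorem abs_timeCutoff_le (T : ℝ) (k : ℕ) (t : ℝ) : |timeCutoff T k t| ≤ 1 := by
  rw [timeCutoff, abs_of_nonneg (Real.smoothTransition.nonneg _)]
  exact Real.smoothTransition.le_one _

theorem exists_bound_timeCutoffDeriv (T : ℝ) : ∃ M : ℝ, 0 ≤ M ∧ ∀ (k : ℕ), ∀ t ∈ Icc 0 T,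
    |timeCutoffDeriv T k t| * (t * (T - t)) ≤ M := by
  obtain ⟨D, hD0, hD⟩ := exists_bound_deriv_smoothTransition
  refine ⟨D * (2 * |T|), by positivity, fun k t ht => ?_⟩
  have hT : 0 ≤ T := ht.1.trans ht.2
  have h0 : 0 ≤ t * (T - t) := mul_nonneg ht.1 (sub_nonneg.2 ht.2)
  by_cases hs : 1 < ((k : ℝ) + 1) * (t * (T - t)) - 1
  · rw [timeCutoffDeriv, deriv_smoothTransition_of_one_lt hs, zero_mul, abs_zero, zero_mul]
    positivity
  · rw [not_lt] at hs
    have h1 : |T - 2 * t| ≤ |T| := by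
      rw [abs_of_nonneg hT, abs_le]; constructor <;> linarith [ht.1, ht.2]
    rw [timeCutoffDeriv, abs_mul, abs_mul, abs_of_nonneg (by positivity : (0 : ℝ) ≤ k + 1)]
    calc |deriv Real.smoothTransition ((k + 1) * (t * (T - t)) - 1)| * ((k + 1) * |T - 2 * t|)
          * (t * (T - t))
        = |deriv Real.smoothTransition ((k + 1) * (t * (T - t)) - 1)|
          * ((((k : ℝ) + 1) * (t * (T - t))) * |T - 2 * t|) := by ring
      _ ≤ D * (2 * |T|) := by
        gcongr
        · exact hD _
        · linarith

theorem eventually_timeCutoff {t : ℝ} (ht : t ∈ Ioo 0 T) :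
    ∀ᶠ k in atTop, timeCutoff T k t = 1 ∧ timeCutoffDeriv T k t = 0 := by
  have h0 : 0 < t * (T - t) := mul_pos ht.1 (sub_pos.2 ht.2)
  obtain ⟨N, hN⟩ := exists_nat_gt (2 / (t * (T - t)))
  filter_upwards [eventually_ge_atTop N] with k hk
  have h1 : (1 : ℝ) < ((k : ℝ) + 1) * (t * (T - t)) - 1 := by
    rw [div_lt_iff₀ h0] at hN
    have : (N : ℝ) ≤ k := by exact_mod_cast hk
    nlinarith
  exact ⟨Real.smoothTransition.one_of_one_le h1.le, by
    rw [timeCutoffDeriv, deriv_smoothTransition_of_one_lt h1, zero_mul]⟩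

/-- A smooth function vanishing at `t = 0` and `t = T` vanishes there to first order. -/
theorem exists_abs_le_of_vanishing (hT : 0 < T) {θ : (Fin n → ℝ) × ℝ → ℝ}
    (hθ : PeriodicSmooth lo hi θ) (h0 : ∀ x, θ (x, 0) = 0) (h1 : ∀ x, θ (x, T) = 0) :
    ∃ C : ℝ, 0 ≤ C ∧ ∀ p ∈ spaceTime lo hi T, |θ p| ≤ C * (p.2 * (T - p.2)) := by
  obtain ⟨C, hC⟩ := (spaceTime_isCompact lo hi T).exists_bound_of_continuousOn
    hθ.continuous_timeDeriv.continuousOn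
  refine ⟨2 * max C 0 / T, by positivity, ?_⟩
  rintro ⟨x, t⟩ ⟨hx, ht⟩
  have hmvt : ∀ s ∈ Icc 0 T, |θ (x, t) - θ (x, s)| ≤ max C 0 * |t - s| := fun s hs =>
    (convex_Icc 0 T).norm_image_sub_le_of_norm_hasDerivWithin_le
      (fun r _ => (hasDerivAt_timeDeriv hθ.1 x r).hasDerivWithinAt)
      (fun r hr => (hC (x, r) ⟨hx, hr⟩).trans (le_max_left _ _)) hs ht
  have e0 := hmvt 0 ⟨le_rfl, hT.le⟩
  have e1 := hmvt T ⟨hT.le, le_rfl⟩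
  rw [h0, sub_zero, sub_zero, abs_of_nonneg ht.1] at e0
  rw [h1, sub_zero, abs_sub_comm, abs_of_nonneg (sub_nonneg.2 ht.2)] at e1
  have e2 := mul_le_mul_of_nonneg_right e0 (sub_nonneg.2 ht.2)
  have e3 := mul_le_mul_of_nonneg_right e1 ht.1
  simp only
  rw [div_mul_eq_mul_div, le_div_iff₀ hT]
  linarith

/-- Integration by parts in time against smooth functions that vanish at `t = 0` and `t = T`,
without being compactly supported: insert the cutoffs.  The cutoff derivative is large only where
the function is small. -/
theorem integral_timeDeriv_eq_zero_of_vanishing (hT : 0 < T) (φ : H1 lo hi T)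
    {θ : (Fin n → ℝ) × ℝ → ℝ} (hθ : PeriodicSmooth lo hi θ) (h0 : ∀ x, θ (x, 0) = 0)
    (h1 : ∀ x, θ (x, T) = 0) :
    ∫ p in spaceTime lo hi T, (H1.dt φ p * θ p + H1.val φ p * timeDeriv θ p) = 0 := by
  have hms := measurableSet_spaceTime lo hi T
  obtain ⟨C, hC0, hC⟩ := exists_abs_le_of_vanishing hT hθ h0 h1
  obtain ⟨M, hM0, hM⟩ := exists_bound_timeCutoffDeriv T
  obtain ⟨B, hB⟩ := (spaceTime_isCompact lo hi T).exists_bound_of_continuousOn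
    hθ.1.continuous.continuousOn
  obtain ⟨B', hB'⟩ := (spaceTime_isCompact lo hi T).exists_bound_of_continuousOn
    hθ.continuous_timeDeriv.continuousOn
  set η : ℕ → (Fin n → ℝ) × ℝ → ℝ := fun k p => timeCutoff T k p.2 * θ p with hη
  have hηsmooth : ∀ k, ContDiff ℝ ∞ (η k) := fun k =>
    ((contDiff_timeCutoff T k).comp contDiff_snd).mul hθ.1
  have hηtest : ∀ k, PeriodicTest lo hi T (η k) := by
    intro k
    refine ⟨⟨hηsmooth k, fun i x t => ?_⟩, ?_⟩
    · simp only [hη, hθ.2 i x t]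
    · obtain ⟨a, b, ha, hb, hab⟩ := timeCutoff_support hT k
      exact ⟨a, b, ha, hb, fun x t ht => by simp only [hη, hab t ht, zero_mul]⟩
  have hηdt : ∀ k p, timeDeriv (η k) p
      = timeCutoffDeriv T k p.2 * θ p + timeCutoff T k p.2 * timeDeriv θ p := fun k p =>
    timeDeriv_eq_of_hasDerivAt (hηsmooth k)
      ((hasDerivAt_timeCutoff T k p.2).mul (hasDerivAt_timeDeriv hθ.1 p.1 p.2))
  set F : ℕ → (Fin n → ℝ) × ℝ → ℝ := fun k p => H1.dt φ p * η k p + H1.val φ p * timeDeriv (η k) p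
    with hF
  have hi1 : ∀ k, Integrable (fun p => H1.dt φ p * η k p) (volume.restrict (spaceTime lo hi T)) :=
    fun k => integrable_mul_continuous (Lp.memLp _) (hηsmooth k).continuous
  have hi2 : ∀ k, Integrable (fun p => H1.val φ p * timeDeriv (η k) p)
      (volume.restrict (spaceTime lo hi T)) :=
    fun k => integrable_mul_continuous (Lp.memLp _) (hηtest k).1.continuous_timeDeriv
  have hF0 : ∀ k, ∫ p in spaceTime lo hi T, F k p = 0 := by
    intro k
    have := (φ.2 (η k) (hηtest k)).1
    rw [hF, integral_add (hi1 k) (hi2 k)]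
    exact (add_eq_zero_iff_eq_neg'.2 this)
  have hfin : IsFiniteMeasure ((volume : Measure ((Fin n → ℝ) × ℝ)).restrict (spaceTime lo hi T)) :=
    ⟨by rw [Measure.restrict_apply_univ]; exact (spaceTime_isCompact lo hi T).measure_lt_top⟩
  have hIoo : ∀ᵐ p ∂((volume : Measure ((Fin n → ℝ) × ℝ)).restrict (spaceTime lo hi T)),
      p.2 ∈ Ioo 0 T := by
    rw [restrict_spaceTime]
    refine Measure.quasiMeasurePreserving_snd.ae ?_
    rw [← restrict_Ioo_eq_restrict_Icc]
    exact ae_restrict_mem measurableSet_Ioo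
  have hlim : Tendsto (fun k => ∫ p in spaceTime lo hi T, F k p) atTop
      (𝓝 (∫ p in spaceTime lo hi T, (H1.dt φ p * θ p + H1.val φ p * timeDeriv θ p))) := by
    refine tendsto_integral_of_dominated_convergence
      (fun p => ‖H1.dt φ p‖ * B + ‖H1.val φ p‖ * (M * C + B'))
      (fun k => ((hi1 k).add (hi2 k)).aestronglyMeasurable)
      ((((Lp.memLp (H1.dt φ)).integrable one_le_two).norm.mul_const _).add
        (((Lp.memLp (H1.val φ)).integrable one_le_two).norm.mul_const _)) (fun k => ?_) ?_
    · filter_upwards [ae_restrict_mem hms] with p hp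
      have hχ := abs_timeCutoff_le T k p.2
      have e1 : |η k p| ≤ B := by
        rw [hη, abs_mul]
        exact (mul_le_of_le_one_left (abs_nonneg _) hχ).trans (hB p hp)
      have e2 : |timeDeriv (η k) p| ≤ M * C + B' := by
        rw [hηdt]
        refine (abs_add_le _ _).trans (add_le_add ?_ ?_)
        · rw [abs_mul]
          calc |timeCutoffDeriv T k p.2| * |θ p|
              ≤ |timeCutoffDeriv T k p.2| * (C * (p.2 * (T - p.2))) := by
                gcongr; exact hC p hp
            _ = (|timeCutoffDeriv T k p.2| * (p.2 * (T - p.2))) * C := by ring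
            _ ≤ M * C := by gcongr; exact hM k p.2 hp.2
        · rw [abs_mul]
          exact (mul_le_of_le_one_left (abs_nonneg _) hχ).trans (hB' p hp)
      refine (norm_add_le _ _).trans (add_le_add ?_ ?_)
      · rw [norm_mul]; exact mul_le_mul_of_nonneg_left e1 (norm_nonneg _)
      · rw [norm_mul]; exact mul_le_mul_of_nonneg_left e2 (norm_nonneg _)
    · filter_upwards [hIoo] with p hp
      refine tendsto_const_nhds.congr' ?_
      filter_upwards [eventually_timeCutoff hp] with k hk
      simp only [hF, hηdt]
      simp only [hη, hk.1, hk.2, one_mul, zero_mul, zero_add]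
  simp only [hF0] at hlim
  exact tendsto_nhds_unique hlim tendsto_const_nhds |>.symm ▸ rfl

/-- The traces are the time integrals of `(t / T) φ_t + φ / T` and
`-((1 - t / T) φ_t - φ / T)`: on affine interpolations in `t` the integration by parts formula holds
by construction, and a general test function differs from its interpolation by a function that
vanishes at both ends. -/
theorem H1.exists_hasTimeTraces (hT : 0 < T) (φ : H1 lo hi T) :
    ∃ u : L2Space lo hi × L2Space lo hi, H1.HasTimeTraces φ u.1 u.2 := by
  have hms := measurableSet_spaceTime lo hi T
  have hmemLp : ∀ r : ℝ → ℝ, Continuous r →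
      MemLp (fun p => H1.dt φ p * r p.2) 2 (volume.restrict (spaceTime lo hi T)) := by
    intro r hr
    obtain ⟨C, hC⟩ := (isCompact_Icc (a := 0) (b := T)).exists_bound_of_continuousOn
      hr.continuousOn
    refine MemLp.of_le_mul (c := C) (Lp.memLp (H1.dt φ))
      ((Lp.aestronglyMeasurable _).mul (hr.comp continuous_snd).aestronglyMeasurable) ?_
    filter_upwards [ae_restrict_mem hms] with p hp
    rw [norm_mul, mul_comm]
    exact mul_le_mul_of_nonneg_right (hC _ hp.2) (norm_nonneg _)
  obtain ⟨u₁, hu₁⟩ := exists_timeIntegral ((hmemLp (fun t => t / T) (by fun_prop)).add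
    ((Lp.memLp (H1.val φ)).const_mul (1 / T)))
  obtain ⟨u₀, hu₀⟩ := exists_timeIntegral (((Lp.memLp (H1.val φ)).const_mul (1 / T)).sub
    (hmemLp (fun t => 1 - t / T) (by fun_prop)))
  refine ⟨(u₀, u₁), fun η hη => ?_⟩
  have hc₁ : ContDiff ℝ ∞ fun x : Fin n → ℝ => η (x, T) :=
    hη.1.comp (contDiff_id.prodMk contDiff_const)
  have hc₀ : ContDiff ℝ ∞ fun x : Fin n → ℝ => η (x, 0) :=
    hη.1.comp (contDiff_id.prodMk contDiff_const)
  rw [hu₁ _ hc₁.continuous, hu₀ _ hc₀.continuous]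
  -- the affine interpolation in time of the boundary values of `η`
  set ζ : (Fin n → ℝ) × ℝ → ℝ := fun p => p.2 / T * η (p.1, T) + (1 - p.2 / T) * η (p.1, 0) with hζ
  have hζc : ContDiff ℝ ∞ ζ := by
    have h1 : ContDiff ℝ ∞ fun p : (Fin n → ℝ) × ℝ => η (p.1, T) := hc₁.comp contDiff_fst
    have h2 : ContDiff ℝ ∞ fun p : (Fin n → ℝ) × ℝ => η (p.1, 0) := hc₀.comp contDiff_fst
    have h3 : ContDiff ℝ ∞ fun p : (Fin n → ℝ) × ℝ => p.2 / T := contDiff_snd.div_const T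
    exact (h3.mul h1).add ((contDiff_const.sub h3).mul h2)
  have hζper : PeriodicSmooth lo hi ζ := ⟨hζc, fun i x t => by simp only [hζ, hη.2 i x]⟩
  have hζdt : ∀ p, timeDeriv ζ p = 1 / T * η (p.1, T) - 1 / T * η (p.1, 0) := by
    intro p
    refine timeDeriv_eq_of_hasDerivAt hζc ?_
    have h1 : HasDerivAt (fun s : ℝ => s / T) (1 / T) p.2 := (hasDerivAt_id p.2).div_const T
    exact ((h1.mul_const (η (p.1, T))).add ((h1.const_sub 1).mul_const (η (p.1, 0)))).congr_deriv
      (by ring)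
  have hθper : PeriodicSmooth lo hi (fun p => η p - ζ p) :=
    ⟨hη.1.sub hζc, fun i x t => by simp only [hη.2 i x t, hζper.2 i x t]⟩
  have hθdt : ∀ p, timeDeriv (fun p => η p - ζ p) p = timeDeriv η p - timeDeriv ζ p := fun p =>
    timeDeriv_eq_of_hasDerivAt hθper.1
      ((hasDerivAt_timeDeriv hη.1 p.1 p.2).sub (hasDerivAt_timeDeriv hζc p.1 p.2))
  have hθ := integral_timeDeriv_eq_zero_of_vanishing hT φ hθper
    (fun x => by simp [hζ]) (fun x => by simp [hζ, hT.ne'])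
  have hint : ∀ {ξ : (Fin n → ℝ) × ℝ → ℝ}, PeriodicSmooth lo hi ξ → Integrable
      (fun p => H1.dt φ p * ξ p + H1.val φ p * timeDeriv ξ p)
      (volume.restrict (spaceTime lo hi T)) := fun hξ =>
    (integrable_mul_continuous (Lp.memLp _) hξ.1.continuous).add
      (integrable_mul_continuous (Lp.memLp _) hξ.continuous_timeDeriv)
  have hsplit : ∫ p in spaceTime lo hi T, (H1.dt φ p * η p + H1.val φ p * timeDeriv η p)
      = ∫ p in spaceTime lo hi T, (H1.dt φ p * ζ p + H1.val φ p * timeDeriv ζ p) := by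
    rw [← sub_eq_zero, ← integral_sub (hint hη) (hint hζper), ← hθ]
    refine integral_congr_ae (Eventually.of_forall fun p => ?_)
    simp only [hθdt]
    ring
  have hb : ∀ {w : (Fin n → ℝ) × ℝ → ℝ} {ξ : (Fin n → ℝ) → ℝ},
      MemLp w 2 (volume.restrict (spaceTime lo hi T)) → Continuous ξ →
      Integrable (fun p => w p * ξ p.1) (volume.restrict (spaceTime lo hi T)) := fun hw hξ =>
    integrable_mul_continuous hw (hξ.comp continuous_fst)
  rw [hsplit, ← integral_sub (hb ((hmemLp (fun t => t / T) (by fun_prop)).add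
    ((Lp.memLp (H1.val φ)).const_mul (1 / T))) hc₁.continuous)
    (hb (((Lp.memLp (H1.val φ)).const_mul (1 / T)).sub
    (hmemLp (fun t => 1 - t / T) (by fun_prop))) hc₀.continuous)]
  refine integral_congr_ae (Eventually.of_forall fun p => ?_)
  simp only [hζdt, Pi.add_apply, Pi.sub_apply]
  simp only [hζ]
  ring

end TraceExistence

/-! ### Uniqueness and continuity of the time traces -/

section TraceUniqueness

variable {n : ℕ} {lo hi : Fin n → ℝ} {T : ℝ}

/-- The representative of `x` in the half-open rectangle, modulo the periods. -/
noncomputable def wrap {lo hi : Fin n → ℝ} (hΩ : ∀ i, lo i < hi i) (x : Fin n → ℝ) : Fin n → ℝ :=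
  fun i => toIcoMod (sub_pos.2 (hΩ i)) (lo i) (x i)

/-- The periodic extension of a function with compact support in the open rectangle is smooth:
near a point whose representative lies in the open rectangle, `wrap` is a translation, and near the
other points the extension vanishes. -/
theorem contDiff_comp_wrap (hΩ : ∀ i, lo i < hi i) {g : (Fin n → ℝ) → ℝ} (hg : ContDiff ℝ ∞ g)
    (hgc : HasCompactSupport g) (hgs : tsupport g ⊆ univ.pi fun i => Ioo (lo i) (hi i)) :
    ContDiff ℝ ∞ fun x => g (wrap hΩ x) := by
  rw [contDiff_iff_contDiffAt]
  intro x
  have hico : ∀ i (y : Fin n → ℝ), wrap hΩ y i ∈ Ico (lo i) (hi i) := fun i y => by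
    have h := toIcoMod_mem_Ico (sub_pos.2 (hΩ i)) (lo i) (y i)
    rwa [add_sub_cancel] at h
  set d : Fin n → ℝ := fun i => toIcoDiv (sub_pos.2 (hΩ i)) (lo i) (x i) • (hi i - lo i) with hd
  have hxd : ∀ i, x i - d i = wrap hΩ x i := fun i => rfl
  have hsub : ∀ i (y : Fin n → ℝ), wrap hΩ y i
      = toIcoMod (sub_pos.2 (hΩ i)) (lo i) (y i - d i) := fun i y =>
    (toIcoMod_sub_zsmul (sub_pos.2 (hΩ i)) (lo i) (y i) _).symm
  by_cases hx : ∀ i, lo i < wrap hΩ x i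
  · have hev : (fun y => g (wrap hΩ y)) =ᶠ[𝓝 x] fun y => g (y - d) := by
      have h1 : ∀ᶠ y in 𝓝 x, ∀ i, y i - d i ∈ Ioo (lo i) (hi i) := by
        rw [eventually_all]
        intro i
        have hc : ContinuousAt (fun y : Fin n → ℝ => y i - d i) x :=
          ((continuous_apply i).sub continuous_const).continuousAt
        refine hc.eventually_mem (isOpen_Ioo.mem_nhds ?_)
        rw [hxd]; exact ⟨hx i, (hico i x).2⟩
      filter_upwards [h1] with y hy
      congr 1
      funext i
      rw [hsub, Pi.sub_apply]
      exact (toIcoMod_eq_self _).2 ⟨(hy i).1.le, by simpa using (hy i).2⟩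
    exact ContDiffAt.congr_of_eventuallyEq
      (hg.comp (contDiff_id.sub contDiff_const)).contDiffAt hev
  · obtain ⟨i, hi'⟩ := not_forall.1 hx
    have hlo : x i - d i = lo i := by
      rw [hxd]; exact le_antisymm (not_lt.1 hi') (hico i x).1
    -- the support keeps a positive distance from the faces
    obtain ⟨δ, hδ0, hδ⟩ : ∃ δ > 0, ∀ y, g y ≠ 0 → lo i + δ ≤ y i ∧ y i ≤ hi i - δ := by
      have hpos : ∀ y ∈ tsupport g, 0 < min (y i - lo i) (hi i - y i) := fun y hy =>
        lt_min (sub_pos.2 (hgs hy i (mem_univ i)).1) (sub_pos.2 (hgs hy i (mem_univ i)).2)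
      obtain ⟨δ, hδ0, hδ⟩ := hgc.isCompact.exists_forall_le' (a := 0)
        (f := fun y : Fin n → ℝ => min (y i - lo i) (hi i - y i)) (by fun_prop) hpos
      refine ⟨δ, hδ0, fun y hy => ?_⟩
      have := hδ y (subset_tsupport g hy)
      exact ⟨by linarith [this.trans (min_le_left _ _)], by linarith [this.trans (min_le_right _ _)]⟩
    have hev : (fun y => g (wrap hΩ y)) =ᶠ[𝓝 x] fun _ => 0 := by
      have h1 : ∀ᶠ y in 𝓝 x, |(y i - d i) - lo i| < min δ (hi i - lo i) := by
        have hc : ContinuousAt (fun y : Fin n → ℝ => |(y i - d i) - lo i|) x :=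
          (((continuous_apply i).sub continuous_const).sub continuous_const).abs.continuousAt
        refine hc.eventually (gt_mem_nhds ?_)
        beta_reduce
        rw [hlo, sub_self, abs_zero]
        exact lt_min hδ0 (sub_pos.2 (hΩ i))
      filter_upwards [h1] with y hy
      by_contra hne
      have h2 := hδ _ hne
      rw [hsub] at h2
      have h3 := abs_lt.1 (hy.trans_le (min_le_left _ _))
      have h4 := abs_lt.1 (hy.trans_le (min_le_right _ _))
      rcases le_or_gt (lo i) (y i - d i) with h | h
      · rw [(toIcoMod_eq_self _).2 ⟨h, by linarith⟩] at h2
        linarith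
      · rw [← toIcoMod_add_right, (toIcoMod_eq_self _).2 ⟨by linarith, by linarith⟩] at h2
        linarith
    exact contDiffAt_const.congr_of_eventuallyEq hev

/-- Smooth periodic functions separate the points of `L²(Ω)`. -/
theorem L2Space.ext_of_integral_periodic (hΩ : ∀ i, lo i < hi i) {u v : L2Space lo hi}
    (h : ∀ ξ : (Fin n → ℝ) → ℝ, ContDiff ℝ ∞ ξ →
      (∀ (i : Fin n) (x : Fin n → ℝ), ξ (x + Pi.single i (hi i - lo i)) = ξ x) →
      ∫ x in Icc lo hi, u x * ξ x = ∫ x in Icc lo hi, v x * ξ x) : u = v := by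
  set U : Set (Fin n → ℝ) := univ.pi fun i => Ioo (lo i) (hi i) with hU
  have hUo : IsOpen U := isOpen_set_pi finite_univ fun i _ => isOpen_Ioo
  have hUsub : U ⊆ Icc lo hi := fun x hx =>
    ⟨fun i => (hx i (mem_univ i)).1.le, fun i => (hx i (mem_univ i)).2.le⟩
  have hUae : U =ᵐ[volume] Icc lo hi := Measure.univ_pi_Ioo_ae_eq_Icc
  have hfin : IsFiniteMeasure ((volume : Measure (Fin n → ℝ)).restrict (Icc lo hi)) :=
    ⟨by rw [Measure.restrict_apply_univ]; exact isCompact_Icc.measure_lt_top⟩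
  have hint : IntegrableOn (fun x => u x - v x) (Icc lo hi) :=
    ((Lp.memLp u).integrable one_le_two).sub ((Lp.memLp v).integrable one_le_two)
  have key := hUo.ae_eq_zero_of_integral_contDiff_smul_eq_zero (μ := volume)
    (f := fun x => u x - v x) (hint.mono_set hUsub).locallyIntegrableOn (by
    intro g hg hgc hgs
    have hzero : ∀ x, x ∉ U → g x = 0 := fun x hx => by
      by_contra hne
      exact hx (hgs (subset_tsupport g hne))
    have hwrap : ∀ x ∈ U, g (wrap hΩ x) = g x := fun x hx => by
      congr 1
      funext i
      exact (toIcoMod_eq_self _).2 ⟨(hx i (mem_univ i)).1.le, by simpa using (hx i (mem_univ i)).2⟩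
    have h1 := h (fun x => g (wrap hΩ x)) (contDiff_comp_wrap hΩ hg hgc hgs) (fun i x => by
      congr 1
      funext j
      simp only [wrap, Pi.add_apply]
      rcases eq_or_ne j i with rfl | hji
      · rw [Pi.single_eq_same, toIcoMod_add_right]
      · rw [Pi.single_eq_of_ne hji, add_zero])
    rw [← setIntegral_congr_set hUae, ← setIntegral_congr_set hUae] at h1
    have hg2 : MemLp g 2 (volume.restrict U) := by
      rw [Measure.restrict_congr_set hUae]
      exact memLp_two_of_continuous isCompact_Icc measurableSet_Icc hg.continuous
    have hu2 : MemLp u 2 (volume.restrict U) := by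
      rw [Measure.restrict_congr_set hUae]; exact Lp.memLp u
    have hv2 : MemLp v 2 (volume.restrict U) := by
      rw [Measure.restrict_congr_set hUae]; exact Lp.memLp v
    have h2 : ∀ w : L2Space lo hi, ∫ x in U, w x * g (wrap hΩ x) = ∫ x in U, w x * g x := fun w =>
      setIntegral_congr_fun hUo.measurableSet fun x hx => by simp only [hwrap x hx]
    rw [h2, h2] at h1
    have hiu : Integrable (fun x => u x * g x) (volume.restrict U) := hu2.integrable_mul hg2
    have hiv : Integrable (fun x => v x * g x) (volume.restrict U) := hv2.integrable_mul hg2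
    rw [← setIntegral_eq_integral_of_forall_compl_eq_zero (s := U)
      (fun x hx => by rw [hzero x hx, zero_smul]), ← sub_eq_zero.2 h1,
      ← integral_sub hiu hiv]
    refine setIntegral_congr_fun hUo.measurableSet fun x _ => ?_
    simp only [smul_eq_mul]
    ring)
  refine Lp.ext ?_
  have huv : ∀ᵐ x ∂(volume.restrict U), u x = v x := by
    rw [ae_restrict_iff' hUo.measurableSet]
    filter_upwards [key] with x hx hxU
    exact sub_eq_zero.1 (hx hxU)
  rwa [Measure.restrict_congr_set hUae] at huv

/-- Traces are unique: test with functions of the form `(t / T) ξ(x)` and `(1 - t / T) ξ(x)`. -/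
theorem H1.hasTimeTraces_unique (hΩ : ∀ i, lo i < hi i) (hT : 0 < T) {φ : H1 lo hi T}
    {u₀ u₁ v₀ v₁ : L2Space lo hi} (hu : H1.HasTimeTraces φ u₀ u₁) (hv : H1.HasTimeTraces φ v₀ v₁) :
    u₀ = v₀ ∧ u₁ = v₁ := by
  have hper : ∀ {r : ℝ → ℝ} {ξ : (Fin n → ℝ) → ℝ}, ContDiff ℝ ∞ r → ContDiff ℝ ∞ ξ →
      (∀ (i : Fin n) (x : Fin n → ℝ), ξ (x + Pi.single i (hi i - lo i)) = ξ x) →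
      PeriodicSmooth lo hi fun p => r p.2 * ξ p.1 := fun hr hξ hξp =>
    ⟨(hr.comp contDiff_snd).mul (hξ.comp contDiff_fst), fun i x t => by simp only [hξp i x]⟩
  constructor <;> refine L2Space.ext_of_integral_periodic hΩ fun ξ hξ hξp => ?_
  · have hη := hper (r := fun t => 1 - t / T) (by fun_prop) hξ hξp
    have := (hu _ hη).symm.trans (hv _ hη)
    simpa [hT.ne'] using this
  · have hη := hper (r := fun t => t / T) (by fun_prop) hξ hξp
    have := (hu _ hη).symm.trans (hv _ hη)
    simpa [hT.ne'] using this

theorem H1.existsUnique_hasTimeTraces (hΩ : ∀ i, lo i < hi i) (hT : 0 < T) (φ : H1 lo hi T) :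
    ∃! u : L2Space lo hi × L2Space lo hi, H1.HasTimeTraces φ u.1 u.2 := by
  obtain ⟨u, hu⟩ := H1.exists_hasTimeTraces hT φ
  refine ⟨u, hu, fun v hv => ?_⟩
  obtain ⟨h0, h1⟩ := H1.hasTimeTraces_unique hΩ hT hv hu
  exact Prod.ext h0 h1

theorem H1.hasTimeTraces_timeTraces (hT : 0 < T) (φ : H1 lo hi T) :
    H1.HasTimeTraces φ (H1.timeTraces φ).1 (H1.timeTraces φ).2 := by
  have h := H1.exists_hasTimeTraces hT φ
  rw [H1.timeTraces, dif_pos h]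
  exact h.choose_spec

/-- The defect in the integration by parts formula is a continuous linear functional of the function
and its candidate traces. -/
theorem exists_traceDefect {η : (Fin n → ℝ) × ℝ → ℝ} (hη : PeriodicSmooth lo hi η) :
    ∃ Φ : (H1 lo hi T × (L2Space lo hi × L2Space lo hi)) →L[ℝ] ℝ, ∀ φ u, Φ (φ, u)
      = (∫ p in spaceTime lo hi T, (H1.dt φ p * η p + H1.val φ p * timeDeriv η p))
        - ((∫ x in Icc lo hi, u.2 x * η (x, T)) - ∫ x in Icc lo hi, u.1 x * η (x, 0)) := by
  have hK := spaceTime_isCompact lo hi T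
  have hm := measurableSet_spaceTime lo hi T
  have h1 := memLp_two_of_continuous hK hm hη.1.continuous
  have h2 := memLp_two_of_continuous hK hm hη.continuous_timeDeriv
  have h3 : MemLp (fun x => η (x, T)) 2 (volume.restrict (Icc lo hi)) :=
    memLp_two_of_continuous isCompact_Icc measurableSet_Icc
      (hη.1.continuous.comp (continuous_id.prodMk continuous_const))
  have h4 : MemLp (fun x => η (x, 0)) 2 (volume.restrict (Icc lo hi)) :=
    memLp_two_of_continuous isCompact_Icc measurableSet_Icc
      (hη.1.continuous.comp (continuous_id.prodMk continuous_const))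
  let D : H1 lo hi T →L[ℝ] L2Cyl lo hi T ℝ :=
    (WithLp.fstL 2 ℝ _ _).comp ((WithLp.sndL 2 ℝ _ _).comp (H1 lo hi T).subtypeL)
  let V : H1 lo hi T →L[ℝ] L2Cyl lo hi T ℝ := (WithLp.fstL 2 ℝ _ _).comp (H1 lo hi T).subtypeL
  refine ⟨(((innerSL ℝ (h1.toLp _)).comp D + (innerSL ℝ (h2.toLp _)).comp V).comp
      (ContinuousLinearMap.fst ℝ _ _))
    - ((innerSL ℝ (h3.toLp _)).comp (ContinuousLinearMap.snd ℝ _ _)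
      - (innerSL ℝ (h4.toLp _)).comp (ContinuousLinearMap.fst ℝ _ _)).comp
      (ContinuousLinearMap.snd ℝ _ _), fun φ u => ?_⟩
  rw [integral_add (integrable_mul_continuous (Lp.memLp _) hη.1.continuous)
    (integrable_mul_continuous (Lp.memLp _) hη.continuous_timeDeriv), integral_mul_eq_inner _ h1,
    integral_mul_eq_inner _ h2, integral_mul_eq_inner _ h3, integral_mul_eq_inner _ h4]
  rfl

/-- The pair of time traces depends continuously and linearly on `φ ∈ H¹`, by the closed graph
theorem. -/
theorem exists_traceCLM (hΩ : ∀ i, lo i < hi i) (hT : 0 < T) :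
    ∃ S : H1 lo hi T →L[ℝ] L2Space lo hi × L2Space lo hi, ∀ φ, S φ = H1.timeTraces φ := by
  choose Φ hΦ using fun (η : (Fin n → ℝ) × ℝ → ℝ) (hη : PeriodicSmooth lo hi η) =>
    exists_traceDefect (T := T) hη
  have hiff : ∀ φ u, H1.HasTimeTraces φ u.1 u.2 ↔ ∀ η hη, Φ η hη (φ, u) = 0 := fun φ u =>
    forall₂_congr fun η hη => by rw [hΦ, sub_eq_zero]
  have heq : ∀ (φ : H1 lo hi T) u, (∀ η hη, Φ η hη (φ, u) = 0) → H1.timeTraces φ = u :=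
    fun φ u h => by
      obtain ⟨h0, h1⟩ := H1.hasTimeTraces_unique hΩ hT (H1.hasTimeTraces_timeTraces hT φ)
        ((hiff φ u).2 h)
      exact Prod.ext h0 h1
  have hzero : ∀ (φ : H1 lo hi T) η hη, Φ η hη (φ, H1.timeTraces φ) = 0 := fun φ =>
    (hiff φ _).1 (H1.hasTimeTraces_timeTraces hT φ)
  let S : H1 lo hi T →ₗ[ℝ] L2Space lo hi × L2Space lo hi :=
    { toFun := H1.timeTraces
      map_add' := fun φ ψ => heq _ _ fun η hη => by
        rw [← Prod.mk_add_mk, map_add, hzero, hzero, add_zero]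
      map_smul' := fun r φ => heq _ _ fun η hη => by
        rw [RingHom.id_apply, ← Prod.smul_mk, map_smul, hzero, smul_zero] }
  refine ⟨⟨S, S.continuous_of_isClosed_graph ?_⟩, fun φ => rfl⟩
  have : (S.graph : Set (H1 lo hi T × (L2Space lo hi × L2Space lo hi)))
      = ⋂ (η) (hη), {q | Φ η hη q = 0} := by
    ext ⟨φ, u⟩
    simp only [SetLike.mem_coe, LinearMap.mem_graph_iff, mem_iInter, mem_ofPred_eq]
    constructor
    · rintro rfl
      exact hzero φ
    · exact fun h => (heq φ u h).symm
  rw [this]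
  exact isClosed_iInter fun η => isClosed_iInter fun hη =>
    isClosed_eq (Φ η hη).continuous continuous_const

end TraceUniqueness

/-! ### The functional `G` -/

section Primal

variable {n m : ℕ} {lo hi : Fin n → ℝ} {T : ℝ}

/-- `G` is a continuous linear functional restricted to a closed affine subspace. -/
theorem exists_primalFunctional_eq (hΩ : ∀ i, lo i < hi i) (hT : 0 < T) {g : (Fin n → ℝ) → ℝ}
    (hg : ∃ φ : H1 lo hi T, H1.InitialCondition φ g) (c : ℝ) :
    ∃ (S₀ : H1 lo hi T →L[ℝ] L2Space lo hi) (u : L2Space lo hi) (ℓ : H1 lo hi T →L[ℝ] ℝ),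
      (∃ φ, S₀ φ = u) ∧ (∀ φ, S₀ φ = u → primalFunctional g c φ = (ℓ φ : EReal)) ∧
      ∀ φ, S₀ φ ≠ u → primalFunctional g c φ = ⊤ := by
  obtain ⟨S, hS⟩ := exists_traceCLM (lo := lo) (hi := hi) hΩ hT
  obtain ⟨φ₀, hφ₀⟩ := hg
  have hfin : IsFiniteMeasure ((volume : Measure (Fin n → ℝ)).restrict (Icc lo hi)) :=
    ⟨by rw [Measure.restrict_apply_univ]; exact isCompact_Icc.measure_lt_top⟩
  have h1 : MemLp (fun _ : Fin n → ℝ => (1 : ℝ)) 2 (volume.restrict (Icc lo hi)) := memLp_const 1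
  have hiff : ∀ φ : H1 lo hi T,
      H1.InitialCondition φ g ↔ (S φ).1 = H1.initialTrace φ₀ := by
    intro φ
    rw [hS]
    constructor
    · intro h
      refine Lp.ext ?_
      filter_upwards [h, hφ₀] with x e1 e2
      rw [e2]; exact e1
    · intro h
      have h' : H1.initialTrace φ = H1.initialTrace φ₀ := h
      rw [H1.InitialCondition, h']
      exact hφ₀
  refine ⟨(ContinuousLinearMap.fst ℝ _ _).comp S, H1.initialTrace φ₀,
    (-c) • ((innerSL ℝ (h1.toLp _)).comp ((ContinuousLinearMap.snd ℝ _ _).comp S)),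
    ⟨φ₀, (hiff φ₀).1 hφ₀⟩, fun φ hφ => ?_, fun φ hφ => ?_⟩
  · rw [primalFunctional, if_pos ((hiff φ).2 hφ)]
    have h2 := integral_mul_eq_inner (H1.terminalTrace φ) h1
    simp only [mul_one] at h2
    rw [h2]
    have h3 : (S φ).2 = H1.terminalTrace φ := by rw [hS]; rfl
    rw [← h3]
    rfl
  · rw [primalFunctional, if_neg fun h => hφ ((hiff φ).1 h)]

theorem primalFunctional_properties (hΩ : ∀ i, lo i < hi i) (hT : 0 < T) {g : (Fin n → ℝ) → ℝ}
    (hg : ∃ φ : H1 lo hi T, H1.InitialCondition φ g) (c : ℝ) :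
    EProper (primalFunctional g c : H1 lo hi T → EReal) ∧
      EConvex (primalFunctional g c : H1 lo hi T → EReal) ∧
      LowerSemicontinuous (primalFunctional g c : H1 lo hi T → EReal) ∧
      ∃ ℓ : H1 lo hi T →L[ℝ] ℝ, ∀ φ, (ℓ φ : EReal) ≤ primalFunctional g c φ := by
  obtain ⟨S₀, u, ℓ, ⟨φ₀, hφ₀⟩, hin, hout⟩ := exists_primalFunctional_eq hΩ hT hg c
  have hle : ∀ (φ : H1 lo hi T) (a : EReal),
      primalFunctional g c φ ≤ a ↔ a = ⊤ ∨ (S₀ φ = u ∧ (ℓ φ : EReal) ≤ a) := by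
    intro φ a
    by_cases h : S₀ φ = u
    · rw [hin φ h]
      constructor
      · exact fun h' => Or.inr ⟨h, h'⟩
      · rintro (rfl | h')
        · exact le_top
        · exact h'.2
    · rw [hout φ h, top_le_iff]
      simp [h]
  refine ⟨⟨fun φ => ?_, φ₀, ?_⟩, ?_, ?_, ℓ, fun φ => ?_⟩
  · by_cases h : S₀ φ = u
    · rw [hin φ h]; exact EReal.coe_ne_bot _
    · rw [hout φ h]; exact top_ne_bot
  · rw [hin φ₀ hφ₀]; exact EReal.coe_ne_top _
  · rintro ⟨φ, r⟩ hφ ⟨ψ, s⟩ hψ a b ha hb hab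
    simp only [mem_ofPred_eq, Prod.smul_mk, Prod.mk_add_mk, smul_eq_mul, hle, EReal.coe_ne_top,
      false_or, EReal.coe_le_coe_iff, map_add, map_smul] at hφ hψ ⊢
    refine ⟨?_, add_le_add (mul_le_mul_of_nonneg_left hφ.2 ha)
      (mul_le_mul_of_nonneg_left hψ.2 hb)⟩
    rw [hφ.1, hψ.1, ← add_smul, hab, one_smul]
  · rw [lowerSemicontinuous_iff_isClosed_preimage]
    intro a
    have : primalFunctional g c ⁻¹' Iic a
        = {_φ : H1 lo hi T | a = ⊤} ∪ ({φ | S₀ φ = u} ∩ {φ | (ℓ φ : EReal) ≤ a}) := by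
      ext φ
      simp only [mem_preimage, mem_Iic, hle, mem_union, mem_inter_iff, mem_ofPred_eq]
    rw [this]
    exact isClosed_const.union ((isClosed_eq S₀.continuous continuous_const).inter
      (isClosed_le (continuous_coe_real_ereal.comp ℓ.continuous) continuous_const))
  · by_cases h : S₀ φ = u
    · rw [hin φ h]
    · rw [hout φ h]; exact le_top

end Primal

/-! ### The updates as proximal steps -/

section Updates

variable {n m : ℕ} {lo hi : Fin n → ℝ} {T : ℝ}
  {A : (Fin n → ℝ) → ℝ → Matrix (Fin n) (Fin m) ℝ} {b : (Fin n → ℝ) → ℝ → (Fin n → ℝ)}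
  {L : (Fin n → ℝ) → ℝ → EuclideanSpace ℝ (Fin m) → ℝ≥0∞} {g : (Fin n → ℝ) → ℝ} {c : ℝ}
  {K : H1 lo hi T →L[ℝ] DualSpace lo hi T m →L[ℝ] ℝ}

theorem isPrimalUpdate_iff (hK : ∀ φ y, K φ y = coupling A b φ y) (τ : ℝ)
    (y : DualSpace lo hi T m) (φ₀ φ : H1 lo hi T) : IsPrimalUpdate A b g c τ y φ₀ φ ↔
      IsMinOn (eProxObjective (primalFunctional g c) (K.flip y) (1 / (2 * τ)) φ₀) univ φ := by
  rw [IsPrimalUpdate]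
  simp only [← hK]
  rfl

theorem isDualUpdate_iff (hK : ∀ φ y, K φ y = coupling A b φ y) (τ : ℝ) (φ : H1 lo hi T)
    (y₀ y : DualSpace lo hi T m) : IsDualUpdate A b L τ φ y₀ y ↔
      IsMinOn (eProxObjective (dualFunctional L) (-K φ) (1 / (2 * τ)) y₀) univ y := by
  have key : ∀ z : DualSpace lo hi T m,
      (coupling A b φ z : EReal) - dualFunctional L z
        - ((1 / (2 * τ) * (‖z.fst - y₀.fst‖ ^ 2 + ‖z.snd - y₀.snd‖ ^ 2) : ℝ) : EReal)
      = -eProxObjective (dualFunctional L) (-K φ) (1 / (2 * τ)) y₀ z := by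
    intro z
    have hn : ‖z.fst - y₀.fst‖ ^ 2 + ‖z.snd - y₀.snd‖ ^ 2 = ‖z - y₀‖ ^ 2 := by
      rw [WithLp.prod_norm_sq_eq_of_L2]; rfl
    rw [hn, ← hK]
    by_cases h : dualFunctional L z = ⊤
    · rw [eProxObjective_eq_top h, h]; simp
    · rw [eProxObjective_eq_coe (eproper_dualFunctional.1 z) h]
      conv_lhs => rw [← EReal.coe_toReal h (eproper_dualFunctional.1 z)]
      rw [← EReal.coe_sub, ← EReal.coe_sub, ← EReal.coe_neg]
      congr 1
      simp only [proxObjective, neg_apply]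
      ring
  rw [IsDualUpdate, isMaxOn_univ_iff, isMinOn_univ_iff]
  simp only [key, EReal.neg_le_neg_iff]

theorem saddleObjective_eq_coe (hK : ∀ φ y, K φ y = coupling A b φ y) {φ : H1 lo hi T}
    {y : DualSpace lo hi T m} (hb : primalFunctional g c φ ≠ ⊥) (ht : primalFunctional g c φ ≠ ⊤)
    (hy : dualFunctional L y ≠ ⊤) : saddleObjective A b L g c φ y
      = ((K φ y + (primalFunctional g c φ).toReal - (dualFunctional L y).toReal : ℝ) : EReal) := by
  rw [saddleObjective, EReal.coe_sub, EReal.coe_add, EReal.coe_toReal ht hb,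
    EReal.coe_toReal hy (eproper_dualFunctional.1 y), hK]

theorem saddleObjective_eq_bot {φ : H1 lo hi T} {y : DualSpace lo hi T m}
    (hy : dualFunctional L y = ⊤) : saddleObjective A b L g c φ y = ⊥ := by
  rw [saddleObjective, hy, EReal.sub_top]

theorem saddleObjective_eq_top {φ : H1 lo hi T} {y : DualSpace lo hi T m}
    (hφ : primalFunctional g c φ = ⊤) (hy : dualFunctional L y ≠ ⊤) :
    saddleObjective A b L g c φ y = ⊤ := by
  rw [saddleObjective, hφ, EReal.coe_add_top,
    ← EReal.coe_toReal hy (eproper_dualFunctional.1 y), EReal.top_sub_coe]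

/-- Saddle points, expressed through real inequalities on the epigraphs. -/
theorem isSaddlePoint_iff (hK : ∀ φ y, K φ y = coupling A b φ y)
    (hG : EProper (primalFunctional g c : H1 lo hi T → EReal)) (φ : H1 lo hi T)
    (y : DualSpace lo hi T m) : IsSaddlePoint A b L g c φ y ↔
      primalFunctional g c φ ≠ ⊤ ∧ dualFunctional L y ≠ ⊤ ∧
      ∀ p ∈ realEpigraph (primalFunctional g c : H1 lo hi T → EReal),
      ∀ q ∈ realEpigraph (dualFunctional L : DualSpace lo hi T m → EReal),
        K φ q.1 + (primalFunctional g c φ).toReal - q.2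
          ≤ K p.1 y + p.2 - (dualFunctional L y).toReal := by
  have hF : EProper (dualFunctional L : DualSpace lo hi T m → EReal) := eproper_dualFunctional
  refine and_congr_right fun hφ => and_congr_right fun hy => ?_
  have e := saddleObjective_eq_coe hK (hG.1 φ) hφ hy
  constructor
  · rintro ⟨hmax, hmin⟩ p hp q hq
    have hp' := ne_top_of_mem_realEpigraph (r := p.2) hp
    have hq' := ne_top_of_mem_realEpigraph (r := q.2) hq
    have h1 := (hmax q.1).trans (hmin p.1)
    rw [saddleObjective_eq_coe hK (hG.1 φ) hφ hq', saddleObjective_eq_coe hK (hG.1 p.1) hp' hy,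
      EReal.coe_le_coe_iff] at h1
    have h2 := toReal_le_of_mem_realEpigraph (r := p.2) (hG.1 p.1) hp
    have h3 := toReal_le_of_mem_realEpigraph (r := q.2) (hF.1 q.1) hq
    linarith
  · intro h
    have hφm := mem_realEpigraph_toReal (hG.1 φ) hφ
    have hym := mem_realEpigraph_toReal (hF.1 y) hy
    refine ⟨fun y' => ?_, fun φ' => ?_⟩
    · by_cases hy' : dualFunctional L y' = ⊤
      · rw [saddleObjective_eq_bot hy']; exact bot_le
      · rw [e, saddleObjective_eq_coe hK (hG.1 φ) hφ hy', EReal.coe_le_coe_iff]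
        exact h _ hφm _ (mem_realEpigraph_toReal (hF.1 y') hy')
    · by_cases hφ' : primalFunctional g c φ' = ⊤
      · rw [saddleObjective_eq_top hφ' hy]; exact le_top
      · rw [e, saddleObjective_eq_coe hK (hG.1 φ') hφ' hy, EReal.coe_le_coe_iff]
        exact h _ (mem_realEpigraph_toReal (hG.1 φ') hφ') _ hym

end Updates

end PDHG

theorem mainTheorem1 {n m : ℕ} (lo hi : Fin n → ℝ) (hΩ : ∀ i, lo i < hi i) (T : ℝ) (hT : 0 < T)
    (A : (Fin n → ℝ) → ℝ → Matrix (Fin n) (Fin m) ℝ)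
    (hA : ContinuousOn (fun p : (Fin n → ℝ) × ℝ => A p.1 p.2) (spaceTime lo hi T))
    (b : (Fin n → ℝ) → ℝ → (Fin n → ℝ))
    (hb : ContinuousOn (fun p : (Fin n → ℝ) × ℝ => b p.1 p.2) (spaceTime lo hi T))
    (L : (Fin n → ℝ) → ℝ → EuclideanSpace ℝ (Fin m) → ℝ≥0∞)
    (hLmeas : Measurable
      (fun q : ((Fin n → ℝ) × ℝ) × EuclideanSpace ℝ (Fin m) => L q.1.1 q.1.2 q.2))
    (hLproper : ∀ p ∈ spaceTime lo hi T, EProper (fun α => (L p.1 p.2 α : EReal)))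
    (hLconvex : ∀ p ∈ spaceTime lo hi T, EConvex (fun α => (L p.1 p.2 α : EReal)))
    (hLlsc : ∀ p ∈ spaceTime lo hi T, LowerSemicontinuous (L p.1 p.2))
    (hLcoercive : ∀ p ∈ spaceTime lo hi T, OneCoercive (L p.1 p.2))
    (hLzero : ∀ p ∈ spaceTime lo hi T, L p.1 p.2 0 = 0)
    (g : (Fin n → ℝ) → ℝ) (hg : ∃ φ : H1 lo hi T, H1.InitialCondition φ g) (c : ℝ) :
    -- the change of variable `m = ρ α`
    (∀ (φ : H1 lo hi T) (y : DualSpace lo hi T m)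
        (α : (Fin n → ℝ) × ℝ → EuclideanSpace ℝ (Fin m)),
      (∀ᵐ p ∂(volume.restrict (spaceTime lo hi T)), 0 ≤ y.fst p ∧ y.snd p = y.fst p • α p) →
      saddleObjective A b L g c φ y = controlObjective A b L g c φ y.fst α) ∧
    (∀ y : DualSpace lo hi T m, dualFunctional L y ≠ ⊤ →
      ∃ α : (Fin n → ℝ) × ℝ → EuclideanSpace ℝ (Fin m), Measurable α ∧
        ∀ᵐ p ∂(volume.restrict (spaceTime lo hi T)), 0 ≤ y.fst p ∧ y.snd p = y.fst p • α p) ∧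
    -- the traces at `t = 0` and `t = T` entering `G` exist and are unique
    (∀ φ : H1 lo hi T, ∃! u : L2Space lo hi × L2Space lo hi, H1.HasTimeTraces φ u.1 u.2) ∧
    -- `G`, `F̂` and `F = F̂*` are proper, convex and lower semicontinuous, and `F̂ = F*`
    (EProper (primalFunctional g c : H1 lo hi T → EReal) ∧
      EConvex (primalFunctional g c : H1 lo hi T → EReal) ∧
      LowerSemicontinuous (primalFunctional g c : H1 lo hi T → EReal)) ∧
    (EProper (dualFunctional L : DualSpace lo hi T m → EReal) ∧
      EConvex (dualFunctional L : DualSpace lo hi T m → EReal) ∧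
      LowerSemicontinuous (dualFunctional L : DualSpace lo hi T m → EReal)) ∧
    (EProper (conjugate (dualFunctional L : DualSpace lo hi T m → EReal)) ∧
      EConvex (conjugate (dualFunctional L : DualSpace lo hi T m → EReal)) ∧
      LowerSemicontinuous (conjugate (dualFunctional L : DualSpace lo hi T m → EReal)) ∧
      conjugate (conjugate (dualFunctional L : DualSpace lo hi T m → EReal)) = dualFunctional L) ∧
    -- `K` is a well-defined bounded bilinear form, with explicit bounds
    (∀ (φ : H1 lo hi T) (y : DualSpace lo hi T m),
      IntegrableOn (couplingDensity A b φ y) (spaceTime lo hi T)) ∧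
    ∃ K : H1 lo hi T →L[ℝ] DualSpace lo hi T m →L[ℝ] ℝ,
      (∀ φ y, K φ y = coupling A b φ y) ∧
      (∀ (φ : H1 lo hi T) (y : DualSpace lo hi T m), |coupling A b φ y| ≤
        √(n + 1) * max 1 (supDrift lo hi T b) * ‖y.fst‖ * ‖φ‖
          + √(n * m) * supEntry lo hi T A * ‖y.snd‖ * ‖φ‖) ∧
      ‖K‖ ≤ (n + 1) * max 1 (supDrift lo hi T b) ^ 2 + n * m * supEntry lo hi T A ^ 2 ∧
      -- the updates are well defined
      (∀ τ : ℝ, 0 < τ →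
        (∀ (φ : H1 lo hi T) (y₀ : DualSpace lo hi T m), ∃! y, IsDualUpdate A b L τ φ y₀ y) ∧
        ∀ (y : DualSpace lo hi T m) (φ₀ : H1 lo hi T), ∃! φ, IsPrimalUpdate A b g c τ y φ₀ φ) ∧
      -- convergence of the ergodic averages
      ((∃ (φ : H1 lo hi T) (y : DualSpace lo hi T m), IsSaddlePoint A b L g c φ y) →
        ∀ τφ τρm : ℝ, 0 < τφ → 0 < τρm → τφ * τρm * ‖K‖ ^ 2 < 1 →
        ∀ (φ φt : ℕ → H1 lo hi T) (y : ℕ → DualSpace lo hi T m),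
          IsPDHG A b L g c τφ τρm φ φt y →
          ∃ (φs : H1 lo hi T) (ys : DualSpace lo hi T m), IsSaddlePoint A b L g c φs ys ∧
            ∃ k : ℕ → ℕ, StrictMono k ∧
              Tendsto (fun j => toWeakSpace ℝ (H1 lo hi T) (ergodicAverage φ (k j)))
                atTop (𝓝 (toWeakSpace ℝ (H1 lo hi T) φs)) ∧
              Tendsto (fun j => toWeakSpace ℝ (DualSpace lo hi T m) (ergodicAverage y (k j)))
                atTop (𝓝 (toWeakSpace ℝ (DualSpace lo hi T m) ys))) := by
  obtain ⟨hGp, hGc, hGl, ℓ, hℓ⟩ := primalFunctional_properties hΩ hT hg c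
  have hFp : EProper (dualFunctional L : DualSpace lo hi T m → EReal) := eproper_dualFunctional
  have hFc := econvex_dualFunctional (lo := lo) (hi := hi) (T := T) hLmeas hLconvex
  have hFl := lowerSemicontinuous_dualFunctional (lo := lo) (hi := hi) (T := T) hLmeas hLlsc
    hLcoercive
  obtain ⟨K, hK, hKnorm⟩ := exists_couplingCLM (m := m) hA hb
  refine ⟨fun φ y α h => saddleObjective_eq_controlObjective φ y α h,
    fun y hy => exists_control_of_dualFunctional_ne_top hLmeas hy,
    H1.existsUnique_hasTimeTraces hΩ hT, ⟨hGp, hGc, hGl⟩, ⟨hFp, hFc, hFl⟩,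
    ⟨eproper_conjugate hFp dualFunctional_nonneg, econvex_conjugate hFp,
      lowerSemicontinuous_conjugate hFp,
      conjugate_conjugate hFp hFc hFl dualFunctional_nonneg dualFunctional_zero⟩,
    integrable_couplingDensity hA hb, K, hK, abs_coupling_le hA hb, hKnorm, fun τ hτ => ?_, ?_⟩
  · refine ⟨fun φ y₀ => ?_, fun y φ₀ => ?_⟩
    · simp only [isDualUpdate_iff hK]
      exact existsUnique_isMinOn_eProxObjective hFp hFc hFl _ 0
        (fun y => by simpa using dualFunctional_nonneg y) (by positivity) y₀
    · simp only [isPrimalUpdate_iff hK]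
      have hs : (0 : ℝ) < 1 / (2 * τ) := by positivity
      have h := existsUnique_isMinOn_eProxObjective (H := H1 lo hi T) hGp
      have hex := h hGc hGl (K.flip y) ℓ hℓ hs φ₀
      exact hex
  · rintro ⟨φ₀, y₀, hsad⟩ τφ τρm hτφ hτρm hτ φ φt y hiter
    obtain ⟨hφ₀, hy₀, hsad'⟩ := (isSaddlePoint_iff hK hGp φ₀ y₀).1 hsad
    have hd : ∀ l, IsMinOn (eProxObjective (dualFunctional L) (-K (φt l)) (1 / (2 * τρm)) (y l))
        univ (y (l + 1)) := fun l => (isDualUpdate_iff hK _ _ _ _).1 (hiter l).1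
    have hp : ∀ l, IsMinOn (eProxObjective (primalFunctional g c) (K.flip (y (l + 1)))
        (1 / (2 * τφ)) (φ l)) univ (φ (l + 1)) :=
      fun l => (isPrimalUpdate_iff hK _ _ _ _).1 (hiter l).2.1
    have hx : ∀ l, φt (l + 1) = (2 : ℝ) • φ (l + 1) - φ l := fun l => (hiter l).2.2
    have herg := ergodic_convergence (X := H1 lo hi T) (Y := DualSpace lo hi T m) K
      (h := dualFunctional L) hGp
    have hstep := herg hGc hGl hFp hFc hFl hτφ hτρm hτ φ φt y hd
    have hlim := hstep hp hx hφ₀ hy₀ hsad'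
    obtain ⟨φs, ys, hφs, hys, hs, k, hk, hlimφ, hlimy⟩ := hlim
    have hwφ := tendsto_toWeakSpace (H := H1 lo hi T) hlimφ
    have hwy := tendsto_toWeakSpace (H := DualSpace lo hi T m) hlimy
    have hs' := (isSaddlePoint_iff hK hGp φs ys).2 ⟨hφs, hys, hs⟩
    exact ⟨φs, ys, hs', k, hk, hwφ, hwy⟩
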